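/- **Hypernets.** Let $\mathbb{O}$ be a set of operations, partitioned into active and passive ones; each operation $\phi$ has a number of eager arguments $m_\phi$ and a list of thunk arities $n_1,\dots,n_r$. Vertex labels are $\star$, $\diamond$ and $T^n(\star)$ ($n\in\mathbb{N}$). Typed edge labels are: operations $\phi : \star\Rightarrow \star^{\otimes m_\phi}\otimes T^{n_1}(\star)\otimes\dots\otimes T^{n_r}(\star)$; instance $\star\Rightarrow\diamond$; atom $\diamond\Rightarrow\star$; tokens $?,\checkmark,\lightning:\star\Rightarrow\star$ (search, value, rewrite); for $\ell\in\{\star,\diamond\}$, weakening $\epsilon\Rightarrow\ell$ and contraction $\ell\otimes\ell\Rightarrow\ell$; hole labels, countably many of each type. A *hypernet* is a finite hypergraph with labelled vertices, whose edges have lists of distinct sources and of distinct targets, in which every vertex is a source of at most one and a target of at most one edge, with ordered lists of inputs (the vertices that are target of no edge) and outputs (source of no edge), no vertex being both; each edge is labelled by an edge label of matching type, or it is a *box*, labelled by a hypernet of type $\star\Rightarrow\star^{\otimes n}\otimes\diamond^{\otimes h}$ (the nesting being finite), the box having type $T^{n-k}(\star)\Rightarrow\star^{\otimes k}\otimes\diamond^{\otimes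 h}$ for some $k\le n$. The type of a hypernet is given by the labels of its inputs and outputs. Hypernets are identified up to isomorphism. An edge is *shallow* if it is not inside a box. Unless called a context, a hypernet has no holes. A *context* may have holes, each hole label occurring at most once, at any depth; it is *simple* if it has exactly one hole and that hole is shallow. $\mathcal{C}[\chi]$ denotes a context whose only hole label is $\chi$. Plugging a hypernet or context into a hole of the same type replaces the hole edge and identifies inputs (outputs) with the sources (targets) of the hole; plugging a context is defined if it shares no hole label with the remaining holes. *Focus-free* means without tokens at any depth; *focussed* means with exactly one token, which is shallow, whose source and target differ, and for which it is not the case that its source is an input and its target is an output. $|\dot G|$ is obtained from $\dot G$ by removing the token and identifying its source and target, and $\mathsf{t};G$ from $G$ by attaching a $\mathsf{t}$-token to its unique input. In a focussed context the token is *entering* if it is an incoming edge of a hole. A hypernet is *one-way* if no nonempty path of operation edges leads from an input labelled $\star$ to an output labelled $\star$. **The machine.** A *state* is a focussed hypernet of type $\star\Rightarrow\epsilon$; a state $\dot G$ is *final* if $\dot G=\checkmark;|\dot G|$. For a local rule $\dot G\mapsto\dot G'$ there is a transition $\mathcal{C}[\dot G]\to\mathcal{C}[\dot G']$ for every focus-free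 simple context $\mathcal{C}:\star\Rightarrow\epsilon$ for which both are states. *Search transitions* come from the interaction rules: $?$ at a source of a contraction (with label $\star$) becomes $\lightning$; $?$ at an instance becomes $\checkmark$; $?$ at the source of an operation moves, as $?$, to its first eager target; $\checkmark$ at an eager target that is not the last moves, as $?$, to the next eager target; $\checkmark$ at the last eager target moves back to the source of the operation and becomes $\lightning$ if the operation is active and $\checkmark$ if it is passive; if the operation has no eager argument, $?$ at its source becomes that token. *Copy transitions* come from the contraction rules. A *contraction tree* is a hypernet $T:\star^{\otimes n}\Rightarrow\star$ built of contractions and weakenings at $\star$ only, whose output is reachable from every vertex. A *copyable* hypernet $H:\star\Rightarrow\star^{\otimes k}\otimes\diamond^{\otimes h}$ is focus-free and consists of an instance edge, or of an operation edge together with a box at each of its thunk targets. For a contraction tree $T:\star^{\otimes(n+1)}\Rightarrow\star$ and a copyable $H$, the left-hand side is $T$ followed by $H$, with a $\lightning$-token at the first input of $T$; on the right-hand side, a $?$-token leads from that input to a copy of $H$, the tree $T$ with a weakening at its first input is followed by another copy of $H$, and, for each $j$, the $j$-th outputs $x,y$ of the two copies are joined into one by contractions $\otimes(x,\otimes(y,w))$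 with $w$ a weakening. A *behaviour* $B_\mathbb{O}$ is an arbitrary set of pairs of states $\dot G\to\dot G'$, the *compute transitions*, such that $\dot G$ has a $\lightning$-token that is an incoming edge of an active operation edge, and $\dot G'$ has a $?$-token. *Rewrite transitions* are copy and compute transitions. The universal abstract machine $\mathcal{U}(\mathbb{O},B_\mathbb{O})$ has the states above, and as transitions $\to$ the search and rewrite transitions. A state is *stuck* if it is not final and has no transition. A state $\dot G$ is *rooted* if search transitions lead from $?;|\dot G|$ to $\dot G$. The machine is *deterministic* if every state has at most one successor, and *refocusing* if every transition from a rooted state leads to a rooted state. **Refinement.** For a relation $Q$ on $\mathbb{N}$ and states, $\dot G_1\mathrel{\dot\preceq_Q}\dot G_2$ means: whenever $\dot G_1\to^{k_1}\dot N_1$ with $\dot N_1$ final, there are $k_2$ and a final $\dot N_2$ with $k_1\mathrel{Q}k_2$ and $\dot G_2\to^{k_2}\dot N_2$; $\dot\simeq_Q$ is $\dot\preceq_Q$ in both directions. For a set $\mathbb{C}$ of contexts and focus-free $H_1,H_2$ of the same type, $H_1\preceq^{\mathbb{C}}_Q H_2$ means: for all focus-free $\mathcal{C}[\chi]\in\mathbb{C}$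 such that $?;\mathcal{C}[H_1]$ and $?;\mathcal{C}[H_2]$ are states, $?;\mathcal{C}[H_1]\mathrel{\dot\preceq_Q}\,?;\mathcal{C}[H_2]$. **Templates and robustness.** A *pre-template* $\vartriangleleft$ is a relation on focus-free hypernets that only relates hypernets of the same type. A *$\mathbb{C}$-specimen* $(\dot{\mathcal{C}};\vec{H^1};\vec{H^2})$ of $\vartriangleleft$ consists of a focussed context $\dot{\mathcal{C}}$ with $|\dot{\mathcal{C}}|\in\mathbb{C}$ and hypernets $H^1_\chi\vartriangleleft H^2_\chi$ of the type of $\chi$, for each hole $\chi$ of $\dot{\mathcal{C}}$, such that $\dot{\mathcal{C}}[\vec{H^1}]$ and $\dot{\mathcal{C}}[\vec{H^2}]$ are states. A pair $(\dot N_1,\dot N_2)$ of states is a *quasi-$\mathbb{C}$-specimen up to $(R,R')$* if there is a $\mathbb{C}$-specimen $(\dot{\mathcal{C}};\vec{H^1};\vec{H^2})$ such that the tokens of $\dot{\mathcal{C}},\dot N_1,\dot N_2$ have the same label and, if $\dot N_1,\dot N_2$ are rooted, then so are $\dot{\mathcal{C}}[\vec{H^1}]$ and $\dot{\mathcal{C}}[\vec{H^2}]$,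 with $\dot N_1\mathrel{R}\dot{\mathcal{C}}[\vec{H^1}]$ and $\dot{\mathcal{C}}[\vec{H^2}]\mathrel{R'}\dot N_2$. $\vartriangleleft$ is a *$(\mathbb{C},Q,Q')$-template* if for all $H_1\vartriangleleft H_2$ one of $H_1,H_2$ is one-way (output-closure), and, for every $\mathbb{C}$-specimen whose context has an entering $?$-token, one of the following holds (input-safety): (I) $\dot{\mathcal{C}}[\vec{H^1}]$ and $\dot{\mathcal{C}}[\vec{H^2}]$ both lead, by $\to^*$, to stuck states; (II) there are a $\mathbb{C}$-specimen $(\dot{\mathcal{C}}';\vec{H'^1};\vec{H'^2})$, with a token that is neither a rewrite token nor entering, and $k_1,k_2\in\mathbb{N}$ with $(1+k_1)\mathrel{Q}k_2$, $\dot{\mathcal{C}}[\vec{H^1}]\to^{1+k_1}\dot{\mathcal{C}}'[\vec{H'^1}]$ and $\dot{\mathcal{C}}[\vec{H^2}]\to^{k_2}\dot{\mathcal{C}}'[\vec{H'^2}]$; (III) there are a quasi-$\mathbb{C}$-specimen $(\dot N_1,\dot N_2)$ up to $(\dot\simeq_{Q'},\dot\simeq_{Q'})$, whose token is not a rewrite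 token, and $k_1,k_2\in\mathbb{N}$ with $(1+k_1)\mathrel{Q}(1+k_2)$, $\dot{\mathcal{C}}[\vec{H^1}]\to^{1+k_1}\dot N_1$ and $\dot{\mathcal{C}}[\vec{H^2}]\to^{1+k_2}\dot N_2$. $\vartriangleleft$ is *$(\mathbb{C},Q,Q',Q'')$-robust relative to* a rewrite transition $\dot N\to\dot N'$ if, for every $\mathbb{C}$-specimen with $\dot{\mathcal{C}}[\vec{H^1}]=\dot N$ whose context has a rewrite token that is not entering, one of the following holds: (I) $\dot{\mathcal{C}}[\vec{H^1}]$ or $\dot{\mathcal{C}}[\vec{H^2}]$ is not rooted; (II) $\dot N'\to^*\dot N''$ for some stuck $\dot N''$; (III) there are a quasi-$\mathbb{C}$-specimen $(\dot N_1,\dot N_2)$ up to $(\dot\preceq_{Q'},\dot\preceq_{Q''})$, whose token is not a rewrite token, and $k_1,k_2\in\mathbb{N}$ with $(1+k_1)\mathrel{Q}k_2$, $\dot N'\to^{k_1}\dot N_1$ and $\dot{\mathcal{C}}[\vec{H^2}]\to^{k_2}\dot N_2$. A triple $(Q,Q',Q'')$ of preorders on $\mathbb{N}$ is *reasonable* if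 $Q$ is closed under addition ($k_1\mathrel{Q}k_2$ and $l_1\mathrel{Q}l_2$ imply $(k_1+l_1)\mathrel{Q}(k_2+l_2)$), $Q'\subseteq{\ge}$, $Q'\subseteq Q''$, and $a\mathrel{Q'}b\mathrel{Q}c\mathrel{Q''}d$ implies $a\mathrel{Q}d$. **Theorem.** Suppose that the universal abstract machine $\mathcal{U}(\mathbb{O},B_\mathbb{O})$ is deterministic and refocusing. Let $\mathbb{C}$ be a set of contexts that is closed under plugging (the plugging of a member of $\mathbb{C}$ into a hole of a member of $\mathbb{C}$ is in $\mathbb{C}$ whenever it is defined), $(Q,Q',Q'')$ a reasonable triple, and $\vartriangleleft$ a pre-template. 1. If $\vartriangleleft$ is a $(\mathbb{C},Q,Q')$-template and is $(\mathbb{C},Q,Q',Q'')$-robust relative to all rewrite transitions, then $G_1\vartriangleleft G_2$ implies $G_1\preceq^{\mathbb{C}}_Q G_2$. 2. If $\vartriangleleft$ is a $(\mathbb{C},Q^{-1},Q')$-template and the converse $\vartriangleleft^{-1}$ is $(\mathbb{C},Q,Q',Q'')$-robust relative to all rewrite transitions, then $G_1\vartriangleleft G_2$ implies $G_2\preceq^{\mathbb{C}}_Q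 G_1$. -/

import Mathlib

universe u

namespace Spartan

/-! ### Labels -/

/-- A set of operations, partitioned into active and passive ones.  The operation `φ` takes
`eager φ` eager arguments, and one thunk binding `n` variables for each entry `n` of `thunks φ`. -/
structure OpSet where
  Op : Type u
  active : Op → Prop
  eager : Op → ℕ
  thunks : Op → List ℕ

/-- The two vertex labels at which contractions and weakenings exist. -/
inductive Wire : Type
  | star
  | dia

/-- Vertex labels: `⋆`, `◇`, and `Tⁿ(⋆)`. -/
inductive VLabel : Type
  | wire (w : Wire)
  | thunk (n : ℕ)

/-- The vertex label `⋆`. -/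
abbrev VLabel.star : VLabel := .wire .star

/-- The vertex label `◇`. -/
abbrev VLabel.dia : VLabel := .wire .dia

/-- Token labels: search `?`, value `✓`, rewrite `↯`. -/
inductive Token : Type
  | search
  | value
  | rewrite

/-- Hole labels.  They are typed, with countably many labels of each type. -/
structure Hole : Type where
  name : ℕ
  dom : List VLabel
  cod : List VLabel

/-- Edge labels other than hypernets: the labels of the operation set `S`, and the hole labels. -/
inductive ELabel (S : OpSet.{u}) : Type u
  | op (φ : S.Op)
  | inst
  | token (t : Token)
  | atom
  | weak (w : Wire)
  | contr (w : Wire)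
  | hole (χ : Hole)

namespace ELabel

variable {S : OpSet.{u}}

/-- The source type of an edge label. -/
def dom : ELabel S → List VLabel
  | op _ => [.star]
  | inst => [.star]
  | token _ => [.star]
  | atom => [.dia]
  | weak _ => []
  | contr w => [.wire w, .wire w]
  | hole χ => χ.dom

/-- The target type of an edge label. -/
def cod : ELabel S → List VLabel
  | op φ => List.replicate (S.eager φ) .star ++ (S.thunks φ).map .thunk
  | inst => [.dia]
  | token _ => [.star]
  | atom => [.star]
  | weak w => [.wire w]
  | contr w => [.wire w]
  | hole χ => χ.cod

end ELabel

/-! ### Hypernets -/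

/-- Raw data of a nested interfaced labelled hypergraph.  There are edges with a label in
`ELabel S`, and box edges, i.e. edges labelled with a hypernet, their content. -/
structure PreNet (S : OpSet.{u}) : Type (max 1 u) where
  /-- Vertices. -/
  V : Type
  /-- Edges that are not boxes. -/
  E : Type
  /-- Box edges. -/
  B : Type
  /-- Vertex labels. -/
  vlab : V → VLabel
  /-- Source lists. -/
  src : E ⊕ B → List V
  /-- Target lists. -/
  tgt : E ⊕ B → List V
  /-- Edge labels. -/
  lab : E → ELabel S
  /-- Contents of boxes. -/
  content : B → PreNet S
  /-- The list of inputs. -/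
  ins : List V
  /-- The list of outputs. -/
  outs : List V

namespace PreNet

variable {S : OpSet.{u}}

/-- `G : dom ⇒ cod`. -/
def HasType (G : PreNet S) (dom cod : List VLabel) : Prop :=
  G.ins.map G.vlab = dom ∧ G.outs.map G.vlab = cod

/-- The conditions on the shallow part of a hypernet. -/
structure ShallowWF (G : PreNet S) : Prop where
  finite_V : Finite G.V
  finite_E : Finite G.E
  finite_B : Finite G.B
  src_nodup : ∀ e, (G.src e).Nodup
  tgt_nodup : ∀ e, (G.tgt e).Nodup
  src_unique : ∀ v e e', v ∈ G.src e → v ∈ G.src e' → e = e'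
  tgt_unique : ∀ v e e', v ∈ G.tgt e → v ∈ G.tgt e' → e = e'
  lab_dom : ∀ e, (G.src (.inl e)).map G.vlab = (G.lab e).dom
  lab_cod : ∀ e, (G.tgt (.inl e)).map G.vlab = (G.lab e).cod
  /-- A box with content of type `⋆ ⇒ ⋆ⁿ ⊗ ◇ʰ` has type `Tⁿ⁻ᵏ(⋆) ⇒ ⋆ᵏ ⊗ ◇ʰ` for some `k ≤ n`. -/
  box_type : ∀ b, ∃ n k h : ℕ, k ≤ n ∧
    (G.content b).HasType [.star] (List.replicate n .star ++ List.replicate h .dia) ∧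
    (G.src (.inr b)).map G.vlab = [.thunk (n - k)] ∧
    (G.tgt (.inr b)).map G.vlab = List.replicate k .star ++ List.replicate h .dia
  ins_nodup : G.ins.Nodup
  outs_nodup : G.outs.Nodup
  mem_ins : ∀ v, v ∈ G.ins ↔ ∀ e, v ∉ G.tgt e
  mem_outs : ∀ v, v ∈ G.outs ↔ ∀ e, v ∉ G.src e
  ins_outs : ∀ v, ¬ (v ∈ G.ins ∧ v ∈ G.outs)

/-- Well-formed nested hypergraphs, i.e. (holed) hypernets. -/
inductive WF : PreNet S → Prop
  | intro (G : PreNet S) (shallow : G.ShallowWF) (deep : ∀ b, WF (G.content b)) : WF G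

/-- Isomorphism: bijections of vertices and edges that preserve all the data, where box contents
are compared up to isomorphism. -/
def Iso : PreNet S → PreNet S → Prop
  | mk V E B vlab src tgt lab content ins outs, G' =>
    ∃ (fV : V ≃ G'.V) (fE : E ≃ G'.E) (fB : B ≃ G'.B),
      (∀ v, G'.vlab (fV v) = vlab v) ∧
      (∀ e, G'.src (Sum.map fE fB e) = (src e).map fV) ∧
      (∀ e, G'.tgt (Sum.map fE fB e) = (tgt e).map fV) ∧
      (∀ e, G'.lab (fE e) = lab e) ∧
      (∀ b, Iso (content b) (G'.content (fB b))) ∧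
      G'.ins = ins.map fV ∧ G'.outs = outs.map fV

theorem Iso.refl (G : PreNet S) : Iso G G := by
  induction G with
  | mk V E B vlab src tgt lab content ins outs ih =>
    refine ⟨Equiv.refl V, Equiv.refl E, Equiv.refl B, fun _ => rfl, fun e => ?_, fun e => ?_,
      fun _ => rfl, ih, (List.map_id ins).symm, (List.map_id outs).symm⟩
    · cases e <;> exact (List.map_id _).symm
    · cases e <;> exact (List.map_id _).symm

/-- Auxiliary: inverting a bijection that maps one list to another. -/
theorem map_symm_eq {α β : Type} (f : α ≃ β) {l : List α} {l' : List β} (h : l' = l.map f) :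
    l = l'.map f.symm := by
  subst h
  simp

theorem Iso.symm {G G' : PreNet S} (h : Iso G G') : Iso G' G := by
  induction G generalizing G' with
  | mk V E B vlab src tgt lab content ins outs ih =>
    cases G' with
    | mk V' E' B' vlab' src' tgt' lab' content' ins' outs' =>
    obtain ⟨fV, fE, fB, h1, h2, h3, h4, h5, h6, h7⟩ := h
    change V ≃ V' at fV
    change E ≃ E' at fE
    change B ≃ B' at fB
    change ∀ v, vlab' (fV v) = vlab v at h1
    change ∀ e, src' (Sum.map fE fB e) = (src e).map fV at h2
    change ∀ e, tgt' (Sum.map fE fB e) = (tgt e).map fV at h3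
    change ∀ e, lab' (fE e) = lab e at h4
    change ∀ b, Iso (content b) (content' (fB b)) at h5
    have key : ∀ e, Sum.map fE fB (Sum.map fE.symm fB.symm e) = e := by
      rintro (e | b) <;> simp
    refine ⟨fV.symm, fE.symm, fB.symm, fun v => ?_, fun e => ?_, fun e => ?_, fun e => ?_,
      fun b => ?_, map_symm_eq fV h6, map_symm_eq fV h7⟩
    · change vlab (fV.symm v) = vlab' v
      rw [← h1, fV.apply_symm_apply]
    · exact map_symm_eq fV ((congrArg src' (key e)).symm.trans (h2 _))
    · exact map_symm_eq fV ((congrArg tgt' (key e)).symm.trans (h3 _))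
    · change lab (fE.symm e) = lab' e
      rw [← h4, fE.apply_symm_apply]
    · refine ih (fB.symm b) ?_
      have := h5 (fB.symm b)
      rwa [fB.apply_symm_apply] at this

theorem Iso.trans {G₁ G₂ G₃ : PreNet S} (h : Iso G₁ G₂) (h' : Iso G₂ G₃) : Iso G₁ G₃ := by
  induction G₁ generalizing G₂ G₃ with
  | mk V E B vlab src tgt lab content ins outs ih =>
    cases G₂ with
    | mk V' E' B' vlab' src' tgt' lab' content' ins' outs' =>
    obtain ⟨fV, fE, fB, h1, h2, h3, h4, h5, h6, h7⟩ := h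
    obtain ⟨gV, gE, gB, k1, k2, k3, k4, k5, k6, k7⟩ := h'
    change V ≃ V' at fV
    change E ≃ E' at fE
    change B ≃ B' at fB
    have key : ∀ e, Sum.map (fE.trans gE) (fB.trans gB) e =
        Sum.map gE gB (Sum.map fE fB e) := by
      rintro (e | b) <;> rfl
    have comp : ∀ (l : List V), l.map (fV.trans gV) = (l.map fV).map gV := by
      intro l
      rw [List.map_map]
      rfl
    refine ⟨fV.trans gV, fE.trans gE, fB.trans gB, fun v => (k1 (fV v)).trans (h1 v),
      fun e => ?_, fun e => ?_, fun e => (k4 (fE e)).trans (h4 e),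
      fun b => ih b (h5 b) (k5 (fB b)), ?_, ?_⟩
    · rw [key, comp, k2]
      exact congrArg (List.map gV) (h2 e)
    · rw [key, comp, k3]
      exact congrArg (List.map gV) (h3 e)
    · rw [comp, k6]
      exact congrArg (List.map gV) h6
    · rw [comp, k7]
      exact congrArg (List.map gV) h7

instance setoid (S : OpSet.{u}) : Setoid (PreNet S) where
  r := Iso
  iseqv := ⟨Iso.refl, Iso.symm, Iso.trans⟩

/-- Edges at any depth that are not boxes. -/
def DeepEdge : PreNet S → Type
  | mk _ E B _ _ _ _ content _ _ => E ⊕ (Σ b : B, DeepEdge (content b))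

/-- The label of an edge at any depth. -/
def deepLab : (G : PreNet S) → G.DeepEdge → ELabel S
  | mk _ _ _ _ _ _ lab _ _ _, .inl e => lab e
  | mk _ _ _ _ _ _ _ content _ _, .inr x => deepLab (content x.1) x.2

/-- The label `l` occurs in `G`, at some depth. -/
def Occurs (G : PreNet S) (l : ELabel S) : Prop := ∃ x, G.deepLab x = l

/-- There is no token, at any depth. -/
def FocusFree (G : PreNet S) : Prop := ∀ t, ¬ G.Occurs (.token t)

/-- There is no hole, at any depth. -/
def HoleFree (G : PreNet S) : Prop := ∀ χ, ¬ G.Occurs (.hole χ)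

/-- Contexts: each hole label occurs at most once, at any depth. -/
def IsContext (G : PreNet S) : Prop :=
  G.WF ∧ ∀ χ x y, G.deepLab x = .hole χ → G.deepLab y = .hole χ → x = y

/-- `G` is a context whose only hole label is `χ`, i.e. a context `G[χ]`. -/
def IsContextOn (G : PreNet S) (χ : Hole) : Prop :=
  G.IsContext ∧ ∀ χ', G.Occurs (.hole χ') ↔ χ' = χ

/-- Simple contexts: there is a single hole, and it is shallow. -/
def IsSimpleContext (G : PreNet S) (χ : Hole) : Prop :=
  G.IsContextOn χ ∧ ∃ e, G.lab e = .hole χ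

/-- Focus-free hypernets without holes. -/
def IsFocusFreeNet (G : PreNet S) : Prop := G.WF ∧ G.FocusFree ∧ G.HoleFree

/-- The shallow edge `e` is a token with label `t`. -/
def IsTokenEdge (G : PreNet S) (e : G.E) (t : Token) : Prop := G.lab e = .token t

/-- `G` has a shallow token with label `t`. -/
def HasToken (t : Token) (G : PreNet S) : Prop := ∃ e, G.IsTokenEdge e t

/-- Focussed: there is exactly one token, which is shallow, self-acyclic and not exposed. -/
def Focussed (G : PreNet S) : Prop :=
  (∃! e, ∃ t, G.IsTokenEdge e t) ∧
  (∀ b, (G.content b).FocusFree) ∧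
  (∀ e t, G.IsTokenEdge e t → G.src (.inl e) ≠ G.tgt (.inl e)) ∧
  (∀ e t, G.IsTokenEdge e t →
    ¬ ((∃ v ∈ G.src (.inl e), v ∈ G.ins) ∧ ∃ v ∈ G.tgt (.inl e), v ∈ G.outs))

/-- `|G|`: remove the token edge and identify its source and its target.  (Both have the same
label, so that the choice of a representative by `Quot.out` does not matter.) -/
noncomputable def underlying (G : PreNet S) : PreNet S :=
  let r : G.V → G.V → Prop := fun v w =>
    ∃ e t, G.IsTokenEdge e t ∧ v ∈ G.src (.inl e) ∧ w ∈ G.tgt (.inl e)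
  mk (Quot r) {e : G.E // ¬ ∃ t, G.IsTokenEdge e t} G.B
    (fun q => G.vlab q.out)
    (fun e => (G.src (e.map Subtype.val id)).map (Quot.mk r))
    (fun e => (G.tgt (e.map Subtype.val id)).map (Quot.mk r))
    (fun e => G.lab e.1)
    G.content
    (G.ins.map (Quot.mk r))
    (G.outs.map (Quot.mk r))

/-- `t ;_i G`: connect a token edge to the input of `G` with index `i` (counted from `0`).  The
new vertex `none` is the source of the token, and the new input with index `i`. -/
def attach (t : Token) (i : ℕ) (G : PreNet S) : PreNet S :=
  mk (Option G.V) (Option G.E) G.B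
    (fun v => v.elim .star G.vlab)
    (fun e => match e with
      | .inl none => [none]
      | .inl (some e) => (G.src (.inl e)).map some
      | .inr b => (G.src (.inr b)).map some)
    (fun e => match e with
      | .inl none => (G.ins[i]?).toList.map some
      | .inl (some e) => (G.tgt (.inl e)).map some
      | .inr b => (G.tgt (.inr b)).map some)
    (fun e => e.elim (.token t) G.lab)
    G.content
    ((G.ins.map some).set i none)
    (G.outs.map some)

/-- `t ; G`, for a hypernet `G` with a unique input. -/
def start (t : Token) (G : PreNet S) : PreNet S := G.attach t 0

/-- The token is an incoming edge of a hole. -/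
def Entering (G : PreNet S) : Prop :=
  ∃ e t f χ v, G.IsTokenEdge e t ∧ G.lab f = .hole χ ∧ v ∈ G.tgt (.inl e) ∧ v ∈ G.src (.inl f)

/-- There is an operation edge from `v` to `w`. -/
def OpStep (G : PreNet S) (v w : G.V) : Prop :=
  ∃ e φ, G.lab e = .op φ ∧ v ∈ G.src (.inl e) ∧ w ∈ G.tgt (.inl e)

/-- There is an edge from `v` to `w`. -/
def EdgeStep (G : PreNet S) (v w : G.V) : Prop := ∃ e, v ∈ G.src e ∧ w ∈ G.tgt e

/-- One-way hypernets: no operation path leads from an input of type `⋆` to an output of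
type `⋆`. -/
def OneWay (G : PreNet S) : Prop :=
  ∀ v ∈ G.ins, ∀ w ∈ G.outs, G.vlab v = .star → G.vlab w = .star →
    ¬ Relation.TransGen G.OpStep v w

/-- States: focussed hypernets, without holes, of type `⋆ ⇒ ε`. -/
def IsState (G : PreNet S) : Prop :=
  G.WF ∧ G.HoleFree ∧ G.Focussed ∧ G.HasType [.star] []

/-! ### Plugging -/

section Plug

open Classical

/-- The vertex of `C` with which the vertex `v` of `H` is identified, when `H` is plugged into the
edge `e` of `C`: the source (target) of `e` that corresponds to `v` if `v` is an input (output)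
of `H`, and none otherwise. -/
noncomputable def glue {V : Type} (srcs tgts : List V) (H : PreNet S) (v : H.V) : Option V :=
  if v ∈ H.ins then srcs[H.ins.idxOf v]?
  else if v ∈ H.outs then tgts[H.outs.idxOf v]?
  else none

/-- The shallow hole edges of `C` with a label `χ ∈ D`, together with their labels. -/
abbrev PlugEdge (D : Set Hole) (C : PreNet S) : Type :=
  {p : C.E × Hole // C.lab p.1 = .hole p.2 ∧ p.2 ∈ D}

/-- The vertex of `C` with which a vertex of `σ χ` is identified, if any. -/
noncomputable def glueAt (D : Set Hole) (σ : Hole → PreNet S) (C : PreNet S) (p : PlugEdge D C) :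
    (σ p.1.2).V → Option C.V :=
  glue (C.src (.inl p.1.1)) (C.tgt (.inl p.1.1)) (σ p.1.2)

/-- The vertices that result from plugging. -/
abbrev PlugV (D : Set Hole) (σ : Hole → PreNet S) (C : PreNet S) : Type :=
  C.V ⊕ (Σ p : PlugEdge D C, {v : (σ p.1.2).V // glueAt D σ C p v = none})

/-- The vertex that a vertex of `σ χ` becomes. -/
noncomputable def plugVertex (D : Set Hole) (σ : Hole → PreNet S) (C : PreNet S)
    (p : PlugEdge D C) (v : (σ p.1.2).V) : PlugV D σ C :=
  if h : glueAt D σ C p v = none then .inr ⟨p, v, h⟩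
  else .inl ((glueAt D σ C p v).get (Option.isSome_iff_ne_none.2 h))

/-- Every shallow hole edge with a label `χ ∈ D` is replaced with the hypernet `σ χ`, and the
contents of the boxes of `C` are replaced with `content'`. -/
noncomputable def plugShallow (D : Set Hole) (σ : Hole → PreNet S) (C : PreNet S)
    (content' : C.B → PreNet S) : PreNet S where
  V := PlugV D σ C
  E := {e : C.E // ¬ ∃ χ ∈ D, C.lab e = .hole χ} ⊕ (Σ p : PlugEdge D C, (σ p.1.2).E)
  B := C.B ⊕ (Σ p : PlugEdge D C, (σ p.1.2).B)
  vlab := fun v => match v with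
    | .inl v => C.vlab v
    | .inr x => (σ x.1.1.2).vlab x.2.1
  src := fun e => match e with
    | .inl (.inl e) => (C.src (.inl e.1)).map .inl
    | .inl (.inr x) => ((σ x.1.1.2).src (.inl x.2)).map (plugVertex D σ C x.1)
    | .inr (.inl b) => (C.src (.inr b)).map .inl
    | .inr (.inr x) => ((σ x.1.1.2).src (.inr x.2)).map (plugVertex D σ C x.1)
  tgt := fun e => match e with
    | .inl (.inl e) => (C.tgt (.inl e.1)).map .inl
    | .inl (.inr x) => ((σ x.1.1.2).tgt (.inl x.2)).map (plugVertex D σ C x.1)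
    | .inr (.inl b) => (C.tgt (.inr b)).map .inl
    | .inr (.inr x) => ((σ x.1.1.2).tgt (.inr x.2)).map (plugVertex D σ C x.1)
  lab := fun e => match e with
    | .inl e => C.lab e.1
    | .inr x => (σ x.1.1.2).lab x.2
  content := fun b => match b with
    | .inl b => content' b
    | .inr x => (σ x.1.1.2).content x.2
  ins := C.ins.map .inl
  outs := C.outs.map .inl

/-- Simultaneous plugging: every hole edge, at any depth, with a label `χ ∈ D` is replaced with
the hypernet `σ χ`. -/
noncomputable def plug (D : Set Hole) (σ : Hole → PreNet S) : PreNet S → PreNet S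
  | mk V E B vlab src tgt lab content ins outs =>
    plugShallow D σ (mk V E B vlab src tgt lab content ins outs) fun b => plug D σ (content b)

end Plug

/-- `C[σ]`: plugging into all the holes. -/
noncomputable def plugAll (C : PreNet S) (σ : Hole → PreNet S) : PreNet S := C.plug Set.univ σ

/-- Plugging `H` into the hole `χ`, and leaving all other holes. -/
noncomputable def plugOne (C : PreNet S) (χ : Hole) (H : PreNet S) : PreNet S :=
  C.plug {χ} (fun _ => H)

/-! ### Interaction rules -/

/-- Vertices of the hypernets that consist of a token and an edge with one source. -/
inductive RuleV (n : ℕ) : Type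
  | root
  | mid
  | out (i : Fin n)

/-- An operation edge together with a token; the token is at the source of the operation edge if
`pos = none`, and at its target with index `k` if `pos = some k`. -/
def opNet (t : Token) (φ : S.Op) (pos : Option (Fin (ELabel.op φ : ELabel S).cod.length)) :
    PreNet S :=
  mk (RuleV (ELabel.op φ : ELabel S).cod.length) Bool Empty
    (fun v => match v with
      | .root => .star
      | .mid => .star
      | .out i => (ELabel.op φ : ELabel S).cod.get i)
    -- `false` is the token edge, and `true` is the operation edge
    (fun e => match e, pos with
      | .inl false, none => [.root]
      | .inl true, none => [.mid]
      | .inl false, some _ => [.mid]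
      | .inl true, some _ => [.root])
    (fun e => match e, pos with
      | .inl false, none => [.mid]
      | .inl true, none => (List.finRange _).map .out
      | .inl false, some k => [.out k]
      | .inl true, some k => (List.finRange _).map fun i => if i = k then .mid else .out i)
    (fun e => match e with
      | false => .token t
      | true => .op φ)
    Empty.elim
    [.root]
    ((List.finRange _).map .out)

/-- A token followed by an instance edge. -/
def instNet (S : OpSet.{u}) (t : Token) : PreNet S :=
  mk (RuleV 1) Bool Empty
    (fun v => match v with
      | .root => .star
      | .mid => .star
      | .out _ => .dia)
    (fun e => match e with
      | .inl false => [.root]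
      | .inl true => [.mid])
    (fun e => match e with
      | .inl false => [.mid]
      | .inl true => [.out 0])
    (fun e => match e with
      | false => .token t
      | true => .inst)
    Empty.elim
    [.root]
    [.out 0]

/-- A token followed by a contraction edge, at its first source if `left`, and at its second
source otherwise; `out 0` is the other source, and `out 1` is the target, of the contraction. -/
def contrNet (S : OpSet.{u}) (t : Token) (left : Bool) : PreNet S :=
  mk (RuleV 2) Bool Empty
    (fun _ => .star)
    (fun e => match e with
      | .inl false => [.root]
      | .inl true => if left then [.mid, .out 0] else [.out 0, .mid])
    (fun e => match e with
      | .inl false => [.mid]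
      | .inl true => [.out 1])
    (fun e => match e with
      | false => .token t
      | true => .contr .star)
    Empty.elim
    (if left then [.root, .out 0] else [.out 0, .root])
    [.out 1]

/-- The token label that results from the evaluation of all eager arguments of `φ`. -/
def IsResultToken (φ : S.Op) (t : Token) : Prop :=
  (S.active φ ∧ t = .rewrite) ∨ (¬ S.active φ ∧ t = .value)

/-- The interaction rules. -/
inductive InteractionRule : PreNet S → PreNet S → Prop
  /-- A search token at a contraction becomes a rewrite token. -/
  | rule1 (left : Bool) : InteractionRule (contrNet S .search left) (contrNet S .rewrite left)
  /-- A search token at an instance becomes a value token. -/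
  | rule2 : InteractionRule (instNet S .search) (instNet S .value)
  /-- A search token proceeds to the first eager argument of an operation. -/
  | rule3 (φ : S.Op) (k : Fin (ELabel.op φ : ELabel S).cod.length) (h : 0 < S.eager φ)
      (hk : k.val = 0) :
      InteractionRule (opNet .search φ none) (opNet .search φ (some k))
  /-- A value token at an eager argument becomes a search token at the next eager argument. -/
  | rule4 (φ : S.Op) (k k' : Fin (ELabel.op φ : ELabel S).cod.length)
      (h : k.val + 1 < S.eager φ) (hk : k'.val = k.val + 1) :
      InteractionRule (opNet .value φ (some k)) (opNet .search φ (some k'))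
  /-- A value token at the last eager argument returns to the operation. -/
  | rule5a (φ : S.Op) (k : Fin (ELabel.op φ : ELabel S).cod.length)
      (h : k.val + 1 = S.eager φ) (t : Token) (ht : IsResultToken φ t) :
      InteractionRule (opNet .value φ (some k)) (opNet t φ none)
  /-- The degenerate case of an operation without eager arguments. -/
  | rule5b (φ : S.Op) (h : S.eager φ = 0) (t : Token) (ht : IsResultToken φ t) :
      InteractionRule (opNet .search φ none) (opNet t φ none)

/-! ### Contraction rules -/

/-- Contraction trees of type `⋆ⁿ ⇒ ⋆`: all edges are contractions and weakenings at `⋆`, and the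
unique output is reachable from every vertex. -/
def IsContractionTree (n : ℕ) (G : PreNet S) : Prop :=
  G.WF ∧ IsEmpty G.B ∧ (∀ v, G.vlab v = .star) ∧
  (∀ e, G.lab e = .weak .star ∨ G.lab e = .contr .star) ∧
  G.HasType (List.replicate n .star) [.star] ∧
  ∀ o ∈ G.outs, ∀ v, Relation.ReflTransGen G.EdgeStep v o

/-- The type `⋆ᵏ ⊗ ◇ʰ`, as a list of wires. -/
def wires (k h : ℕ) : List Wire := List.replicate k .star ++ List.replicate h .dia

/-- Copyable hypernets `⋆ ⇒ ⋆ᵏ ⊗ ◇ʰ`: an instance edge, or an operation edge each of whose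
thunk targets is the source of a box edge. -/
def IsCopyable (k h : ℕ) (G : PreNet S) : Prop :=
  G.IsFocusFreeNet ∧ G.HasType [.star] ((wires k h).map .wire) ∧
  ∃ e, (∀ e', e' = e) ∧ G.src (.inl e) = G.ins ∧
    ((G.lab e = .inst ∧ IsEmpty G.B) ∨
      ((∃ φ, G.lab e = .op φ) ∧ ∀ b, ∀ v ∈ G.src (.inr b), v ∈ G.tgt (.inl e)))

/-- Vertices for both sides of a contraction rule. -/
inductive CopyV (n m : ℕ) : Type
  /-- source of the token -/
  | tokSrc
  /-- target of the token -/
  | tokTgt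
  /-- the inputs of the contraction tree that are not at the token -/
  | leaf (i : Fin n)
  /-- the output of the contraction tree -/
  | root
  /-- the outputs -/
  | out (j : Fin m)

/-- The additional vertices for the right-hand side of a contraction rule. -/
inductive CopyV' (m : ℕ) : Type
  /-- the input of the contraction tree where the token was -/
  | leaf
  /-- outputs of the copy at the token -/
  | copy₁ (j : Fin m)
  /-- outputs of the copy at the contraction tree -/
  | copy₂ (j : Fin m)
  /-- targets of weakenings in the distributor -/
  | weak (j : Fin m)
  /-- targets of inner contractions in the distributor -/
  | inner (j : Fin m)

/-- Edges for the right-hand side of a contraction rule. -/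
inductive CopyE' (m : ℕ) : Type
  | token
  | leafWeak
  | tree
  | copy₁
  | copy₂
  | distOuter (j : Fin m)
  | distInner (j : Fin m)
  | distWeak (j : Fin m)

/-- The hole for the contraction tree. -/
def treeHole (n : ℕ) : Hole := ⟨0, List.replicate (n + 1) .star, [.star]⟩

/-- The holes for the copyable hypernet (`i = 1`) and for its additional copy (`i = 2`). -/
def copyHole (i : ℕ) (ws : List Wire) : Hole := ⟨i, [.star], ws.map .wire⟩

/-- The shape of the left-hand side: a rewrite token at the first input of the contraction tree,
whose output is the input of the copyable hypernet. -/
def copyLeft (S : OpSet.{u}) (n : ℕ) (ws : List Wire) : PreNet S :=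
  mk (CopyV n ws.length) (Fin 3) Empty
    (fun v => match v with
      | .out j => .wire (ws.get j)
      | _ => .star)
    (fun e => match e with
      | .inl 0 => [.tokSrc]
      | .inl 1 => .tokTgt :: (List.finRange n).map .leaf
      | .inl 2 => [.root])
    (fun e => match e with
      | .inl 0 => [.tokTgt]
      | .inl 1 => [.root]
      | .inl 2 => (List.finRange _).map .out)
    (fun e => match e with
      | 0 => .token .rewrite
      | 1 => .hole (treeHole n)
      | 2 => .hole (copyHole 1 ws))
    Empty.elim
    (.tokSrc :: (List.finRange n).map .leaf)
    ((List.finRange _).map .out)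

/-- The shape of the right-hand side: a search token at one copy of the copyable hypernet; the
contraction tree, with a weakening at its first input, at the other copy; the outputs of the two
copies are shared by the distributors `D_{k,2}` and `D_{h,2}`, i.e. by a contraction tree
`⊗(x, ⊗(y, weakening))` for each output. -/
def copyRight (S : OpSet.{u}) (n : ℕ) (ws : List Wire) : PreNet S :=
  mk (CopyV n ws.length ⊕ CopyV' ws.length) (CopyE' ws.length) Empty
    (fun v => match v with
      | .inl (.out j) => .wire (ws.get j)
      | .inl _ => .star
      | .inr .leaf => .star
      | .inr (.copy₁ j) => .wire (ws.get j)
      | .inr (.copy₂ j) => .wire (ws.get j)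
      | .inr (.weak j) => .wire (ws.get j)
      | .inr (.inner j) => .wire (ws.get j))
    (fun e => match e with
      | .inl .token => [.inl .tokSrc]
      | .inl .leafWeak => []
      | .inl .tree => .inr .leaf :: (List.finRange n).map fun i => .inl (.leaf i)
      | .inl .copy₁ => [.inl .tokTgt]
      | .inl .copy₂ => [.inl .root]
      | .inl (.distOuter j) => [.inr (.copy₁ j), .inr (.inner j)]
      | .inl (.distInner j) => [.inr (.copy₂ j), .inr (.weak j)]
      | .inl (.distWeak _) => [])
    (fun e => match e with
      | .inl .token => [.inl .tokTgt]
      | .inl .leafWeak => [.inr .leaf]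
      | .inl .tree => [.inl .root]
      | .inl .copy₁ => (List.finRange _).map fun j => .inr (.copy₁ j)
      | .inl .copy₂ => (List.finRange _).map fun j => .inr (.copy₂ j)
      | .inl (.distOuter j) => [.inl (.out j)]
      | .inl (.distInner j) => [.inr (.inner j)]
      | .inl (.distWeak j) => [.inr (.weak j)])
    (fun e => match e with
      | .token => .token .search
      | .leafWeak => .weak .star
      | .tree => .hole (treeHole n)
      | .copy₁ => .hole (copyHole 1 ws)
      | .copy₂ => .hole (copyHole 2 ws)
      | .distOuter j => .contr (ws.get j)
      | .distInner j => .contr (ws.get j)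
      | .distWeak j => .weak (ws.get j))
    Empty.elim
    (.inl .tokSrc :: (List.finRange n).map fun i => .inl (.leaf i))
    ((List.finRange _).map fun j => .inl (.out j))

/-- The contraction rules, for a contraction tree `T` and a copyable hypernet `H`. -/
inductive ContractionRule : PreNet S → PreNet S → Prop
  | copy (n k h : ℕ) (T H : PreNet S) (hT : T.IsContractionTree (n + 1)) (hH : H.IsCopyable k h) :
      ContractionRule
        ((copyLeft S n (wires k h)).plugAll fun χ => if χ.name = 0 then T else H)
        ((copyRight S n (wires k h)).plugAll fun χ => if χ.name = 0 then T else H)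

end PreNet

/-! ### The universal abstract machine -/

/-- Hypernets (holed, and possibly ill-formed), up to isomorphism. -/
def Hypernet (S : OpSet.{u}) : Type (max 1 u) := Quotient (PreNet.setoid S)

/-- The isomorphism class. -/
def PreNet.toNet {S : OpSet.{u}} (G : PreNet S) : Hypernet S := Quotient.mk _ G

namespace Hypernet

variable {S : OpSet.{u}}

/-- The property `P`, which is to be invariant under isomorphism, holds for the class `X`. -/
def Sat (X : Hypernet S) (P : PreNet S → Prop) : Prop := ∃ G : PreNet S, G.toNet = X ∧ P G

/-- The class of states. -/
def IsState (X : Hypernet S) : Prop := X.Sat PreNet.IsState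

/-- The state `X` is final: it equals `✓ ; |X|`. -/
def IsFinal (X : Hypernet S) : Prop :=
  X.Sat fun G => G.IsState ∧ X = (G.underlying.start .value).toNet

/-- Transitions that apply a local rule in a focus-free simple context. -/
def LocalStep (rule : PreNet S → PreNet S → Prop) (X Y : Hypernet S) : Prop :=
  ∃ (N N' C : PreNet S) (χ : Hole), rule N N' ∧
    C.IsSimpleContext χ ∧ C.FocusFree ∧ C.HasType [.star] [] ∧
    N.HasType χ.dom χ.cod ∧ N'.HasType χ.dom χ.cod ∧
    X = (C.plugOne χ N).toNet ∧ Y = (C.plugOne χ N').toNet ∧ X.IsState ∧ Y.IsState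

/-- Search transitions. -/
def Search : Hypernet S → Hypernet S → Prop := LocalStep PreNet.InteractionRule

/-- Copy transitions. -/
def Copy : Hypernet S → Hypernet S → Prop := LocalStep PreNet.ContractionRule

/-- The state `X` is rooted: search transitions lead from `? ; |X|` to `X`. -/
def Rooted (X : Hypernet S) : Prop :=
  X.Sat fun G => G.IsState ∧
    Relation.ReflTransGen Search (G.underlying.start .search).toNet X

end Hypernet

/-- A behaviour of the operation set: a set of compute transitions between states.  The token of
the first state is a rewrite token that is an incoming edge of an active operation edge, and the
token of the second state is a search token. -/
structure Behaviour (S : OpSet.{u}) where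
  compute : Hypernet S → Hypernet S → Prop
  isState_left : ∀ X Y, compute X Y → X.IsState
  isState_right : ∀ X Y, compute X Y → Y.IsState
  active_left : ∀ X Y, compute X Y → X.Sat fun G =>
    ∃ e f φ v, G.IsTokenEdge e .rewrite ∧ G.lab f = .op φ ∧ S.active φ ∧
      v ∈ G.tgt (.inl e) ∧ v ∈ G.src (.inl f)
  search_right : ∀ X Y, compute X Y → Y.Sat (PreNet.HasToken .search)

/-- `r^k`: sequences of `k` steps. -/
def StepsN {α : Type*} (r : α → α → Prop) : ℕ → α → α → Prop
  | 0, x, y => x = y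
  | k + 1, x, y => ∃ z, r x z ∧ StepsN r k z y

namespace Behaviour

open Hypernet

variable {S : OpSet.{u}} (B : Behaviour S)

/-- Rewrite transitions: copy transitions and compute transitions. -/
def Rewrite (X Y : Hypernet S) : Prop := Copy X Y ∨ B.compute X Y

/-- Transitions of the universal abstract machine. -/
def Step (X Y : Hypernet S) : Prop := Search X Y ∨ B.Rewrite X Y

/-- The machine is deterministic. -/
def Deterministic : Prop := ∀ X Y Z, B.Step X Y → B.Step X Z → Y = Z

/-- The machine is refocusing: every transition preserves rootedness. -/
def Refocusing : Prop := ∀ X Y, B.Step X Y → X.Rooted → Y.Rooted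

/-- Stuck states. -/
def Stuck (X : Hypernet S) : Prop := X.IsState ∧ ¬ X.IsFinal ∧ ¬ ∃ Y, B.Step X Y

/-! ### Refinement -/

/-- State refinement up to `Q`. -/
def StateRefines (Q : ℕ → ℕ → Prop) (X₁ X₂ : Hypernet S) : Prop :=
  ∀ k₁ N₁, N₁.IsFinal → StepsN B.Step k₁ X₁ N₁ →
    ∃ k₂ N₂, N₂.IsFinal ∧ Q k₁ k₂ ∧ StepsN B.Step k₂ X₂ N₂

/-- State equivalence up to `Q`. -/
def StateEquiv (Q : ℕ → ℕ → Prop) (X₁ X₂ : Hypernet S) : Prop :=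
  B.StateRefines Q X₁ X₂ ∧ B.StateRefines Q X₂ X₁

/-- Contextual refinement in `𝒞` up to `Q`. -/
def CtxtRefines (𝒞 : Set (Hypernet S)) (Q : ℕ → ℕ → Prop) (X₁ X₂ : Hypernet S) : Prop :=
  ∀ (C H₁ H₂ : PreNet S) (χ : Hole), H₁.toNet = X₁ → H₂.toNet = X₂ →
    C.toNet ∈ 𝒞 → C.IsContextOn χ → C.FocusFree →
    H₁.HasType χ.dom χ.cod → H₂.HasType χ.dom χ.cod →
    ((C.plugOne χ H₁).start .search).IsState → ((C.plugOne χ H₂).start .search).IsState →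
    B.StateRefines Q ((C.plugOne χ H₁).start .search).toNet
      ((C.plugOne χ H₂).start .search).toNet

/-! ### Templates and robustness -/

/-- Specimens `(C; H₁; H₂)`, where the families `H₁`, `H₂` are indexed by hole labels, and only
their values at the holes of `C` matter. -/
structure Specimen (𝒞 : Set (Hypernet S)) (T : Hypernet S → Hypernet S → Prop)
    (C : PreNet S) (H₁ H₂ : Hole → PreNet S) : Prop where
  isContext : C.IsContext
  focussed : C.Focussed
  mem : C.underlying.toNet ∈ 𝒞
  related : ∀ χ, C.Occurs (.hole χ) → T (H₁ χ).toNet (H₂ χ).toNet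
  type₁ : ∀ χ, C.Occurs (.hole χ) → (H₁ χ).HasType χ.dom χ.cod
  type₂ : ∀ χ, C.Occurs (.hole χ) → (H₂ χ).HasType χ.dom χ.cod
  isState₁ : (C.plugAll H₁).IsState
  isState₂ : (C.plugAll H₂).IsState

/-- Quasi-specimens up to `(R, R')`, with token label `t`. -/
def QuasiSpecimen (𝒞 : Set (Hypernet S)) (T : Hypernet S → Hypernet S → Prop)
    (R R' : Hypernet S → Hypernet S → Prop) (t : Token) (N₁ N₂ : Hypernet S) : Prop :=
  N₁.IsState ∧ N₂.IsState ∧ ∃ C H₁ H₂, Specimen 𝒞 T C H₁ H₂ ∧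
    C.HasToken t ∧ N₁.Sat (PreNet.HasToken t) ∧ N₂.Sat (PreNet.HasToken t) ∧
    (N₁.Rooted → N₂.Rooted →
      (C.plugAll H₁).toNet.Rooted ∧ (C.plugAll H₂).toNet.Rooted ∧
      R N₁ (C.plugAll H₁).toNet ∧ R' (C.plugAll H₂).toNet N₂)

/-- Input-safety. -/
def InputSafe (𝒞 : Set (Hypernet S)) (Q Q' : ℕ → ℕ → Prop)
    (T : Hypernet S → Hypernet S → Prop) : Prop :=
  ∀ C H₁ H₂, Specimen 𝒞 T C H₁ H₂ → C.HasToken .search → C.Entering →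
    (∃ N₁ N₂, B.Stuck N₁ ∧ B.Stuck N₂ ∧
      Relation.ReflTransGen B.Step (C.plugAll H₁).toNet N₁ ∧
      Relation.ReflTransGen B.Step (C.plugAll H₂).toNet N₂) ∨
    (∃ C' H₁' H₂' k₁ k₂, Specimen 𝒞 T C' H₁' H₂' ∧
      ¬ C'.HasToken .rewrite ∧ ¬ C'.Entering ∧ Q (1 + k₁) k₂ ∧
      StepsN B.Step (1 + k₁) (C.plugAll H₁).toNet (C'.plugAll H₁').toNet ∧
      StepsN B.Step k₂ (C.plugAll H₂).toNet (C'.plugAll H₂').toNet) ∨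
    (∃ N₁ N₂ t k₁ k₂, QuasiSpecimen 𝒞 T (B.StateEquiv Q') (B.StateEquiv Q') t N₁ N₂ ∧
      t ≠ .rewrite ∧ Q (1 + k₁) (1 + k₂) ∧
      StepsN B.Step (1 + k₁) (C.plugAll H₁).toNet N₁ ∧
      StepsN B.Step (1 + k₂) (C.plugAll H₂).toNet N₂)

/-- Robustness relative to the rewrite transition `N → N'`. -/
def RobustAt (𝒞 : Set (Hypernet S)) (Q Q' Q'' : ℕ → ℕ → Prop)
    (T : Hypernet S → Hypernet S → Prop) (N N' : Hypernet S) : Prop :=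
  ∀ C H₁ H₂, Specimen 𝒞 T C H₁ H₂ → (C.plugAll H₁).toNet = N →
    C.HasToken .rewrite → ¬ C.Entering →
    (¬ (C.plugAll H₁).toNet.Rooted ∨ ¬ (C.plugAll H₂).toNet.Rooted) ∨
    (∃ N'', B.Stuck N'' ∧ Relation.ReflTransGen B.Step N' N'') ∨
    (∃ N₁ N₂ t k₁ k₂, QuasiSpecimen 𝒞 T (B.StateRefines Q') (B.StateRefines Q'') t N₁ N₂ ∧
      t ≠ .rewrite ∧ Q (1 + k₁) k₂ ∧
      StepsN B.Step k₁ N' N₁ ∧ StepsN B.Step k₂ (C.plugAll H₂).toNet N₂)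

/-- Robustness relative to all rewrite transitions. -/
def Robust (𝒞 : Set (Hypernet S)) (Q Q' Q'' : ℕ → ℕ → Prop)
    (T : Hypernet S → Hypernet S → Prop) : Prop :=
  ∀ N N', B.Rewrite N N' → B.RobustAt 𝒞 Q Q' Q'' T N N'

end Behaviour

section Templates

variable {S : OpSet.{u}}

/-- Pre-templates: relations on focus-free hypernets that only relate hypernets of one type. -/
def IsPreTemplate (T : Hypernet S → Hypernet S → Prop) : Prop :=
  ∀ X₁ X₂, T X₁ X₂ → ∃ dom cod,
    (X₁.Sat fun G => G.IsFocusFreeNet ∧ G.HasType dom cod) ∧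
    (X₂.Sat fun G => G.IsFocusFreeNet ∧ G.HasType dom cod)

/-- Output-closure. -/
def OutputClosed (T : Hypernet S → Hypernet S → Prop) : Prop :=
  ∀ X₁ X₂, T X₁ X₂ → X₁.Sat PreNet.OneWay ∨ X₂.Sat PreNet.OneWay

/-- `(𝒞, Q, Q')`-templates. -/
def Behaviour.IsTemplate (B : Behaviour S) (𝒞 : Set (Hypernet S)) (Q Q' : ℕ → ℕ → Prop)
    (T : Hypernet S → Hypernet S → Prop) : Prop :=
  B.InputSafe 𝒞 Q Q' T ∧ OutputClosed T

/-- `𝒞` consists of contexts. -/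
def IsContextSet (𝒞 : Set (Hypernet S)) : Prop := ∀ X ∈ 𝒞, X.Sat PreNet.IsContext

/-- Closure under plugging.  The plugging of `C'` into the hole `χ` of `C` is defined if `χ` and
`C'` have the same type, and `C'` shares no hole label with the rest of `C`. -/
def ClosedUnderPlugging (𝒞 : Set (Hypernet S)) : Prop :=
  ∀ (C C' : PreNet S) (χ : Hole), C.toNet ∈ 𝒞 → C'.toNet ∈ 𝒞 →
    C.IsContext → C'.IsContext → C.Occurs (.hole χ) → C'.HasType χ.dom χ.cod →
    (∀ χ', χ' ≠ χ → C.Occurs (.hole χ') → ¬ C'.Occurs (.hole χ')) →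
    (C.plugOne χ C').toNet ∈ 𝒞

end Templates

/-- Reasonable triples of preorders on `ℕ`. -/
structure Reasonable (Q Q' Q'' : ℕ → ℕ → Prop) : Prop where
  preorder : IsPreorder ℕ Q
  preorder' : IsPreorder ℕ Q'
  preorder'' : IsPreorder ℕ Q''
  add : ∀ k₁ k₂ l₁ l₂, Q k₁ k₂ → Q l₁ l₂ → Q (k₁ + l₁) (k₂ + l₂)
  ge : ∀ k l, Q' k l → k ≥ l
  sub : ∀ k l, Q' k l → Q'' k l
  comp : ∀ a b c d, Q' a b → Q b c → Q'' c d → Q a d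

end Spartan

/-! A token is a label placed at a vertex. Every well-formed focussed hypernet is isomorphic to
`U.focus p t`, where `U` has no token and its vertex `p` is split by a `t`-token
(`Focussed.exists_focus`), and `U`, `p`, `t` are unique up to isomorphism (`Iso.of_focus`). In this
form a search transition leaves `U` alone and moves the pair `(p, t)` along a single edge
(`search_focus`, `SearchMove.search`), and plugging commutes with placing a token at a vertex of the
context (`plug_focus`). The two states of a specimen are therefore two pluggings of one context with
a token at the same context vertex.

If that token is neither a rewrite token nor searching at a source of a hole, both states behave
alike (`Specimen.step`): a possible search move uses an edge of the context, hence is possible on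
both sides. The only obstacle would be a value token at a target of a hole. In a rooted state the
token is reached from the input by a path of operation edges (`exists_opPath_of_rooted`); a path
that ends at a target of a hole has to cross the plugged hypernet from a ⋆-input to a ⋆-output
(`not_oneWay_of_opPath`). Both states are rooted and one of the two plugged hypernets is one-way, so
this cannot occur.

The other configurations are governed by the hypotheses: an entering search token by input-safety, a
rewrite token that is not entering by robustness. An entering rewrite token never arises, because a
search move creates rewrite tokens only at sources of contractions and operations. Hence `Related`
is a simulation that counts steps and closes up to state refinements.

Such a simulation yields refinement (`StateRefines.of_simulation`) by strong induction on the length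
of a run to a final state. Determinism forces this run through the simulated steps; the refinement
on the left, up to `Q'` contained in `≥`, does not lengthen what remains; the axioms of a reasonable
triple recombine the counts. Refocusing keeps all states rooted.

The second part is the same argument for the converse pre-template. `WeaklyInputSafe` is what both
readings of input-safety provide; there the first state may make no step, and progress is recovered
by appending one step common to both states. -/

namespace Spartan

namespace PreNet

variable {S : OpSet.{u}}

/-! ### Isomorphisms with explicit bijections -/

/-- The bijections `fV`, `fE`, `fB` form an isomorphism. -/
structure IsoBy (G G' : PreNet S) (fV : G.V ≃ G'.V) (fE : G.E ≃ G'.E) (fB : G.B ≃ G'.B) :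
    Prop where
  vlab : ∀ v, G'.vlab (fV v) = G.vlab v
  src : ∀ e, G'.src (Sum.map fE fB e) = (G.src e).map fV
  tgt : ∀ e, G'.tgt (Sum.map fE fB e) = (G.tgt e).map fV
  lab : ∀ e, G'.lab (fE e) = G.lab e
  content : ∀ b, Iso (G.content b) (G'.content (fB b))
  ins : G'.ins = G.ins.map fV
  outs : G'.outs = G.outs.map fV

/-- `Iso` is defined by recursion on constructor terms; this form applies to an arbitrary hypernet.
-/
theorem iso_iff {G G' : PreNet S} : Iso G G' ↔ ∃ fV fE fB, IsoBy G G' fV fE fB := by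
  cases G
  constructor
  · rintro ⟨fV, fE, fB, h1, h2, h3, h4, h5, h6, h7⟩
    exact ⟨fV, fE, fB, h1, h2, h3, h4, h5, h6, h7⟩
  · rintro ⟨fV, fE, fB, h1, h2, h3, h4, h5, h6, h7⟩
    exact ⟨fV, fE, fB, h1, h2, h3, h4, h5, h6, h7⟩

theorem IsoBy.iso {G G' : PreNet S} {fV fE fB} (h : IsoBy G G' fV fE fB) : Iso G G' :=
  iso_iff.2 ⟨fV, fE, fB, h⟩

theorem toNet_eq_iff {G G' : PreNet S} : G.toNet = G'.toNet ↔ Iso G G' :=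
  ⟨fun h => Quotient.exact h, fun h => Quotient.sound h⟩

theorem Iso.toNet_eq {G G' : PreNet S} (h : Iso G G') : G.toNet = G'.toNet := toNet_eq_iff.2 h

namespace IsoBy

variable {G G' : PreNet S} {fV : G.V ≃ G'.V} {fE : G.E ≃ G'.E} {fB : G.B ≃ G'.B}

theorem symm (h : IsoBy G G' fV fE fB) : IsoBy G' G fV.symm fE.symm fB.symm := by
  have key : ∀ e, Sum.map fE fB (Sum.map fE.symm fB.symm e) = e := by
    rintro (e | b) <;> simp
  refine ⟨fun v => ?_, fun e => ?_, fun e => ?_, fun e => ?_, fun b => ?_,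
    map_symm_eq fV h.ins, map_symm_eq fV h.outs⟩
  · rw [← h.vlab, fV.apply_symm_apply]
  · exact map_symm_eq fV ((congrArg G'.src (key e)).symm.trans (h.src _))
  · exact map_symm_eq fV ((congrArg G'.tgt (key e)).symm.trans (h.tgt _))
  · rw [← h.lab, fE.apply_symm_apply]
  · refine Iso.symm ?_
    have := h.content (fB.symm b)
    rwa [fB.apply_symm_apply] at this

theorem edge_surj (fE : G.E ≃ G'.E) (fB : G.B ≃ G'.B) (e' : G'.E ⊕ G'.B) :
    ∃ e, Sum.map fE fB e = e' := ⟨Sum.map fE.symm fB.symm e', by cases e' <;> simp⟩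

theorem srcE (h : IsoBy G G' fV fE fB) (e : G.E) :
    G'.src (.inl (fE e)) = (G.src (.inl e)).map fV := h.src (.inl e)

theorem tgtE (h : IsoBy G G' fV fE fB) (e : G.E) :
    G'.tgt (.inl (fE e)) = (G.tgt (.inl e)).map fV := h.tgt (.inl e)

theorem mem_src (h : IsoBy G G' fV fE fB) {v e} :
    fV v ∈ G'.src (Sum.map fE fB e) ↔ v ∈ G.src e := by
  rw [h.src]; simp

theorem mem_tgt (h : IsoBy G G' fV fE fB) {v e} :
    fV v ∈ G'.tgt (Sum.map fE fB e) ↔ v ∈ G.tgt e := by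
  rw [h.tgt]; simp

theorem mem_ins (h : IsoBy G G' fV fE fB) {v} : fV v ∈ G'.ins ↔ v ∈ G.ins := by
  rw [h.ins]; simp

theorem mem_outs (h : IsoBy G G' fV fE fB) {v} : fV v ∈ G'.outs ↔ v ∈ G.outs := by
  rw [h.outs]; simp

theorem map_vlab (h : IsoBy G G' fV fE fB) (l : List G.V) :
    (l.map fV).map G'.vlab = l.map G.vlab := by
  rw [List.map_map]
  exact List.map_congr_left fun v _ => h.vlab v

end IsoBy

theorem Iso.hasType {G G' : PreNet S} (h : Iso G G') {dom cod} (hG : G.HasType dom cod) :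
    G'.HasType dom cod := by
  obtain ⟨fV, fE, fB, h⟩ := iso_iff.1 h
  exact ⟨by rw [h.ins, h.map_vlab, hG.1], by rw [h.outs, h.map_vlab, hG.2]⟩

theorem IsoBy.shallowWF {G G' : PreNet S} {fV fE fB} (h : IsoBy G G' fV fE fB)
    (w : G.ShallowWF) : G'.ShallowWF := by
  have hs := fun e' => IsoBy.edge_surj fE fB e'
  constructor
  · exact @Finite.of_equiv _ _ w.finite_V fV
  · exact @Finite.of_equiv _ _ w.finite_E fE
  · exact @Finite.of_equiv _ _ w.finite_B fB
  · intro e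
    obtain ⟨e, rfl⟩ := hs e
    rw [h.src]
    exact (w.src_nodup e).map fV.injective
  · intro e
    obtain ⟨e, rfl⟩ := hs e
    rw [h.tgt]
    exact (w.tgt_nodup e).map fV.injective
  · intro v e e' hv hv'
    obtain ⟨e, rfl⟩ := hs e
    obtain ⟨e', rfl⟩ := hs e'
    obtain ⟨v, rfl⟩ := fV.surjective v
    rw [w.src_unique v e e' (h.mem_src.1 hv) (h.mem_src.1 hv')]
  · intro v e e' hv hv'
    obtain ⟨e, rfl⟩ := hs e
    obtain ⟨e', rfl⟩ := hs e'
    obtain ⟨v, rfl⟩ := fV.surjective v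
    rw [w.tgt_unique v e e' (h.mem_tgt.1 hv) (h.mem_tgt.1 hv')]
  · intro e
    obtain ⟨e, rfl⟩ := fE.surjective e
    rw [h.srcE, h.map_vlab, h.lab, w.lab_dom]
  · intro e
    obtain ⟨e, rfl⟩ := fE.surjective e
    rw [h.tgtE, h.map_vlab, h.lab, w.lab_cod]
  · intro b
    obtain ⟨b, rfl⟩ := fB.surjective b
    obtain ⟨n, k, m, h1, h2, h3, h4⟩ := w.box_type b
    refine ⟨n, k, m, h1, (h.content b).hasType h2, ?_, ?_⟩
    · rw [← h3, ← h.map_vlab, ← h.src (.inr b)]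
      rfl
    · rw [← h4, ← h.map_vlab, ← h.tgt (.inr b)]
      rfl
  · rw [h.ins]
    exact w.ins_nodup.map fV.injective
  · rw [h.outs]
    exact w.outs_nodup.map fV.injective
  · intro v
    obtain ⟨v, rfl⟩ := fV.surjective v
    rw [h.mem_ins, w.mem_ins]
    constructor
    · intro H e he
      obtain ⟨e, rfl⟩ := hs e
      exact H e (h.mem_tgt.1 he)
    · intro H e he
      exact H _ (h.mem_tgt.2 he)
  · intro v
    obtain ⟨v, rfl⟩ := fV.surjective v
    rw [h.mem_outs, w.mem_outs]
    constructor
    · intro H e he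
      obtain ⟨e, rfl⟩ := hs e
      exact H e (h.mem_src.1 he)
    · intro H e he
      exact H _ (h.mem_src.2 he)
  · intro v
    obtain ⟨v, rfl⟩ := fV.surjective v
    rw [h.mem_ins, h.mem_outs]
    exact w.ins_outs v

theorem WF.shallow {G : PreNet S} (w : G.WF) : G.ShallowWF := by
  cases w with
  | intro _ h _ => exact h

theorem WF.deep {G : PreNet S} (w : G.WF) (b : G.B) : (G.content b).WF := by
  cases w with
  | intro _ _ h => exact h b

theorem Iso.wf {G G' : PreNet S} (h : Iso G G') (w : G.WF) : G'.WF := by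
  induction w generalizing G' with
  | intro G sh _ ih =>
    obtain ⟨fV, fE, fB, h⟩ := iso_iff.1 h
    refine .intro _ (h.shallowWF sh) fun b => ?_
    obtain ⟨b, rfl⟩ := fB.surjective b
    exact ih b (h.content b)

/-! ### Edges at any depth -/

/-- The edges at any depth are the shallow edges and those in the boxes. -/
def deepEquiv (G : PreNet S) : G.DeepEdge ≃ G.E ⊕ (Σ b : G.B, (G.content b).DeepEdge) :=
  match G with
  | mk _ _ _ _ _ _ _ _ _ _ => Equiv.refl _

theorem deepLab_inl (G : PreNet S) (e : G.E) : G.deepLab (G.deepEquiv.symm (.inl e)) = G.lab e := by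
  cases G; rfl

theorem deepLab_inr (G : PreNet S) (b : G.B) (x : (G.content b).DeepEdge) :
    G.deepLab (G.deepEquiv.symm (.inr ⟨b, x⟩)) = (G.content b).deepLab x := by
  cases G; rfl

theorem occurs_iff {G : PreNet S} {l : ELabel S} :
    G.Occurs l ↔ (∃ e, G.lab e = l) ∨ ∃ b, (G.content b).Occurs l := by
  constructor
  · rintro ⟨x, hx⟩
    obtain ⟨x, rfl⟩ := G.deepEquiv.symm.surjective x
    obtain e | ⟨b, x⟩ := x
    · exact .inl ⟨e, by rw [← deepLab_inl, hx]⟩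
    · exact .inr ⟨b, x, by rw [← deepLab_inr, hx]⟩
  · rintro (⟨e, h⟩ | ⟨b, x, h⟩)
    · exact ⟨_, (deepLab_inl G e).trans h⟩
    · exact ⟨_, (deepLab_inr G b x).trans h⟩

/-- The bijections inside the boxes are chosen by induction on the nesting. A bijection is needed,
rather than mere agreement on which labels occur, because contexts bound the number of occurrences
of each hole label. -/
theorem Iso.exists_deepEquiv {G G' : PreNet S} (h : Iso G G') :
    ∃ f : G.DeepEdge ≃ G'.DeepEdge, ∀ x, G'.deepLab (f x) = G.deepLab x := by
  induction G generalizing G' with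
  | mk V E B vlab src tgt lab content ins outs ih =>
    obtain ⟨fV, fE, fB, h⟩ := iso_iff.1 h
    choose g hg using fun b => ih b (h.content b)
    refine ⟨((deepEquiv _).trans (Equiv.sumCongr fE (Equiv.sigmaCongr fB g))).trans
      (deepEquiv G').symm, fun x => ?_⟩
    obtain e | ⟨b, x⟩ := x
    · exact (deepLab_inl G' (fE e)).trans (h.lab e)
    · exact (deepLab_inr G' (fB b) (g b x)).trans (hg b x)

theorem Iso.occurs {G G' : PreNet S} (h : Iso G G') {l : ELabel S} (hl : G.Occurs l) :
    G'.Occurs l := by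
  obtain ⟨f, hf⟩ := h.exists_deepEquiv
  obtain ⟨x, hx⟩ := hl
  exact ⟨f x, by rw [hf, hx]⟩

theorem Iso.focusFree {G G' : PreNet S} (h : Iso G G') (hG : G.FocusFree) : G'.FocusFree :=
  fun t ht => hG t (h.symm.occurs ht)

theorem Iso.holeFree {G G' : PreNet S} (h : Iso G G') (hG : G.HoleFree) : G'.HoleFree :=
  fun t ht => hG t (h.symm.occurs ht)

theorem Iso.isContext {G G' : PreNet S} (h : Iso G G') (hG : G.IsContext) : G'.IsContext := by
  refine ⟨h.wf hG.1, fun χ x y hx hy => ?_⟩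
  obtain ⟨f, hf⟩ := h.symm.exists_deepEquiv
  exact f.injective (hG.2 χ _ _ ((hf x).trans hx) ((hf y).trans hy))

theorem FocusFree.lab_ne {G : PreNet S} (h : G.FocusFree) (e : G.E) (t : Token) :
    G.lab e ≠ .token t := fun he => h t (occurs_iff.2 (.inl ⟨e, he⟩))

theorem FocusFree.content {G : PreNet S} (h : G.FocusFree) (b : G.B) :
    (G.content b).FocusFree := fun t ht => h t (occurs_iff.2 (.inr ⟨b, ht⟩))

theorem Iso.hasToken {G G' : PreNet S} (h : Iso G G') {t : Token} (hG : G.HasToken t) :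
    G'.HasToken t := by
  obtain ⟨fV, fE, fB, h⟩ := iso_iff.1 h
  obtain ⟨e, he⟩ := hG
  exact ⟨fE e, (h.lab e).trans he⟩

theorem Iso.entering {G G' : PreNet S} (h : Iso G G') (hG : G.Entering) : G'.Entering := by
  obtain ⟨fV, fE, fB, h⟩ := iso_iff.1 h
  obtain ⟨e, t, f, χ, v, he, hf, hv, hv'⟩ := hG
  exact ⟨fE e, t, fE f, χ, fV v, (h.lab e).trans he, (h.lab f).trans hf,
    h.mem_tgt (e := .inl e) |>.2 hv, h.mem_src (e := .inl f) |>.2 hv'⟩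

theorem IsoBy.opStep {G G' : PreNet S} {fV fE fB} (h : IsoBy G G' fV fE fB) {v w}
    (hs : G.OpStep v w) : G'.OpStep (fV v) (fV w) := by
  obtain ⟨e, φ, he, hv, hw⟩ := hs
  exact ⟨fE e, φ, (h.lab e).trans he, h.mem_src (e := .inl e) |>.2 hv,
    h.mem_tgt (e := .inl e) |>.2 hw⟩

theorem Iso.oneWay {G G' : PreNet S} (h : Iso G G') (hG : G.OneWay) : G'.OneWay := by
  obtain ⟨fV, fE, fB, h⟩ := iso_iff.1 h.symm
  intro v hv w hw hv' hw' hp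
  exact hG (fV v) (h.mem_ins.2 hv) (fV w) (h.mem_outs.2 hw) ((h.vlab v).trans hv')
    ((h.vlab w).trans hw') (hp.lift fV fun _ _ => h.opStep)

theorem Iso.focussed {G G' : PreNet S} (h : Iso G G') (hG : G.Focussed) : G'.Focussed := by
  obtain ⟨fV, fE, fB, h⟩ := iso_iff.1 h
  obtain ⟨⟨e, he, hu⟩, h2, h3, h4⟩ := hG
  have ht : ∀ e t, G'.IsTokenEdge (fE e) t ↔ G.IsTokenEdge e t := fun e t => by
    rw [IsTokenEdge, h.lab, IsTokenEdge]
  refine ⟨⟨fE e, ?_, fun e' => ?_⟩, fun b => ?_, fun e' t he' => ?_, fun e' t he' => ?_⟩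
  · simpa only [ht] using he
  · obtain ⟨e', rfl⟩ := fE.surjective e'
    simp only [ht]
    exact fun H => congrArg fE (hu e' H)
  · obtain ⟨b, rfl⟩ := fB.surjective b
    exact (h.content b).focusFree (h2 b)
  · obtain ⟨e', rfl⟩ := fE.surjective e'
    rw [h.srcE, h.tgtE]
    exact fun H => h3 e' t ((ht _ _).1 he') (List.map_injective_iff.2 fV.injective H)
  · obtain ⟨e', rfl⟩ := fE.surjective e'
    rintro ⟨⟨v, hv, hv'⟩, w, hw, hw'⟩
    obtain ⟨v, rfl⟩ := fV.surjective v
    obtain ⟨w, rfl⟩ := fV.surjective w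
    exact h4 e' t ((ht _ _).1 he') ⟨⟨v, h.mem_src (e := .inl e') |>.1 hv, h.mem_ins.1 hv'⟩,
      w, h.mem_tgt (e := .inl e') |>.1 hw, h.mem_outs.1 hw'⟩

/-- Invariance under isomorphism lets `Hypernet.IsState`, which asks for some representative, be
tested on any of them. -/
theorem Iso.isState {G G' : PreNet S} (h : Iso G G') (hG : G.IsState) : G'.IsState :=
  ⟨h.wf hG.1, h.holeFree hG.2.1, h.focussed hG.2.2.1, h.hasType hG.2.2.2⟩

end PreNet

end Spartan

namespace Spartan

namespace PreNet

variable {S : OpSet.{u}}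

/-! ### Inserting a token at a vertex -/

open Classical in
/-- Splitting the vertex `p`: its half with the outgoing edge is `none`. -/
noncomputable def splitAt {V : Type} (p v : V) : Option V := if v = p then none else some v

theorem splitAt_self {V : Type} (p : V) : splitAt p p = none := by simp [splitAt]

theorem splitAt_ne {V : Type} {p v : V} (h : v ≠ p) : splitAt p v = some v := by simp [splitAt, h]

theorem splitAt_eq_none {V : Type} {p v : V} : splitAt p v = none ↔ v = p := by
  simp [splitAt]

theorem splitAt_eq_some {V : Type} {p v w : V} : splitAt p v = some w ↔ v = w ∧ v ≠ p := by
  by_cases h : v = p <;> simp [splitAt, h]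

theorem splitAt_injective {V : Type} (p : V) : Function.Injective (splitAt p) := by
  intro v w h
  by_cases hv : v = p <;> by_cases hw : w = p <;> simp_all [splitAt]

/-- The vertex `p` of `U` is replaced with a token edge. -/
noncomputable abbrev focus (U : PreNet S) (p : U.V) (t : Token) : PreNet S :=
  mk (Option U.V) (Option U.E) U.B
    (fun v => v.elim (U.vlab p) U.vlab)
    (fun e => match e with
      | .inl none => [some p]
      | .inl (some e) => (U.src (.inl e)).map (splitAt p)
      | .inr b => (U.src (.inr b)).map (splitAt p))
    (fun e => match e with
      | .inl none => [none]
      | .inl (some e) => (U.tgt (.inl e)).map some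
      | .inr b => (U.tgt (.inr b)).map some)
    (fun e => e.elim (.token t) U.lab)
    U.content
    (U.ins.map some)
    (U.outs.map (splitAt p))

section Focus

variable (U : PreNet S) (p : U.V) (t : Token)

/-- The edges of `U` as edges of `U.focus p t`. -/
def focusEdge (e : U.E ⊕ U.B) : (U.focus p t).E ⊕ (U.focus p t).B := Sum.map some id e

theorem focusEdge_cases (e : (U.focus p t).E ⊕ (U.focus p t).B) :
    e = .inl none ∨ ∃ e', e = U.focusEdge p t e' := by
  obtain (_ | e) | b := e
  · exact .inl rfl
  · exact .inr ⟨.inl e, rfl⟩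
  · exact .inr ⟨.inr b, rfl⟩

theorem focusEdge_injective : Function.Injective (U.focusEdge p t) :=
  Sum.map_injective.2 ⟨Option.some_injective _, Function.injective_id⟩

theorem focus_src (e : U.E ⊕ U.B) :
    (U.focus p t).src (U.focusEdge p t e) = (U.src e).map (splitAt p) := by
  cases e <;> rfl

theorem focus_tgt (e : U.E ⊕ U.B) :
    (U.focus p t).tgt (U.focusEdge p t e) = (U.tgt e).map some := by
  cases e <;> rfl

theorem focus_src_token : (U.focus p t).src (.inl none) = [some p] := rfl

theorem focus_tgt_token : (U.focus p t).tgt (.inl none) = [none] := rfl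

theorem focus_vlab_splitAt (v : U.V) : (U.focus p t).vlab (splitAt p v) = U.vlab v := by
  by_cases h : v = p
  · subst h
    rw [splitAt_self]
    rfl
  · rw [splitAt_ne h]
    rfl

theorem focus_map_vlab_splitAt (l : List U.V) :
    (l.map (splitAt p)).map (U.focus p t).vlab = l.map U.vlab := by
  rw [List.map_map]
  exact List.map_congr_left fun v _ => U.focus_vlab_splitAt p t v

theorem focus_map_vlab_some (l : List U.V) :
    (l.map some).map (U.focus p t).vlab = l.map U.vlab := by
  rw [List.map_map]
  rfl

theorem focus_hasType {dom cod} : (U.focus p t).HasType dom cod ↔ U.HasType dom cod := by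
  unfold HasType
  rw [← U.focus_map_vlab_some p t, ← U.focus_map_vlab_splitAt p t]

variable {U p t}

theorem focus_none_mem_src {e : U.E ⊕ U.B} :
    none ∈ (U.focus p t).src (U.focusEdge p t e) ↔ p ∈ U.src e := by
  rw [focus_src, List.mem_map]
  simp [splitAt_eq_none]

theorem focus_some_mem_src {v : U.V} {e : U.E ⊕ U.B} :
    some v ∈ (U.focus p t).src (U.focusEdge p t e) ↔ v ≠ p ∧ v ∈ U.src e := by
  rw [focus_src, List.mem_map]
  simp only [splitAt_eq_some]
  aesop

theorem focus_none_mem_tgt {e : U.E ⊕ U.B} :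
    none ∉ (U.focus p t).tgt (U.focusEdge p t e) := by
  rw [focus_tgt, List.mem_map]
  simp

theorem focus_some_mem_tgt {v : U.V} {e : U.E ⊕ U.B} :
    some v ∈ (U.focus p t).tgt (U.focusEdge p t e) ↔ v ∈ U.tgt e := by
  rw [focus_tgt, List.mem_map]
  simp

theorem focus_some_mem_ins {v : U.V} : some v ∈ (U.focus p t).ins ↔ v ∈ U.ins :=
  List.mem_map_of_injective (Option.some_injective _)

theorem focus_none_mem_ins : none ∉ (U.focus p t).ins := by
  change none ∉ U.ins.map some
  simp

theorem focus_none_mem_outs : none ∈ (U.focus p t).outs ↔ p ∈ U.outs := by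
  change none ∈ U.outs.map (splitAt p) ↔ _
  rw [List.mem_map]
  simp [splitAt_eq_none]

theorem focus_some_mem_outs {v : U.V} : some v ∈ (U.focus p t).outs ↔ v ≠ p ∧ v ∈ U.outs := by
  change some v ∈ U.outs.map (splitAt p) ↔ _
  rw [List.mem_map]
  simp only [splitAt_eq_some]
  aesop

/-- Of the two halves of `p`, `some p` keeps the incoming edge or the place among the inputs, and
`none` keeps the outgoing edge or the place among the outputs. The label ⋆ is what the type of the
token demands. -/
theorem ShallowWF.focus (w : U.ShallowWF) (hp : U.vlab p = .star) :
    (U.focus p t).ShallowWF := by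
  have hc := U.focusEdge_cases p t
  constructor
  · have := w.finite_V
    exact inferInstanceAs (Finite (Option U.V))
  · have := w.finite_E
    exact inferInstanceAs (Finite (Option U.E))
  · exact w.finite_B
  · intro e
    obtain rfl | ⟨e, rfl⟩ := hc e
    · exact List.nodup_singleton _
    · rw [focus_src]
      exact (w.src_nodup e).map (splitAt_injective p)
  · intro e
    obtain rfl | ⟨e, rfl⟩ := hc e
    · exact List.nodup_singleton _
    · rw [focus_tgt]
      exact (w.tgt_nodup e).map (Option.some_injective _)
  · intro v e e' hv hv'
    obtain rfl | ⟨e, rfl⟩ := hc e <;> obtain rfl | ⟨e', rfl⟩ := hc e'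
    · rfl
    · obtain rfl := List.mem_singleton.1 hv
      exact absurd rfl (focus_some_mem_src.1 hv').1
    · obtain rfl := List.mem_singleton.1 hv'
      exact absurd rfl (focus_some_mem_src.1 hv).1
    · cases v with
      | none => rw [w.src_unique p e e' (focus_none_mem_src.1 hv) (focus_none_mem_src.1 hv')]
      | some v =>
        rw [w.src_unique v e e' (focus_some_mem_src.1 hv).2 (focus_some_mem_src.1 hv').2]
  · intro v e e' hv hv'
    obtain rfl | ⟨e, rfl⟩ := hc e <;> obtain rfl | ⟨e', rfl⟩ := hc e'
    · rfl
    · obtain rfl := List.mem_singleton.1 hv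
      exact absurd hv' focus_none_mem_tgt
    · obtain rfl := List.mem_singleton.1 hv'
      exact absurd hv focus_none_mem_tgt
    · cases v with
      | none => exact absurd hv focus_none_mem_tgt
      | some v => rw [w.tgt_unique v e e' (focus_some_mem_tgt.1 hv) (focus_some_mem_tgt.1 hv')]
  · rintro (_ | e)
    · exact congrArg (fun l => [l]) hp
    · exact (U.focus_map_vlab_splitAt p t _).trans (w.lab_dom e)
  · rintro (_ | e)
    · exact congrArg (fun l => [l]) hp
    · exact (U.focus_map_vlab_some p t _).trans (w.lab_cod e)
  · intro b
    obtain ⟨n, k, h, h1, h2, h3, h4⟩ := w.box_type b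
    exact ⟨n, k, h, h1, h2, (U.focus_map_vlab_splitAt p t _).trans h3,
      (U.focus_map_vlab_some p t _).trans h4⟩
  · exact w.ins_nodup.map (Option.some_injective _)
  · exact w.outs_nodup.map (splitAt_injective p)
  · rintro (_ | v)
    · refine iff_of_false focus_none_mem_ins fun h => h (.inl none) ?_
      exact List.mem_singleton.2 rfl
    · rw [focus_some_mem_ins, w.mem_ins]
      constructor
      · intro h e he
        obtain rfl | ⟨e, rfl⟩ := hc e
        · exact absurd (List.mem_singleton.1 he) (by simp)
        · exact h e (focus_some_mem_tgt.1 he)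
      · exact fun h e he => h _ (focus_some_mem_tgt.2 he)
  · rintro (_ | v)
    · rw [focus_none_mem_outs, w.mem_outs]
      constructor
      · intro h e he
        obtain rfl | ⟨e, rfl⟩ := hc e
        · exact absurd (List.mem_singleton.1 he) (by simp)
        · exact h e (focus_none_mem_src.1 he)
      · exact fun h e he => h _ (focus_none_mem_src.2 he)
    · rw [focus_some_mem_outs, w.mem_outs]
      constructor
      · rintro ⟨hv, h⟩ e he
        obtain rfl | ⟨e, rfl⟩ := hc e
        · exact hv (Option.some_injective _ (List.mem_singleton.1 he))
        · exact h e (focus_some_mem_src.1 he).2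
      · intro h
        have hv : v ≠ p := by
          rintro rfl
          exact h (.inl none) (List.mem_singleton.2 rfl)
        exact ⟨hv, fun e he => h _ (focus_some_mem_src.2 ⟨hv, he⟩)⟩
  · rintro (_ | v) ⟨h, h'⟩
    · exact focus_none_mem_ins h
    · exact w.ins_outs v ⟨focus_some_mem_ins.1 h, (focus_some_mem_outs.1 h').2⟩

/-- Splitting separates an input from an output, so well-formedness with the token cannot detect a
`p` that is both; `hp` excludes it. For focussed hypernets it holds because the token is not
exposed. -/
theorem ShallowWF.of_focus (w : (U.focus p t).ShallowWF) (hp : ¬ (p ∈ U.ins ∧ p ∈ U.outs)) :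
    U.ShallowWF := by
  have hc := U.focusEdge_cases p t
  constructor
  · have : Finite (Option U.V) := w.finite_V
    exact Finite.of_injective (β := Option U.V) some (Option.some_injective _)
  · have : Finite (Option U.E) := w.finite_E
    exact Finite.of_injective (β := Option U.E) some (Option.some_injective _)
  · exact w.finite_B
  · intro e
    have := w.src_nodup (U.focusEdge p t e)
    rw [focus_src] at this
    exact this.of_map _
  · intro e
    have := w.tgt_nodup (U.focusEdge p t e)
    rw [focus_tgt] at this
    exact this.of_map _
  · intro v e e' hv hv'
    apply U.focusEdge_injective p t
    by_cases h : v = p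
    · subst h
      exact w.src_unique none _ _ (focus_none_mem_src.2 hv) (focus_none_mem_src.2 hv')
    · exact w.src_unique (some v) _ _ (focus_some_mem_src.2 ⟨h, hv⟩)
        (focus_some_mem_src.2 ⟨h, hv'⟩)
  · intro v e e' hv hv'
    apply U.focusEdge_injective p t
    exact w.tgt_unique (some v) _ _ (focus_some_mem_tgt.2 hv) (focus_some_mem_tgt.2 hv')
  · intro e
    exact (U.focus_map_vlab_splitAt p t _).symm.trans (w.lab_dom (some e))
  · intro e
    exact (U.focus_map_vlab_some p t _).symm.trans (w.lab_cod (some e))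
  · intro b
    obtain ⟨n, k, h, h1, h2, h3, h4⟩ := w.box_type b
    exact ⟨n, k, h, h1, h2, (U.focus_map_vlab_splitAt p t _).symm.trans h3,
      (U.focus_map_vlab_some p t _).symm.trans h4⟩
  · exact (show (U.ins.map some).Nodup from w.ins_nodup).of_map _
  · exact (show (U.outs.map (splitAt p)).Nodup from w.outs_nodup).of_map _
  · intro v
    rw [← focus_some_mem_ins (p := p) (t := t), w.mem_ins]
    constructor
    · exact fun h e he => h _ (focus_some_mem_tgt.2 he)
    · intro h e he
      obtain rfl | ⟨e, rfl⟩ := hc e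
      · exact absurd (List.mem_singleton.1 he) (by simp)
      · exact h e (focus_some_mem_tgt.1 he)
  · intro v
    by_cases hv : v = p
    · subst hv
      rw [← focus_none_mem_outs (p := v) (t := t), w.mem_outs]
      constructor
      · exact fun h e he => h _ (focus_none_mem_src.2 he)
      · intro h e he
        obtain rfl | ⟨e, rfl⟩ := hc e
        · exact absurd (List.mem_singleton.1 he) (by simp)
        · exact h e (focus_none_mem_src.1 he)
    · constructor
      · intro hvo e he
        exact (w.mem_outs (some v)).1 (focus_some_mem_outs.2 ⟨hv, hvo⟩) _
          (focus_some_mem_src.2 ⟨hv, he⟩)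
      · intro h
        refine (focus_some_mem_outs.1 ((w.mem_outs (some v)).2 fun e he => ?_)).2
        obtain rfl | ⟨e, rfl⟩ := hc e
        · exact hv (Option.some_injective _ (List.mem_singleton.1 he))
        · exact h e (focus_some_mem_src.1 he).2
  · rintro v ⟨h, h'⟩
    by_cases hv : v = p
    · exact hp (hv ▸ ⟨h, h'⟩)
    · exact w.ins_outs (some v) ⟨focus_some_mem_ins.2 h, focus_some_mem_outs.2 ⟨hv, h'⟩⟩

theorem WF.focus (w : U.WF) (hp : U.vlab p = .star) : (U.focus p t).WF :=
  .intro _ (w.shallow.focus hp) w.deep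

theorem occurs_focus {l : ELabel S} (h : U.Occurs l) : (U.focus p t).Occurs l := by
  obtain ⟨e, h⟩ | ⟨b, h⟩ := occurs_iff.1 h
  · exact occurs_iff.2 (.inl ⟨some e, h⟩)
  · exact occurs_iff.2 (.inr ⟨b, h⟩)

theorem occurs_of_focus {l : ELabel S} (h : (U.focus p t).Occurs l) (hl : l ≠ .token t) :
    U.Occurs l := by
  obtain ⟨_ | e, h⟩ | ⟨b, h⟩ := occurs_iff.1 h
  · exact absurd h.symm hl
  · exact occurs_iff.2 (.inl ⟨e, h⟩)
  · exact occurs_iff.2 (.inr ⟨b, h⟩)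

theorem hole_occurs_focus {χ : Hole} :
    (U.focus p t).Occurs (.hole χ) ↔ U.Occurs (.hole χ) :=
  ⟨fun h => occurs_of_focus h (by simp), occurs_focus⟩

theorem holeFree_focus : (U.focus p t).HoleFree ↔ U.HoleFree :=
  forall_congr' fun _ => not_congr hole_occurs_focus

/-- The edges of `U` at any depth, as edges of `U.focus p t`. -/
noncomputable def focusDeep (x : U.DeepEdge) : (U.focus p t).DeepEdge :=
  (U.focus p t).deepEquiv.symm (Sum.map some id (U.deepEquiv x))

theorem focusDeep_injective : Function.Injective (focusDeep (U := U) (p := p) (t := t)) :=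
  (Equiv.injective _).comp ((Sum.map_injective.2
    ⟨Option.some_injective _, Function.injective_id⟩).comp (Equiv.injective _))

theorem deepLab_focusDeep (x : U.DeepEdge) :
    (U.focus p t).deepLab (focusDeep x) = U.deepLab x := by
  obtain ⟨x, rfl⟩ := U.deepEquiv.symm.surjective x
  unfold focusDeep
  rw [Equiv.apply_symm_apply]
  obtain e | ⟨b, x⟩ := x
  · exact (deepLab_inl (U.focus p t) (some e)).trans (deepLab_inl U e).symm
  · exact (deepLab_inr (U.focus p t) b x).trans (deepLab_inr U b x).symm

theorem focusDeep_cases (x : (U.focus p t).DeepEdge) :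
    (U.focus p t).deepLab x = .token t ∨ ∃ y, x = focusDeep y := by
  obtain ⟨x, rfl⟩ := (U.focus p t).deepEquiv.symm.surjective x
  obtain (_ | e) | ⟨b, x⟩ := x
  · exact .inl (deepLab_inl (U.focus p t) none)
  · exact .inr ⟨U.deepEquiv.symm (.inl e), by simp [focusDeep]⟩
  · exact .inr ⟨U.deepEquiv.symm (.inr ⟨b, x⟩), by simp [focusDeep]⟩

theorem IsContext.of_focus (h : (U.focus p t).IsContext) (w : U.WF) : U.IsContext :=
  ⟨w, fun χ x y hx hy => focusDeep_injective (h.2 χ _ _ ((deepLab_focusDeep x).trans hx)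
    ((deepLab_focusDeep y).trans hy))⟩

theorem IsContext.focus (h : U.IsContext) (hp : U.vlab p = .star) :
    (U.focus p t).IsContext := by
  refine ⟨h.1.focus hp, fun χ x y hx hy => ?_⟩
  obtain hx' | ⟨x, rfl⟩ := focusDeep_cases x
  · simp [hx] at hx'
  obtain hy' | ⟨y, rfl⟩ := focusDeep_cases y
  · simp [hy] at hy'
  rw [h.2 χ x y ((deepLab_focusDeep x).symm.trans hx) ((deepLab_focusDeep y).symm.trans hy)]

theorem FocusFree.focussed_focus (h : U.FocusFree) (hp : ¬ (p ∈ U.ins ∧ p ∈ U.outs)) :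
    (U.focus p t).Focussed := by
  have key : ∀ (e : (U.focus p t).E) s, (U.focus p t).IsTokenEdge e s → e = none := by
    rintro (_ | e) s hs
    · rfl
    · exact absurd hs (h.lab_ne e s)
  refine ⟨⟨none, ⟨t, rfl⟩, fun e ⟨s, hs⟩ => key e s hs⟩, h.content, fun e s hs => ?_,
    fun e s hs => ?_⟩
  · obtain rfl := key e s hs
    rw [focus_src_token, focus_tgt_token]
    simp
  · obtain rfl := key e s hs
    rw [focus_src_token, focus_tgt_token]
    rintro ⟨⟨v, hv, hv'⟩, w, hw, hw'⟩
    obtain rfl := List.mem_singleton.1 hv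
    obtain rfl := List.mem_singleton.1 hw
    exact hp ⟨focus_some_mem_ins.1 hv', focus_none_mem_outs.1 hw'⟩

theorem focusFree_of_focussed_focus (h : (U.focus p t).Focussed) : U.FocusFree := by
  intro s hs
  obtain ⟨e, h'⟩ | ⟨b, h'⟩ := occurs_iff.1 hs
  · have := h.1.unique (y₁ := none) (y₂ := some e) ⟨t, rfl⟩ ⟨s, h'⟩
    simp at this
  · exact h.2.1 b s h'

theorem not_exposed_of_focussed_focus (h : (U.focus p t).Focussed) :
    ¬ (p ∈ U.ins ∧ p ∈ U.outs) := fun ⟨h1, h2⟩ =>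
  h.2.2.2 none t rfl ⟨⟨some p, List.mem_singleton.2 rfl, focus_some_mem_ins.2 h1⟩,
    none, List.mem_singleton.2 rfl, focus_none_mem_outs.2 h2⟩

theorem WF.of_focus (h : (U.focus p t).WF) (h' : (U.focus p t).Focussed) : U.WF :=
  .intro _ (h.shallow.of_focus (not_exposed_of_focussed_focus h')) h.deep

theorem WF.vlab_of_focus (h : (U.focus p t).WF) : U.vlab p = .star := by
  have := h.shallow.lab_dom none
  exact (List.cons_eq_cons.1 this).1

/-- Apart from the label of `p`, all conditions concern `U`. So a token may move to any other
⋆-vertex, and change its label, without leaving the states. -/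
theorem isState_focus : (U.focus p t).IsState ↔
    U.WF ∧ U.FocusFree ∧ U.HoleFree ∧ U.HasType [.star] [] ∧ U.vlab p = .star := by
  constructor
  · rintro ⟨h1, h2, h3, h4⟩
    exact ⟨h1.of_focus h3, focusFree_of_focussed_focus h3, holeFree_focus.1 h2,
      (U.focus_hasType p t).1 h4, h1.vlab_of_focus⟩
  · rintro ⟨h1, h2, h3, h4, h5⟩
    exact ⟨h1.focus h5, holeFree_focus.2 h3,
      h2.focussed_focus fun h => h1.shallow.ins_outs p h, (U.focus_hasType p t).2 h4⟩

theorem hasToken_focus : (U.focus p t).HasToken t := ⟨none, rfl⟩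

theorem FocusFree.eq_of_hasToken_focus (h : U.FocusFree) {s : Token}
    (hs : (U.focus p t).HasToken s) : s = t := by
  obtain ⟨_ | e, he⟩ := hs
  · exact (ELabel.token.inj he).symm
  · exact absurd he (h.lab_ne e s)

theorem entering_focus {f : U.E} {χ : Hole} (hf : U.lab f = .hole χ) (hp : p ∈ U.src (.inl f)) :
    (U.focus p t).Entering :=
  ⟨none, t, some f, χ, none, rfl, hf, List.mem_singleton.2 rfl,
    focus_none_mem_src (e := .inl f) |>.2 hp⟩

theorem FocusFree.exists_of_entering_focus (h : U.FocusFree) (he : (U.focus p t).Entering) :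
    ∃ f χ, U.lab f = .hole χ ∧ p ∈ U.src (.inl f) := by
  obtain ⟨e, s, f, χ, v, he, hf, hv, hv'⟩ := he
  obtain _ | e := e
  · obtain _ | f := f
    · cases hf
    · obtain rfl := List.mem_singleton.1 hv
      exact ⟨f, χ, hf, focus_none_mem_src (e := .inl f) |>.1 hv'⟩
  · exact absurd he (h.lab_ne e s)

end Focus

/-! ### Isomorphisms of hypernets with a token -/

theorem IsoBy.splitAt_map {V W : Type} (f : V ≃ W) (p v : V) :
    (splitAt p v).map f = splitAt (f p) (f v) := by
  by_cases h : v = p <;> simp [splitAt, h]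

theorem IsoBy.focus {U W : PreNet S} {fV fE fB} (h : IsoBy U W fV fE fB) (p : U.V) (t : Token) :
    Iso (U.focus p t) (W.focus (fV p) t) := by
  refine IsoBy.iso (fV := fV.optionCongr) (fE := fE.optionCongr) (fB := fB)
    ⟨?_, ?_, ?_, ?_, h.content, ?_, ?_⟩
  · rintro (_ | v)
    · exact h.vlab p
    · exact h.vlab v
  · have key : ∀ l : List U.V, (l.map fV).map (splitAt (fV p)) =
        (l.map (splitAt p)).map fV.optionCongr := fun l => by
      simp [Function.comp_def, IsoBy.splitAt_map]
    rintro ((_ | e) | b)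
    · rfl
    · exact (congrArg (List.map _) (h.src (.inl e))).trans (key _)
    · exact (congrArg (List.map _) (h.src (.inr b))).trans (key _)
  · have key : ∀ l : List U.V, (l.map fV).map some = (l.map some).map fV.optionCongr :=
      fun l => by simp [Function.comp_def]
    rintro ((_ | e) | b)
    · rfl
    · exact (congrArg (List.map _) (h.tgt (.inl e))).trans (key _)
    · exact (congrArg (List.map _) (h.tgt (.inr b))).trans (key _)
  · rintro (_ | e)
    · rfl
    · exact h.lab e
  · refine (congrArg (List.map some) h.ins).trans ?_
    change _ = (U.ins.map some).map fV.optionCongr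
    simp [Function.comp_def]
  · refine (congrArg (List.map _) h.outs).trans ?_
    change _ = (U.outs.map (splitAt p)).map fV.optionCongr
    simp [Function.comp_def, IsoBy.splitAt_map]

/-- As `W` has no token edge of its own, the added token edge on the left must go to the one on the
right, hence so do its source and its target. Deleting `none` from the bijections of vertices and
edges leaves an isomorphism from `U` to `W` that maps `p` to `q`. -/
theorem Iso.of_focus {U W : PreNet S} {p : U.V} {q : W.V} {s t : Token}
    (h : Iso (U.focus p t) (W.focus q s)) (hW : ∀ e t, W.lab e ≠ .token t) :
    t = s ∧ ∃ fV fE fB, IsoBy U W fV fE fB ∧ fV p = q := by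
  obtain ⟨fV, fE, fB, h⟩ := iso_iff.1 h
  change Option U.V ≃ Option W.V at fV
  change Option U.E ≃ Option W.E at fE
  change U.B ≃ W.B at fB
  have hE : fE none = none := by
    have := h.lab none
    cases hx : fE none with
    | none => rfl
    | some e =>
      rw [hx] at this
      exact absurd this (hW e t)
  have hts : t = s := by
    have := h.lab none
    rw [hE] at this
    exact (ELabel.token.inj this).symm
  have h1 := h.srcE none
  have h2 := h.tgtE none
  rw [hE, focus_src_token, focus_src_token] at h1
  rw [hE, focus_tgt_token, focus_tgt_token] at h2
  have hp : fV (some p) = some q := (List.cons_eq_cons.1 h1).1.symm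
  have hn : fV none = none := (List.cons_eq_cons.1 h2).1.symm
  -- Since `fV` fixes `none`, `Equiv.removeNone fV` is just its restriction.
  have hV' : ∀ v, some (Equiv.removeNone fV v) = fV (some v) := fun v =>
    Equiv.removeNone_some _ (Option.ne_none_iff_exists'.1 fun h => by simp [← hn] at h)
  have hE' : ∀ e, some (Equiv.removeNone fE e) = fE (some e) := fun e =>
    Equiv.removeNone_some _ (Option.ne_none_iff_exists'.1 fun h => by simp [← hE] at h)
  have hs : ∀ v, fV (splitAt p v) = splitAt q (Equiv.removeNone fV v) := fun v => by
    by_cases hv : v = p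
    · subst hv
      rw [splitAt_self, hn, Option.some_injective _ ((hV' v).trans hp), splitAt_self]
    · rw [splitAt_ne hv, splitAt_ne, hV']
      intro H
      refine hv (Option.some_injective _ (fV.injective ?_))
      rw [← hV', H, hp]
  have hm : ∀ (l : List U.V) (l' : List W.V),
      l'.map some = (l.map some).map fV → l' = l.map (Equiv.removeNone fV) := by
    intro l l' hl
    apply List.map_injective_iff.2 (Option.some_injective _)
    rw [hl, List.map_map, List.map_map]
    exact List.map_congr_left fun v _ => (hV' v).symm
  refine ⟨hts, Equiv.removeNone fV, Equiv.removeNone fE, fB, ⟨?_, ?_, ?_, ?_, h.content, ?_, ?_⟩,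
    Option.some_injective _ ((hV' p).trans hp)⟩
  · intro v
    have := h.vlab (some v)
    rw [← hV'] at this
    exact this
  · have key : ∀ (l : List U.V) (l' : List W.V),
        l'.map (splitAt q) = (l.map (splitAt p)).map fV → l' = l.map (Equiv.removeNone fV) := by
      intro l l' hl
      apply List.map_injective_iff.2 (splitAt_injective q)
      rw [hl, List.map_map, List.map_map]
      exact List.map_congr_left fun v _ => hs v
    rintro (e | b)
    · refine key _ _ ?_
      have := h.srcE (some e)
      rw [← hE'] at this
      exact this
    · exact key _ _ (h.src (.inr b))
  · rintro (e | b)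
    · refine hm _ _ ?_
      have := h.tgtE (some e)
      rw [← hE'] at this
      exact this
    · exact hm _ _ (h.tgt (.inr b))
  · intro e
    have := h.lab (some e)
    rw [← hE'] at this
    exact this
  · exact hm _ _ h.ins
  · apply List.map_injective_iff.2 (splitAt_injective q)
    refine h.outs.trans ?_
    rw [List.map_map, List.map_map]
    exact List.map_congr_left fun v _ => hs v

/-! ### Removing the token -/

theorem underlying_focus {U : PreNet S} (hU : ∀ e t, U.lab e ≠ .token t) (p : U.V) (t : Token) :
    Iso (U.focus p t).underlying U := by
  refine Iso.symm ?_
  have hr : ∀ v w : Option U.V,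
      (∃ e s, (U.focus p t).IsTokenEdge e s ∧ v ∈ (U.focus p t).src (.inl e) ∧
        w ∈ (U.focus p t).tgt (.inl e)) → v = some p ∧ w = none := by
    rintro v w ⟨_ | e, s, he, hv, hw⟩
    · exact ⟨List.mem_singleton.1 hv, List.mem_singleton.1 hw⟩
    · exact absurd he (hU e s)
  -- Each class contains exactly one `some v`; the half `none` lies in the class of `some p`, which
  -- explains the default value `p` of `getD`.
  let fV : U.V ≃ (U.focus p t).underlying.V :=
    { toFun := fun v => Quot.mk _ (some v)
      invFun := Quot.lift (fun v => v.getD p) fun v w h => by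
        obtain ⟨rfl, rfl⟩ := hr v w h
        rfl
      left_inv := fun v => rfl
      right_inv := by
        rintro ⟨_ | v⟩
        · exact Quot.sound ⟨none, t, rfl, List.mem_singleton.2 rfl, List.mem_singleton.2 rfl⟩
        · rfl }
  let fE : U.E ≃ (U.focus p t).underlying.E :=
    Equiv.ofBijective (fun e => ⟨some e, fun ⟨s, hs⟩ => hU e s hs⟩) ⟨fun e e' h =>
      Option.some_injective _ (congrArg Subtype.val h), by
        rintro ⟨_ | e, he⟩
        · exact absurd ⟨t, rfl⟩ he
        · exact ⟨e, rfl⟩⟩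
  have hmk : ∀ v, Quot.mk _ (splitAt p v) = fV v := fun v => by
    by_cases h : v = p
    · subst h
      rw [splitAt_self]
      exact (Quot.sound ⟨none, t, rfl, List.mem_singleton.2 rfl, List.mem_singleton.2 rfl⟩).symm
    · rw [splitAt_ne h]
      rfl
  have hsome : ∀ l : List U.V, (l.map some).map (Quot.mk _) = l.map fV := fun l => by
    rw [List.map_map]
    rfl
  have hsplit : ∀ l : List U.V, (l.map (splitAt p)).map (Quot.mk _) = l.map fV := fun l => by
    rw [List.map_map]
    exact List.map_congr_left fun v _ => hmk v
  refine IsoBy.iso (fV := fV) (fE := fE) (fB := Equiv.refl _)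
    ⟨fun v => ?_, ?_, ?_, fun _ => rfl, fun _ => Iso.refl _, (hsome _).symm ▸ rfl, ?_⟩
  -- The two halves of `p` carry the same label, so labels descend to the quotient and the
  -- representative picked by `Quot.out` is immaterial.
  · let L : (U.focus p t).underlying.V → VLabel := Quot.lift (U.focus p t).vlab fun v w h => by
      obtain ⟨rfl, rfl⟩ := hr v w h
      rfl
    exact congrArg L (Quot.out_eq (fV v))
  · rintro (e | b)
    · exact hsplit _
    · exact hsplit _
  · rintro (e | b)
    · exact hsome _
    · exact hsome _
  · exact hsplit _

/-- The typing of the token edge gives it a single source `a` and a single target `b`, distinct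
because the token is self-acyclic. Identifying them merges no other vertices, and splitting the
merged vertex again restores `G`. -/
theorem Focussed.exists_focus {G : PreNet S} (h : G.Focussed) (w : G.WF) :
    ∃ p t, Iso G (G.underlying.focus p t) := by
  classical
  obtain ⟨⟨e₀, ⟨t, ht⟩, hu⟩, -, h3, -⟩ := h
  have sw := w.shallow
  have hd := sw.lab_dom e₀
  have hc := sw.lab_cod e₀
  rw [show G.lab e₀ = _ from ht] at hd hc
  obtain ⟨a, ha, hav⟩ := List.map_eq_singleton_iff.1 hd
  obtain ⟨b, hb, hbv⟩ := List.map_eq_singleton_iff.1 hc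
  have hab : a ≠ b := by
    rintro rfl
    exact h3 e₀ t ht (ha.trans hb.symm)
  let r : G.V → G.V → Prop := fun v w =>
    ∃ e t, G.IsTokenEdge e t ∧ v ∈ G.src (.inl e) ∧ w ∈ G.tgt (.inl e)
  have hr : ∀ v w, r v w → v = a ∧ w = b := by
    rintro v w ⟨e, s, he, hv, hw⟩
    obtain rfl := hu e ⟨s, he⟩
    rw [ha] at hv
    rw [hb] at hw
    exact ⟨List.mem_singleton.1 hv, List.mem_singleton.1 hw⟩
  have hrab : r a b := ⟨e₀, t, ht, by simp [ha], by simp [hb]⟩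
  -- The representative other than `b` of each class; it identifies the quotient with the vertices
  -- other than `b`, and `b` itself will correspond to `none`.
  let col : Quot r → G.V := Quot.lift (fun v => if v = b then a else v) fun v w h => by
    obtain ⟨rfl, rfl⟩ := hr v w h
    simp [hab]
  have hcol : ∀ v, v ≠ b → col (Quot.mk r v) = v := fun v hv => by simp [col, hv]
  have hcolb : col (Quot.mk r b) = a := by simp [col]
  have hmk : ∀ q, Quot.mk r (col q) = q := by
    rintro ⟨v⟩
    by_cases hv : v = b
    · subst hv
      exact (congrArg (Quot.mk r) hcolb).trans (Quot.sound hrab)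
    · exact congrArg (Quot.mk r) (hcol v hv)
  have hcolne : ∀ q, col q ≠ b := by
    rintro ⟨v⟩
    by_cases hv : v = b
    · subst hv
      exact hcolb ▸ hab
    · exact (hcol v hv).symm ▸ hv
  let fV : G.V ≃ Option (Quot r) :=
    { toFun := fun v => if v = b then none else some (Quot.mk r v)
      invFun := fun q => q.elim b col
      left_inv := fun v => by
        by_cases hv : v = b
        · simp [hv]
        · simp [hv, hcol]
      right_inv := by
        rintro (_ | q)
        · simp
        · simp [hcolne, hmk] }
  have hfVb : fV b = none := by simp [fV]
  have hfV : ∀ v, v ≠ b → fV v = some (Quot.mk r v) := fun v hv => by simp [fV, hv]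
  have hfV' : ∀ v, v ≠ a → splitAt (Quot.mk r a) (Quot.mk r v) = fV v := fun v hv => by
    by_cases hv' : v = b
    · subst hv'
      rw [hfVb, splitAt_eq_none]
      exact (Quot.sound hrab).symm
    · rw [hfV v hv', splitAt_ne]
      intro H
      have := congrArg col H
      rw [hcol v hv', hcol a hab] at this
      exact hv this
  let fE : G.E ≃ Option {e : G.E // ¬ ∃ t, G.IsTokenEdge e t} :=
    { toFun := fun e => if he : ∃ t, G.IsTokenEdge e t then none else some ⟨e, he⟩
      invFun := fun e => e.elim e₀ Subtype.val
      left_inv := fun e => by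
        by_cases he : ∃ t, G.IsTokenEdge e t
        · obtain rfl := hu e he
          simp only [he, dif_pos, Option.elim_none]
        · simp [he]
      right_inv := by
        rintro (_ | ⟨e, he⟩)
        · simp only [Option.elim_none]
          exact dif_pos ⟨t, ht⟩
        · exact dif_neg he }
  have hfE₀ : fE e₀ = none := dif_pos ⟨t, ht⟩
  have hfE : ∀ e (he : ¬ ∃ t, G.IsTokenEdge e t), fE e = some ⟨e, he⟩ := fun e he => dif_neg he
  have hvl : ∀ v, G.underlying.vlab (Quot.mk r v) = G.vlab v := by
    intro v
    let L : Quot r → VLabel := Quot.lift G.vlab fun v w h => by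
      obtain ⟨rfl, rfl⟩ := hr v w h
      exact hav.trans hbv.symm
    change L (Quot.mk _ (Quot.mk r v).out) = L (Quot.mk r v)
    rw [Quot.out_eq]
  -- Only the token edge has `a` among its sources, and `a` is no output; dually for `b`, targets
  -- and inputs. So in every other list the merged vertex stands for `b` on the source side and for
  -- `a` on the target side, which is how `focus` splits it.
  have hsrc : ∀ l : List G.V, a ∉ l →
      (l.map (Quot.mk r)).map (splitAt (Quot.mk r a)) = l.map fV := fun l hl => by
    rw [List.map_map]
    exact List.map_congr_left fun v hv => hfV' v fun h => hl (h ▸ hv)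
  have htgt : ∀ l : List G.V, b ∉ l → (l.map (Quot.mk r)).map some = l.map fV := fun l hl => by
    rw [List.map_map]
    exact List.map_congr_left fun v hv => (hfV v fun h => hl (h ▸ hv)).symm
  let F := G.underlying.focus (Quot.mk r a) t
  refine ⟨Quot.mk r a, t, IsoBy.iso (fV := fV) (fE := fE) (fB := Equiv.refl _)
    ⟨fun v => ?_, ?_, ?_, fun e => ?_, fun _ => Iso.refl _, ?_, ?_⟩⟩
  · by_cases hv : v = b
    · subst hv
      exact (congrArg F.vlab hfVb).trans ((hvl a).trans (hav.trans hbv.symm))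
    · exact (congrArg F.vlab (hfV v hv)).trans (hvl v)
  · rintro (e | c)
    · by_cases he : ∃ t, G.IsTokenEdge e t
      · obtain rfl := hu e he
        refine (congrArg (fun x => F.src (.inl x)) hfE₀).trans ?_
        rw [ha]
        exact congrArg (fun x => [x]) (hfV a hab).symm
      · refine (congrArg (fun x => F.src (.inl x)) (hfE e he)).trans ?_
        refine hsrc _ fun hae => he ?_
        have : e = e₀ :=
          Sum.inl.inj (sw.src_unique a _ _ hae (ha ▸ List.mem_singleton.2 rfl))
        exact this ▸ ⟨t, ht⟩
    · refine hsrc _ fun hae => ?_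
      have := sw.src_unique a _ _ hae (ha ▸ List.mem_singleton.2 rfl)
      cases this
  · rintro (e | c)
    · by_cases he : ∃ t, G.IsTokenEdge e t
      · obtain rfl := hu e he
        refine (congrArg (fun x => F.tgt (.inl x)) hfE₀).trans ?_
        rw [hb]
        exact congrArg (fun x => [x]) hfVb.symm
      · refine (congrArg (fun x => F.tgt (.inl x)) (hfE e he)).trans ?_
        refine htgt _ fun hbe => he ?_
        have : e = e₀ :=
          Sum.inl.inj (sw.tgt_unique b _ _ hbe (hb ▸ List.mem_singleton.2 rfl))
        exact this ▸ ⟨t, ht⟩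
    · refine htgt _ fun hbe => ?_
      have := sw.tgt_unique b _ _ hbe (hb ▸ List.mem_singleton.2 rfl)
      cases this
  · by_cases he : ∃ t, G.IsTokenEdge e t
    · obtain rfl := hu e he
      exact (congrArg F.lab hfE₀).trans ht.symm
    · exact congrArg F.lab (hfE e he)
  · refine (htgt _ fun h => ?_).symm ▸ rfl
    exact (sw.mem_ins b).1 h (.inl e₀) (hb ▸ List.mem_singleton.2 rfl)
  · refine hsrc _ fun h => ?_
    exact (sw.mem_outs a).1 h (.inl e₀) (ha ▸ List.mem_singleton.2 rfl)

/-- A token at the unique input. -/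
theorem start_iso_focus {U : PreNet S} {i : U.V} (hi : U.ins = [i]) (w : ∀ e, i ∉ U.tgt e)
    (hl : U.vlab i = .star) (t : Token) : Iso (U.start t) (U.focus i t) := by
  classical
  -- In `start` the added vertex `none` is the source of the token and `some i` its target; in
  -- `focus` it is the other way round. The bijection exchanges the two.
  let g : Option U.V → Option U.V := fun v => v.elim (some i) (splitAt i)
  have hg : ∀ v, g (g v) = v := by
    rintro (_ | v)
    · simp [g, splitAt_self]
    · by_cases h : v = i
      · simp [g, h, splitAt_self]
      · simp [g, splitAt_ne h]
  let fV : Option U.V ≃ Option U.V := ⟨g, g, hg, hg⟩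
  have hsrc : ∀ l : List U.V, l.map (splitAt i) = (l.map some).map fV := fun l => by
    rw [List.map_map]
    rfl
  have htgt : ∀ l : List U.V, i ∉ l → l.map some = (l.map some).map fV := fun l hl => by
    rw [List.map_map]
    exact List.map_congr_left fun v hv => (splitAt_ne (ne_of_mem_of_not_mem hv hl)).symm
  refine IsoBy.iso (fV := fV) (fE := Equiv.refl (Option U.E)) (fB := Equiv.refl U.B)
    ⟨?_, ?_, ?_, fun e => ?_, fun _ => Iso.refl _, ?_, hsrc _⟩
  · rintro (_ | v)
    · exact hl
    · by_cases h : v = i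
      · subst h
        change (U.focus v t).vlab (splitAt v v) = _
        rw [splitAt_self]
        rfl
      · change (U.focus i t).vlab (splitAt i v) = _
        rw [splitAt_ne h]
        rfl
  · rintro ((_ | e) | b)
    · rfl
    · exact hsrc _
    · exact hsrc _
  · rintro ((_ | e) | b)
    · change [none] = ((U.ins[0]?).toList.map some).map fV
      rw [hi]
      exact congrArg (fun x => [x]) (splitAt_self i).symm
    · exact htgt _ (w _)
    · exact htgt _ (w _)
  · cases e <;> rfl
  · change U.ins.map some = ((U.ins.map some).set 0 none).map fV
    rw [hi]
    rfl

end PreNet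

end Spartan

namespace Spartan

namespace PreNet

variable {S : OpSet.{u}}

/-! ### Plugging -/

/-- Induction on the nesting of boxes. -/
theorem content_induction {P : PreNet S → Prop} (h : ∀ G, (∀ b, P (G.content b)) → P G)
    (G : PreNet S) : P G := by
  induction G with
  | mk V E B vlab src tgt lab content ins outs ih => exact h _ ih

/-- The result of plugging, with its components exposed. -/
noncomputable abbrev plugNet (D : Set Hole) (σ : Hole → PreNet S) (C : PreNet S) : PreNet S where
  V := PlugV D σ C
  E := {e : C.E // ¬ ∃ χ ∈ D, C.lab e = .hole χ} ⊕ (Σ p : PlugEdge D C, (σ p.1.2).E)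
  B := C.B ⊕ (Σ p : PlugEdge D C, (σ p.1.2).B)
  vlab := fun v => match v with
    | .inl v => C.vlab v
    | .inr x => (σ x.1.1.2).vlab x.2.1
  src := fun e => match e with
    | .inl (.inl e) => (C.src (.inl e.1)).map .inl
    | .inl (.inr x) => ((σ x.1.1.2).src (.inl x.2)).map (plugVertex D σ C x.1)
    | .inr (.inl b) => (C.src (.inr b)).map .inl
    | .inr (.inr x) => ((σ x.1.1.2).src (.inr x.2)).map (plugVertex D σ C x.1)
  tgt := fun e => match e with
    | .inl (.inl e) => (C.tgt (.inl e.1)).map .inl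
    | .inl (.inr x) => ((σ x.1.1.2).tgt (.inl x.2)).map (plugVertex D σ C x.1)
    | .inr (.inl b) => (C.tgt (.inr b)).map .inl
    | .inr (.inr x) => ((σ x.1.1.2).tgt (.inr x.2)).map (plugVertex D σ C x.1)
  lab := fun e => match e with
    | .inl e => C.lab e.1
    | .inr x => (σ x.1.1.2).lab x.2
  content := fun b => match b with
    | .inl b => (C.content b).plug D σ
    | .inr x => (σ x.1.1.2).content x.2
  ins := C.ins.map .inl
  outs := C.outs.map .inl

theorem plug_eq (D : Set Hole) (σ : Hole → PreNet S) (C : PreNet S) :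
    C.plug D σ = plugNet D σ C := by
  cases C
  rfl

/-! ### Gluing the inputs and outputs of a plugged hypernet -/

section Glue

variable {D : Set Hole} {σ : Hole → PreNet S} {C : PreNet S} {q : PlugEdge D C}
  {v : (σ q.1.2).V}

theorem plugVertex_of_none (h : glueAt D σ C q v = none) :
    plugVertex D σ C q v = .inr ⟨q, v, h⟩ := dif_pos h

theorem plugVertex_of_some {x : C.V} (h : glueAt D σ C q v = some x) :
    plugVertex D σ C q v = .inl x := by
  have h' : ¬ glueAt D σ C q v = none := by simp [h]
  refine (dif_neg h').trans (congrArg Sum.inl ?_)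
  exact Option.get_of_eq_some _ h

theorem glueAt_eq_of_plugVertex {x : C.V} (h : plugVertex D σ C q v = .inl x) :
    glueAt D σ C q v = some x := by
  cases hg : glueAt D σ C q v with
  | none => rw [plugVertex_of_none hg] at h; cases h
  | some y => rw [plugVertex_of_some hg] at h; rw [Sum.inl.inj h]

theorem glue_of_mem_ins {V : Type} {srcs tgts : List V} {H : PreNet S} {v : H.V} (h : v ∈ H.ins) :
    ∃ j : ℕ, H.ins[j]? = some v ∧ glue srcs tgts H v = srcs[j]? := by
  classical
  refine ⟨H.ins.idxOf v, ?_, ?_⟩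
  · rw [List.getElem?_idxOf h]
  · rw [glue, if_pos h]

theorem glue_of_mem_outs {V : Type} {srcs tgts : List V} {H : PreNet S} {v : H.V}
    (h' : v ∉ H.ins) (h : v ∈ H.outs) :
    ∃ j : ℕ, H.outs[j]? = some v ∧ glue srcs tgts H v = tgts[j]? := by
  classical
  refine ⟨H.outs.idxOf v, ?_, ?_⟩
  · rw [List.getElem?_idxOf h]
  · rw [glue, if_neg h', if_pos h]

theorem glue_ins {V : Type} {srcs tgts : List V} {H : PreNet S} (hn : H.ins.Nodup) {v : H.V}
    {j : ℕ} (hj : H.ins[j]? = some v) : glue srcs tgts H v = srcs[j]? := by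
  obtain ⟨k, hk, h⟩ := glue_of_mem_ins (srcs := srcs) (tgts := tgts) (List.mem_of_getElem? hj)
  rw [h]
  have hkl := (List.getElem?_eq_some_iff.1 hk).1
  rw [(List.getElem?_inj hkl hn).1 (hk.trans hj.symm)]

/-- The assumption `hv` reflects that `glue` looks among the inputs first. -/
theorem glue_outs {V : Type} {srcs tgts : List V} {H : PreNet S} (hn : H.outs.Nodup) {v : H.V}
    {j : ℕ} (hv : v ∉ H.ins) (hj : H.outs[j]? = some v) : glue srcs tgts H v = tgts[j]? := by
  obtain ⟨k, hk, h⟩ := glue_of_mem_outs (srcs := srcs) (tgts := tgts) hv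
    (List.mem_of_getElem? hj)
  rw [h]
  have hkl := (List.getElem?_eq_some_iff.1 hk).1
  rw [(List.getElem?_inj hkl hn).1 (hk.trans hj.symm)]

theorem glue_none {V : Type} {srcs tgts : List V} {H : PreNet S} {v : H.V} (h : v ∉ H.ins)
    (h' : v ∉ H.outs) : glue srcs tgts H v = none := by
  rw [glue, if_neg h, if_neg h']

theorem glue_map {V V' : Type} (f : V → V') {srcs tgts : List V} {H H' : PreNet S}
    {fV fE fB} (h : IsoBy H H' fV fE fB) (v : H.V) :
    glue (srcs.map f) (tgts.map f) H' (fV v) = (glue srcs tgts H v).map f := by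
  classical
  have key : ∀ l : List H.V, (l.map fV).idxOf (fV v) = l.idxOf v := by
    intro l
    induction l with
    | nil => rfl
    | cons a l ih =>
      have : (fV a == fV v) = (a == v) := by
        rw [Bool.eq_iff_iff]
        simp
      rw [List.map_cons, List.idxOf_cons, List.idxOf_cons, ih, this]
  by_cases h1 : v ∈ H.ins
  · rw [glue, if_pos (h.mem_ins.2 h1), glue, if_pos h1, List.getElem?_map, h.ins]
    congr 2
    convert key H.ins
  · by_cases h2 : v ∈ H.outs
    · rw [glue, if_neg (mt h.mem_ins.1 h1), if_pos (h.mem_outs.2 h2), glue, if_neg h1, if_pos h2,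
        List.getElem?_map, h.outs]
      congr 2
      convert key H.outs
    · rw [glue_none (mt h.mem_ins.1 h1) (mt h.mem_outs.1 h2), glue_none h1 h2]
      rfl

end Glue

/-- Plugging respects isomorphisms, and only depends on the holes that occur. -/
theorem Iso.plug {C C' : PreNet S} (h : Iso C C') {D D' : Set Hole} {σ σ' : Hole → PreNet S}
    (hσ : ∀ χ, Iso (σ χ) (σ' χ)) (hD : ∀ χ, C.Occurs (.hole χ) → (χ ∈ D ↔ χ ∈ D')) :
    Iso (C.plug D σ) (C'.plug D' σ') := by
  induction C using content_induction generalizing C' with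
  | h C ih =>
    obtain ⟨fV, fE, fB, h⟩ := iso_iff.1 h
    choose sV sE sB hs using fun χ => iso_iff.1 (hσ χ)
    rw [plug_eq, plug_eq]
    let g : PlugEdge D C ≃ PlugEdge D' C' :=
      { toFun := fun q => ⟨(fE q.1.1, q.1.2), (h.lab _).trans q.2.1,
          (hD _ (occurs_iff.2 (.inl ⟨_, q.2.1⟩))).1 q.2.2⟩
        invFun := fun q =>
          have hq : C.lab (fE.symm q.1.1) = .hole q.1.2 := (h.symm.lab _).trans q.2.1
          ⟨(fE.symm q.1.1, q.1.2), hq, (hD _ (occurs_iff.2 (.inl ⟨_, hq⟩))).2 q.2.2⟩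
        left_inv := fun q => by simp
        right_inv := fun q => by simp }
    have hglue : ∀ q v, glueAt D' σ' C' (g q) (sV q.1.2 v) = (glueAt D σ C q v).map fV := by
      intro q v
      have := glue_map fV (srcs := C.src (.inl q.1.1)) (tgts := C.tgt (.inl q.1.1)) (hs q.1.2) v
      rw [← h.srcE, ← h.tgtE] at this
      exact this
    let FV : PlugV D σ C ≃ PlugV D' σ' C' :=
      Equiv.sumCongr fV (Equiv.sigmaCongr g fun q => (sV q.1.2).subtypeEquiv fun v => by
        rw [hglue]
        simp)
    let FE : (plugNet D σ C).E ≃ (plugNet D' σ' C').E :=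
      Equiv.sumCongr (fE.subtypeEquiv fun e => by
        refine not_congr (exists_congr fun χ => ?_)
        rw [h.lab]
        refine and_congr_left fun he => hD χ (occurs_iff.2 (.inl ⟨e, he⟩)))
        (Equiv.sigmaCongr g fun q => sE q.1.2)
    let FB : (plugNet D σ C).B ≃ (plugNet D' σ' C').B :=
      Equiv.sumCongr fB (Equiv.sigmaCongr g fun q => sB q.1.2)
    have hFV : ∀ q v, plugVertex D' σ' C' (g q) (sV q.1.2 v) = FV (plugVertex D σ C q v) := by
      intro q v
      cases hg : glueAt D σ C q v with
      | none =>
        have hg' := hglue q v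
        rw [hg] at hg'
        rw [plugVertex_of_none hg, plugVertex_of_none hg']
        rfl
      | some x =>
        have hg' := hglue q v
        rw [hg] at hg'
        rw [plugVertex_of_some hg, plugVertex_of_some hg']
        rfl
    have hl : ∀ (q : PlugEdge D C) (l : List (σ q.1.2).V), (l.map (sV q.1.2)).map
        (plugVertex D' σ' C' (g q)) = (l.map (plugVertex D σ C q)).map FV := fun q l => by
      rw [List.map_map, List.map_map]
      exact List.map_congr_left fun v _ => hFV q v
    have hc : ∀ (l : List C.V), (l.map fV).map Sum.inl =
        ((l.map Sum.inl : List (PlugV D σ C)).map FV : List (PlugV D' σ' C')) := fun l => by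
      rw [List.map_map, List.map_map]
      rfl
    refine IsoBy.iso (fV := FV) (fE := FE) (fB := FB) ⟨?_, ?_, ?_, ?_, ?_, ?_, ?_⟩
    · rintro (v | ⟨q, v, hv⟩)
      · exact h.vlab v
      · exact (hs q.1.2).vlab v
    · rintro ((⟨e, he⟩ | ⟨q, e⟩) | (b | ⟨q, b⟩))
      · exact (congrArg (List.map _) (h.srcE e)).trans (hc _)
      · exact (congrArg (List.map _) ((hs q.1.2).srcE e)).trans (hl q _)
      · exact (congrArg (List.map _) (h.src (.inr b))).trans (hc _)
      · exact (congrArg (List.map _) ((hs q.1.2).src (.inr b))).trans (hl q _)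
    · rintro ((⟨e, he⟩ | ⟨q, e⟩) | (b | ⟨q, b⟩))
      · exact (congrArg (List.map _) (h.tgtE e)).trans (hc _)
      · exact (congrArg (List.map _) ((hs q.1.2).tgtE e)).trans (hl q _)
      · exact (congrArg (List.map _) (h.tgt (.inr b))).trans (hc _)
      · exact (congrArg (List.map _) ((hs q.1.2).tgt (.inr b))).trans (hl q _)
    · rintro (⟨e, he⟩ | ⟨q, e⟩)
      · exact h.lab e
      · exact (hs q.1.2).lab e
    · rintro (b | ⟨q, b⟩)
      · exact ih b (h.content b) fun χ hχ => hD χ (occurs_iff.2 (.inr ⟨b, hχ⟩))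
      · exact (hs q.1.2).content b
    · exact (congrArg (List.map _) h.ins).trans (hc _)
    · exact (congrArg (List.map _) h.outs).trans (hc _)

/-- Plugging into holes that do not occur. -/
theorem plug_of_not_occurs {C : PreNet S} {D : Set Hole} (σ : Hole → PreNet S)
    (h : ∀ χ ∈ D, ¬ C.Occurs (.hole χ)) : Iso C (C.plug D σ) := by
  induction C using content_induction with
  | h C ih =>
    rw [plug_eq]
    have hE : IsEmpty (PlugEdge D C) :=
      ⟨fun q => h _ q.2.2 (occurs_iff.2 (.inl ⟨_, q.2.1⟩))⟩
    let fE : C.E ≃ {e : C.E // ¬ ∃ χ ∈ D, C.lab e = .hole χ} :=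
      { toFun := fun e => ⟨e, fun ⟨χ, hχ, he⟩ => h χ hχ (occurs_iff.2 (.inl ⟨e, he⟩))⟩
        invFun := Subtype.val
        left_inv := fun _ => rfl
        right_inv := fun _ => rfl }
    refine IsoBy.iso (fV := (Equiv.sumEmpty _ _).symm) (fE := fE.trans (Equiv.sumEmpty _ _).symm)
      (fB := (Equiv.sumEmpty _ _).symm) ⟨fun _ => rfl, ?_, ?_, fun _ => rfl, fun b => ?_, rfl, rfl⟩
    · rintro (e | b) <;> rfl
    · rintro (e | b) <;> rfl
    · exact ih b fun χ hχ hb => h χ hχ (occurs_iff.2 (.inr ⟨b, hb⟩))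

/-- Plugging commutes with the insertion of a token into the context. -/
theorem plug_focus {C : PreNet S} {D : Set Hole} {σ : Hole → PreNet S}
    (hσ : ∀ q : PlugEdge D C, (σ q.1.2).ShallowWF) (p : C.V) (t : Token) :
    Iso ((plugNet D σ C).focus (.inl p) t) ((C.focus p t).plug D σ) := by
  classical
  rw [plug_eq]
  let g : PlugEdge D C ≃ PlugEdge D (C.focus p t) :=
    { toFun := fun q => ⟨(some q.1.1, q.1.2), q.2⟩
      invFun := fun q => match q with
        | ⟨(some e, χ), h⟩ => ⟨(e, χ), h⟩
        | ⟨(none, χ), h⟩ => by cases h.1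
      left_inv := fun _ => rfl
      right_inv := by
        rintro ⟨⟨_ | e, χ⟩, h⟩
        · cases h.1
        · rfl }
  -- Around a hole, the source list of the context is split by `splitAt p` and the target list by
  -- `some`, so an input and an output that are glued to `p` now go to different halves.
  have hglue : ∀ (q : PlugEdge D C) (v : (σ q.1.2).V), glueAt D σ (C.focus p t) (g q) v =
      (glueAt D σ C q v).map (if v ∈ (σ q.1.2).ins then splitAt p else some) := by
    intro q v
    change glue ((C.src (.inl q.1.1)).map (splitAt p)) ((C.tgt (.inl q.1.1)).map some) _ v =
      (glue (C.src (.inl q.1.1)) (C.tgt (.inl q.1.1)) _ v).map _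
    unfold glue
    split_ifs
    · rw [List.getElem?_map]
    · rw [List.getElem?_map]
    · rfl
  let FV : Option (PlugV D σ C) ≃ PlugV D σ (C.focus p t) :=
    { toFun := fun v => match v with
        | none => .inl none
        | some (.inl v) => .inl (some v)
        | some (.inr ⟨q, v, h⟩) => .inr ⟨g q, v, by rw [hglue, h]; rfl⟩
      invFun := fun v => match v with
        | .inl none => none
        | .inl (some v) => some (.inl v)
        | .inr ⟨⟨(some e, χ), h⟩, v, hv⟩ => some (.inr ⟨⟨(e, χ), h⟩, v, by
            have := hglue ⟨(e, χ), h⟩ v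
            exact Option.map_eq_none_iff.1 (this.symm.trans hv)⟩)
        | .inr ⟨⟨(none, χ), h⟩, v, hv⟩ => by cases h.1
      left_inv := by rintro (_ | v | ⟨q, v, h⟩) <;> rfl
      right_inv := by
        rintro ((_ | v) | ⟨⟨⟨_ | e, χ⟩, h⟩, v, hv⟩)
        · rfl
        · rfl
        · cases h.1
        · rfl }
  let FE : Option (plugNet D σ C).E ≃ (plugNet D σ (C.focus p t)).E :=
    { toFun := fun v => match v with
        | none => .inl ⟨none, by rintro ⟨χ, -, h⟩; cases h⟩
        | some (.inl e) => .inl ⟨some e.1, e.2⟩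
        | some (.inr ⟨q, e⟩) => .inr ⟨g q, e⟩
      invFun := fun v => match v with
        | .inl ⟨none, _⟩ => none
        | .inl ⟨some e, h⟩ => some (.inl ⟨e, h⟩)
        | .inr ⟨⟨(some e, χ), h⟩, x⟩ => some (.inr ⟨⟨(e, χ), h⟩, x⟩)
        | .inr ⟨⟨(none, χ), h⟩, v⟩ => by cases h.1
      left_inv := by rintro (_ | v | ⟨q, v⟩) <;> rfl
      right_inv := by
        rintro (⟨_ | v, h⟩ | ⟨⟨⟨_ | e, χ⟩, h⟩, v⟩)
        · rfl
        · rfl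
        · cases h.1
        · rfl }
  let FB : (plugNet D σ C).B ≃ (plugNet D σ (C.focus p t)).B :=
    Equiv.sumCongr (Equiv.refl _) (Equiv.sigmaCongr g fun q => Equiv.refl _)
  have hinl : ∀ v : C.V, FV (splitAt (.inl p) (.inl v)) = .inl (splitAt p v) := fun v => by
    by_cases h : v = p
    · subst h
      rw [splitAt_self, splitAt_self]
      rfl
    · rw [splitAt_ne h, splitAt_ne fun h' => h (Sum.inl.inj h')]
      rfl
  have hinr : ∀ x, FV (splitAt (.inl p) (.inr x)) = FV (some (.inr x)) := fun x => by
    rw [splitAt_ne]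
    simp
  have hsrcC : ∀ l : List C.V, (l.map (splitAt p)).map (Sum.inl : _ → PlugV D σ (C.focus p t)) =
      ((l.map Sum.inl).map (splitAt (.inl p))).map FV := fun l => by
    rw [List.map_map, List.map_map, List.map_map]
    exact List.map_congr_left fun v _ => (hinl v).symm
  have htgtC : ∀ l : List C.V, (l.map some).map (Sum.inl : _ → PlugV D σ (C.focus p t)) =
      ((l.map Sum.inl).map some).map FV := fun l => by
    rw [List.map_map, List.map_map, List.map_map]
    rfl
  have hsrc : ∀ (q : PlugEdge D C) (l : List (σ q.1.2).V), (∀ v ∈ l, v ∉ (σ q.1.2).outs) →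
      l.map (plugVertex D σ (C.focus p t) (g q)) =
      ((l.map (plugVertex D σ C q)).map (splitAt (.inl p))).map FV := fun q l hl => by
    rw [List.map_map, List.map_map]
    refine List.map_congr_left fun v hv => ?_
    have hg' := hglue q v
    cases hg : glueAt D σ C q v with
    | none =>
      rw [hg] at hg'
      rw [Function.comp, Function.comp, plugVertex_of_none hg, hinr, plugVertex_of_none hg']
      rfl
    | some x =>
      rw [hg] at hg'
      by_cases hi : v ∈ (σ q.1.2).ins
      · rw [if_pos hi] at hg'
        rw [Function.comp, Function.comp, plugVertex_of_some hg, hinl, plugVertex_of_some hg']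
      · rw [glueAt, glue_none hi (hl v hv)] at hg
        cases hg
  have htgt : ∀ (q : PlugEdge D C) (l : List (σ q.1.2).V), (∀ v ∈ l, v ∉ (σ q.1.2).ins) →
      l.map (plugVertex D σ (C.focus p t) (g q)) =
      ((l.map (plugVertex D σ C q)).map some).map FV := fun q l hl => by
    rw [List.map_map, List.map_map]
    refine List.map_congr_left fun v hv => ?_
    have hg' := hglue q v
    rw [if_neg (hl v hv)] at hg'
    cases hg : glueAt D σ C q v with
    | none =>
      rw [hg] at hg'
      rw [Function.comp, Function.comp, plugVertex_of_none hg, plugVertex_of_none hg']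
      rfl
    | some x =>
      rw [hg] at hg'
      rw [Function.comp, Function.comp, plugVertex_of_some hg, plugVertex_of_some hg']
      rfl
  -- In a well-formed plugged hypernet a source of an edge is no output and a target is no input.
  -- Hence glued sources only meet `splitAt p` and glued targets only meet `some`, in agreement with
  -- splitting `p` after plugging.
  have hso : ∀ (q : PlugEdge D C) e, ∀ v ∈ (σ q.1.2).src e, v ∉ (σ q.1.2).outs :=
    fun q e v hv hv' => ((hσ q).mem_outs v).1 hv' e hv
  have hti : ∀ (q : PlugEdge D C) e, ∀ v ∈ (σ q.1.2).tgt e, v ∉ (σ q.1.2).ins :=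
    fun q e v hv hv' => ((hσ q).mem_ins v).1 hv' e hv
  refine IsoBy.iso (fV := FV) (fE := FE) (fB := FB) ⟨?_, ?_, ?_, ?_, ?_, ?_, ?_⟩
  · rintro (_ | v | ⟨q, v, hv⟩) <;> rfl
  · rintro ((_ | ⟨e, he⟩ | ⟨q, e⟩) | (b | ⟨q, b⟩))
    · rfl
    · exact hsrcC _
    · exact hsrc q _ (hso q _)
    · exact hsrcC _
    · exact hsrc q _ (hso q _)
  · rintro ((_ | ⟨e, he⟩ | ⟨q, e⟩) | (b | ⟨q, b⟩))
    · rfl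
    · exact htgtC _
    · exact htgt q _ (hti q _)
    · exact htgtC _
    · exact htgt q _ (hti q _)
  · rintro (_ | ⟨e, he⟩ | ⟨q, e⟩) <;> rfl
  · rintro (b | ⟨q, b⟩) <;> exact Iso.refl _
  · exact htgtC _
  · exact hsrcC _

end PreNet

end Spartan

namespace Spartan

namespace PreNet

variable {S : OpSet.{u}}

/-! ### Single edges -/

/-- The hypernet that consists of an edge with label `l`. -/
abbrev corolla (l : ELabel S) : PreNet S :=
  mk (Fin l.dom.length ⊕ Fin l.cod.length) Unit Empty
    (Sum.elim l.dom.get l.cod.get)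
    (fun _ => (List.finRange _).map .inl)
    (fun _ => (List.finRange _).map .inr)
    (fun _ => l)
    Empty.elim
    ((List.finRange _).map .inl)
    ((List.finRange _).map .inr)

open Classical in
/-- The edge `h` is given the label `l`. -/
noncomputable abbrev relabel (D : PreNet S) (h : D.E) (l : ELabel S) : PreNet S :=
  mk D.V D.E D.B D.vlab D.src D.tgt (Function.update D.lab h l) D.content D.ins D.outs

/-- The vertex `x` of `D` is the source or target of `h` that corresponds to `pos`. -/
def IsAt (D : PreNet S) (h : D.E) {m n : ℕ} (pos : Fin m ⊕ Fin n) (x : D.V) : Prop :=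
  match pos with
  | .inl i => (D.src (.inl h))[i.val]? = some x
  | .inr k => (D.tgt (.inl h))[k.val]? = some x

section Corolla

variable {D : PreNet S} {h : D.E} {χ : Hole} {l : ELabel S}

theorem corolla_plugEdge_eq (hlab : D.lab h = .hole χ) (hu : ∀ e, D.lab e = .hole χ → e = h)
    (q : PlugEdge {χ} D) : q = ⟨(h, χ), hlab, rfl⟩ := by
  obtain ⟨⟨e, χ'⟩, he, hχ⟩ := q
  obtain rfl : χ' = χ := hχ
  obtain rfl := hu e he
  rfl

theorem ShallowWF.exists_hole_src (w : D.ShallowWF) (hlab : D.lab h = .hole χ)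
    (hdom : l.dom = χ.dom) (j : Fin l.dom.length) :
    ∃ v, (D.src (.inl h))[j.val]? = some v ∧ D.vlab v = l.dom.get j := by
  have h1 := w.lab_dom h
  rw [hlab] at h1
  have h2 := congrArg (fun L => L[j.val]?) (h1.trans hdom.symm)
  simpa using h2

theorem ShallowWF.exists_hole_tgt (w : D.ShallowWF) (hlab : D.lab h = .hole χ)
    (hcod : l.cod = χ.cod) (j : Fin l.cod.length) :
    ∃ v, (D.tgt (.inl h))[j.val]? = some v ∧ D.vlab v = l.cod.get j := by
  have h1 := w.lab_cod h
  rw [hlab] at h1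
  have h2 := congrArg (fun L => L[j.val]?) (h1.trans hcod.symm)
  simpa using h2

variable (pos : (corolla l).V) (t : Token)

theorem focus_corolla_ins (j : Fin l.dom.length) :
    ((corolla l).focus pos t).ins[j.val]? = some (some (.inl j)) := by
  simp [focus]

theorem focus_corolla_outs (j : Fin l.cod.length) :
    ((corolla l).focus pos t).outs[j.val]? = some (splitAt pos (.inr j)) := by
  simp [focus]

theorem focus_corolla_mem_ins {v : Option (corolla l).V} :
    v ∈ ((corolla l).focus pos t).ins ↔ ∃ j, v = some (.inl j) := by
  simp [focus, eq_comm]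

theorem focus_corolla_mem_outs {v : Option (corolla l).V} :
    v ∈ ((corolla l).focus pos t).outs ↔ ∃ j, v = splitAt pos (.inr j) := by
  simp [focus, eq_comm]

theorem focus_corolla_ins_nodup : ((corolla l).focus pos t).ins.Nodup :=
  ((List.nodup_finRange _).map Sum.inl_injective).map (Option.some_injective _)

theorem focus_corolla_outs_nodup : ((corolla l).focus pos t).outs.Nodup :=
  ((List.nodup_finRange _).map Sum.inr_injective).map (splitAt_injective _)

theorem plugVertex_corolla_in (hlab : D.lab h = .hole χ) {j : Fin l.dom.length} {v : D.V}
    (hv : (D.src (.inl h))[j.val]? = some v) :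
    plugVertex {χ} (fun _ => (corolla l).focus pos t) D ⟨(h, χ), hlab, rfl⟩ (some (.inl j)) =
      .inl v :=
  plugVertex_of_some ((glue_ins (focus_corolla_ins_nodup pos t)
    (focus_corolla_ins pos t j)).trans hv)

theorem plugVertex_corolla_out (hlab : D.lab h = .hole χ) {j : Fin l.cod.length} {v : D.V}
    (hv : (D.tgt (.inl h))[j.val]? = some v) :
    plugVertex {χ} (fun _ => (corolla l).focus pos t) D ⟨(h, χ), hlab, rfl⟩
      (splitAt pos (.inr j)) = .inl v := by
  refine plugVertex_of_some ((glue_outs (focus_corolla_outs_nodup pos t) ?_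
    (focus_corolla_outs pos t j)).trans hv)
  rw [focus_corolla_mem_ins]
  rintro ⟨i, hi⟩
  cases (splitAt_eq_some.1 hi).1

/-- The isomorphism for the plugging of an edge with a token, from a bijection of the vertices. -/
theorem plugOne_corolla_of_equiv (w : D.ShallowWF) (hlab : D.lab h = .hole χ)
    (hu : ∀ e, D.lab e = .hole χ → e = h) (hdeep : ∀ b, ¬ (D.content b).Occurs (.hole χ))
    (hdom : l.dom = χ.dom) (hcod : l.cod = χ.cod) {x : D.V}
    (fV : Option D.V ≃ PlugV {χ} (fun _ => (corolla l).focus pos t) D)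
    (hx : fV (some x) = plugVertex {χ} (fun _ => (corolla l).focus pos t) D ⟨(h, χ), hlab, rfl⟩
      (some pos))
    (hn : fV none = plugVertex {χ} (fun _ => (corolla l).focus pos t) D ⟨(h, χ), hlab, rfl⟩ none)
    (hvl : ∀ v, (plugNet {χ} (fun _ => (corolla l).focus pos t) D).vlab (fV v) =
      ((D.relabel h l).focus x t).vlab v)
    (hs : ∀ v, v ∉ D.src (.inl h) → fV (splitAt x v) = .inl v)
    (ht : ∀ v, v ∉ D.tgt (.inl h) → fV (some v) = .inl v)
    (hsh : ∀ (j : Fin l.dom.length) v, (D.src (.inl h))[j.val]? = some v →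
      fV (splitAt x v) = plugVertex {χ} (fun _ => (corolla l).focus pos t) D
        ⟨(h, χ), hlab, rfl⟩ (splitAt pos (.inl j)))
    (hth : ∀ (j : Fin l.cod.length) v, (D.tgt (.inl h))[j.val]? = some v →
      fV (some v) = plugVertex {χ} (fun _ => (corolla l).focus pos t) D
        ⟨(h, χ), hlab, rfl⟩ (some (.inr j))) :
    Iso ((D.relabel h l).focus x t) (D.plugOne χ ((corolla l).focus pos t)) := by
  classical
  -- There is exactly one plugged edge, `q₀`. The bijection of edges sends `h` to the edge of the
  -- corolla and the added token to the token of the corolla.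
  rw [plugOne, plug_eq]
  set q₀ : PlugEdge {χ} D := ⟨(h, χ), hlab, rfl⟩ with hq₀
  have hq := corolla_plugEdge_eq hlab hu
  have hne : ∀ e, ¬ e = h → ¬ ∃ χ' ∈ ({χ} : Set Hole), D.lab e = .hole χ' := by
    rintro e he ⟨χ', rfl, h'⟩
    exact he (hu e h')
  have hne' : ∀ e, (¬ ∃ χ' ∈ ({χ} : Set Hole), D.lab e = .hole χ') → ¬ e = h := by
    rintro e he rfl
    exact he ⟨χ, rfl, hlab⟩
  let FE : Option D.E ≃ (plugNet {χ} (fun _ => (corolla l).focus pos t) D).E :=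
    { toFun := fun e => match e with
        | none => .inr ⟨q₀, none⟩
        | some e => if he : e = h then .inr ⟨q₀, some ()⟩ else .inl ⟨e, hne e he⟩
      invFun := fun e => match e with
        | .inl e => some e.1
        | .inr ⟨_, none⟩ => none
        | .inr ⟨_, some _⟩ => some h
      left_inv := by
        rintro (_ | e)
        · rfl
        · by_cases he : e = h
          · simp [he]
          · simp [he]
      right_inv := by
        rintro (⟨e, he⟩ | ⟨q, _ | e⟩)
        · simp [hne' e he]
        · obtain rfl := hq q
          rfl
        · obtain rfl := hq q
          exact dif_pos rfl }
  have hFEh : FE (some h) = .inr ⟨q₀, some ()⟩ := dif_pos rfl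
  have hFE : ∀ e (he : ¬ e = h), FE (some e) = .inl ⟨e, hne e he⟩ := fun e he => dif_neg he
  have hlen : (D.src (.inl h)).length = l.dom.length := by
    have := congrArg List.length (w.lab_dom h)
    rw [hlab, List.length_map] at this
    exact this.trans (congrArg List.length hdom.symm)
  have hlen' : (D.tgt (.inl h)).length = l.cod.length := by
    have := congrArg List.length (w.lab_cod h)
    rw [hlab, List.length_map] at this
    exact this.trans (congrArg List.length hcod.symm)
  have hsl : ∀ L : List D.V, (∀ v ∈ L, v ∉ D.src (.inl h)) →
      L.map Sum.inl = (L.map (splitAt x)).map fV := fun L hL => by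
    rw [List.map_map]
    exact List.map_congr_left fun v hv => (hs v (hL v hv)).symm
  have htl : ∀ L : List D.V, (∀ v ∈ L, v ∉ D.tgt (.inl h)) →
      L.map Sum.inl = (L.map some).map fV := fun L hL => by
    rw [List.map_map]
    exact List.map_congr_left fun v hv => (ht v (hL v hv)).symm
  have hB : IsEmpty (Σ p : PlugEdge {χ} D, ((fun _ => (corolla l).focus pos t) p.1.2).B) :=
    ⟨fun y => y.2.elim⟩
  refine IsoBy.iso (fV := fV) (fE := FE) (fB := (Equiv.sumEmpty _ _).symm)
    ⟨hvl, ?_, ?_, ?_, fun b => ?_, ?_, ?_⟩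
  · rintro ((_ | e) | b)
    · exact congrArg (fun x => [x]) hx.symm
    · by_cases he : e = h
      · rw [Sum.map_inl, he, hFEh]
        apply List.ext_getElem?
        intro j
        simp only [focus, corolla, List.map_map, List.getElem?_map]
        by_cases hj : j < l.dom.length
        · have hj' : j < (D.src (.inl h)).length := hlen ▸ hj
          have := hsh ⟨j, hj⟩ _ (List.getElem?_eq_getElem hj')
          simp [hj, hj', this]
        · have hj' : ¬ j < (D.src (.inl h)).length := hlen ▸ hj
          rw [List.getElem?_eq_none (by simpa using hj), List.getElem?_eq_none (by simpa using hj')]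
          rfl
      · rw [Sum.map_inl, hFE e he]
        exact hsl _ fun v hv hv' => he (Sum.inl.inj (w.src_unique v _ _ hv hv'))
    · exact hsl _ fun v hv hv' => by cases w.src_unique v _ _ hv hv'
  · rintro ((_ | e) | b)
    · exact congrArg (fun x => [x]) hn.symm
    · by_cases he : e = h
      · rw [Sum.map_inl, he, hFEh]
        apply List.ext_getElem?
        intro j
        simp only [focus, corolla, List.map_map, List.getElem?_map]
        by_cases hj : j < l.cod.length
        · have hj' : j < (D.tgt (.inl h)).length := hlen' ▸ hj
          have := hth ⟨j, hj⟩ _ (List.getElem?_eq_getElem hj')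
          simp [hj, hj', this]
        · have hj' : ¬ j < (D.tgt (.inl h)).length := hlen' ▸ hj
          rw [List.getElem?_eq_none (by simpa using hj), List.getElem?_eq_none (by simpa using hj')]
          rfl
      · rw [Sum.map_inl, hFE e he]
        exact htl _ fun v hv hv' => he (Sum.inl.inj (w.tgt_unique v _ _ hv hv'))
    · exact htl _ fun v hv hv' => by cases w.tgt_unique v _ _ hv hv'
  · rintro (_ | e)
    · rfl
    · by_cases he : e = h
      · rw [he, hFEh]
        simp
      · rw [hFE e he]
        simp [he]
  · refine plug_of_not_occurs _ ?_
    rintro χ' rfl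
    exact hdeep b
  · exact htl _ fun v hv hv' => (w.mem_ins v).1 hv _ hv'
  · exact hsl _ fun v hv hv' => (w.mem_outs v).1 hv _ hv'

/-- All vertices of the corolla with its token are glued to the sources and targets of `h`, except
for one, which lies between the token and the edge. So plugging amounts to relabelling `h` and
splitting the vertex `x` of `D` at the position `pos`. -/
theorem plugOne_corolla (w : D.ShallowWF) (hlab : D.lab h = .hole χ)
    (hu : ∀ e, D.lab e = .hole χ → e = h) (hdeep : ∀ b, ¬ (D.content b).Occurs (.hole χ))
    (hdom : l.dom = χ.dom) (hcod : l.cod = χ.cod) {x : D.V} (hx : D.IsAt h pos x) :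
    Iso ((D.relabel h l).focus x t) (D.plugOne χ ((corolla l).focus pos t)) := by
  classical
  set q₀ : PlugEdge {χ} D := ⟨(h, χ), hlab, rfl⟩ with hq₀
  have hq := corolla_plugEdge_eq hlab hu
  set σ : Hole → PreNet S := fun _ => (corolla l).focus pos t with hσ
  cases pos with
  | inl i =>
    change (D.src (.inl h))[i.val]? = some x at hx
    have hxs := List.mem_of_getElem? hx
    -- A token at a source stands before the edge, so the vertex that is not glued is the half
    -- `none`, where the token ends.
    have hfr : glueAt {χ} σ D q₀ (none : Option (corolla l).V) = none := by
      refine glue_none ?_ ?_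
      · rw [focus_corolla_mem_ins]
        simp
      · rw [focus_corolla_mem_outs]
        rintro ⟨j, hj⟩
        cases splitAt_eq_none.1 hj.symm
    have huniq : ∀ y : (Σ q : PlugEdge {χ} D, {v : (σ q.1.2).V // glueAt {χ} σ D q v = none}),
        y = ⟨q₀, none, hfr⟩ := by
      rintro ⟨q, v, hv⟩
      obtain rfl := hq q
      obtain _ | j | j := v
      · rfl
      · obtain ⟨y, hy, -⟩ := w.exists_hole_src hlab hdom j
        have := glueAt_eq_of_plugVertex (plugVertex_corolla_in (.inl i) t hlab hy)
        exact absurd (hv.symm.trans this) (by simp)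
      · obtain ⟨y, hy, -⟩ := w.exists_hole_tgt hlab hcod j
        have := plugVertex_corolla_out (.inl i) t hlab hy
        rw [splitAt_ne (by simp)] at this
        exact absurd (hv.symm.trans (glueAt_eq_of_plugVertex this)) (by simp)
    let fV : Option D.V ≃ PlugV {χ} σ D :=
      { toFun := fun v => v.elim (.inr ⟨q₀, none, hfr⟩) .inl
        invFun := Sum.elim some fun _ => none
        left_inv := by rintro (_ | v) <;> rfl
        right_inv := by
          rintro (v | y)
          · rfl
          · exact congrArg Sum.inr (huniq y).symm }
    refine plugOne_corolla_of_equiv (.inl i) t w hlab hu hdeep hdom hcod fV ?_ ?_ ?_ ?_ ?_ ?_ ?_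
    · exact (plugVertex_corolla_in _ t hlab hx).symm
    · exact (plugVertex_of_none hfr).symm
    · rintro (_ | v)
      · obtain ⟨y, hy, hyl⟩ := w.exists_hole_src hlab hdom i
        obtain rfl := Option.some_injective _ (hy.symm.trans hx)
        exact hyl.symm
      · rfl
    · intro v hv
      rw [splitAt_ne (ne_of_mem_of_not_mem hxs hv).symm]
      rfl
    · exact fun v hv => rfl
    · intro j v hv
      by_cases hj : j = i
      · subst hj
        obtain rfl := Option.some_injective _ (hv.symm.trans hx)
        rw [splitAt_self, splitAt_self]
        exact (plugVertex_of_none hfr).symm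
      · rw [splitAt_ne fun h => hj (Sum.inl.inj h), plugVertex_corolla_in _ t hlab hv, splitAt_ne]
        · rfl
        · rintro rfl
          refine hj (Fin.ext ?_)
          exact (List.getElem?_inj (List.getElem?_eq_some_iff.1 hv).1 (w.src_nodup _)).1
            (hv.trans hx.symm)
    · intro j v hv
      have := plugVertex_corolla_out (.inl i) t hlab hv
      rw [splitAt_ne (by simp)] at this
      exact this.symm
  | inr k =>
    change (D.tgt (.inl h))[k.val]? = some x at hx
    have hxs := List.mem_of_getElem? hx
    -- A token at a target stands behind the edge, so the vertex that is not glued is the half `some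
    -- (.inr k)`, where the token begins.
    have hfr : glueAt {χ} σ D q₀ (some (.inr k) : Option (corolla l).V) = none := by
      refine glue_none ?_ ?_
      · rw [focus_corolla_mem_ins]
        simp
      · rw [focus_corolla_mem_outs]
        rintro ⟨j, hj⟩
        obtain ⟨h1, h2⟩ := splitAt_eq_some.1 hj.symm
        exact h2 h1
    have huniq : ∀ y : (Σ q : PlugEdge {χ} D, {v : (σ q.1.2).V // glueAt {χ} σ D q v = none}),
        y = ⟨q₀, some (.inr k), hfr⟩ := by
      rintro ⟨q, v, hv⟩
      obtain rfl := hq q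
      obtain _ | j | j := v
      · have := plugVertex_corolla_out (.inr k) t hlab hx
        rw [splitAt_self] at this
        exact absurd (hv.symm.trans (glueAt_eq_of_plugVertex this)) (by simp)
      · obtain ⟨y, hy, -⟩ := w.exists_hole_src hlab hdom j
        have := glueAt_eq_of_plugVertex (plugVertex_corolla_in (.inr k) t hlab hy)
        exact absurd (hv.symm.trans this) (by simp)
      · by_cases hj : j = k
        · subst hj
          rfl
        · obtain ⟨y, hy, -⟩ := w.exists_hole_tgt hlab hcod j
          have := plugVertex_corolla_out (.inr k) t hlab hy
          rw [splitAt_ne fun h => hj (Sum.inr.inj h)] at this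
          exact absurd (hv.symm.trans (glueAt_eq_of_plugVertex this)) (by simp)
    -- The half `none` of `x` keeps the rest of the context and becomes the old vertex `x`; the half
    -- `some x` becomes the one new vertex.
    let fV : Option D.V ≃ PlugV {χ} σ D :=
      { toFun := fun v => v.elim (.inl x) fun v =>
          if v = x then .inr ⟨q₀, some (.inr k), hfr⟩ else .inl v
        invFun := Sum.elim (splitAt x) fun _ => some x
        left_inv := by
          rintro (_ | v)
          · exact splitAt_self x
          · by_cases hv : v = x
            · simp [hv]
            · simp [hv, splitAt_ne hv]
        right_inv := by
          rintro (v | y)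
          · by_cases hv : v = x
            · simp [hv, splitAt_self]
            · simp [hv, splitAt_ne hv]
          · rw [huniq y]
            simp }
    have hfx : fV (some x) = .inr ⟨q₀, some (.inr k), hfr⟩ := by simp [fV]
    have hfv : ∀ v, v ≠ x → fV (some v) = .inl v := fun v hv => by simp [fV, hv]
    have hfs : ∀ v, fV (splitAt x v) = .inl v := fun v => by
      by_cases hv : v = x
      · subst hv
        rw [splitAt_self]
        rfl
      · rw [splitAt_ne hv, hfv v hv]
    refine plugOne_corolla_of_equiv (.inr k) t w hlab hu hdeep hdom hcod fV ?_ ?_ ?_ ?_ ?_ ?_ ?_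
    · exact hfx.trans (plugVertex_of_none hfr).symm
    · have := plugVertex_corolla_out (.inr k) t hlab hx
      rw [splitAt_self] at this
      exact this.symm
    · rintro (_ | v)
      · rfl
      · by_cases hv : v = x
        · subst hv
          rw [hfx]
          obtain ⟨y, hy, hyl⟩ := w.exists_hole_tgt hlab hcod k
          obtain rfl := Option.some_injective _ (hy.symm.trans hx)
          exact hyl.symm
        · rw [hfv v hv]
          rfl
    · exact fun v _ => hfs v
    · exact fun v hv => hfv v (ne_of_mem_of_not_mem hxs hv).symm
    · intro j v hv
      rw [hfs, splitAt_ne (by simp)]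
      exact (plugVertex_corolla_in _ t hlab hv).symm
    · intro j v hv
      by_cases hj : j = k
      · subst hj
        obtain rfl := Option.some_injective _ (hv.symm.trans hx)
        exact hfx.trans (plugVertex_of_none hfr).symm
      · have := plugVertex_corolla_out (.inr k) t hlab hv
        rw [splitAt_ne fun h => hj (Sum.inr.inj h)] at this
        rw [this]
        refine hfv v ?_
        rintro rfl
        refine hj (Fin.ext ?_)
        exact (List.getElem?_inj (List.getElem?_eq_some_iff.1 hv).1 (w.tgt_nodup _)).1
          (hv.trans hx.symm)

end Corolla

end PreNet

end Spartan

namespace Spartan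

namespace PreNet

variable {S : OpSet.{u}}

/-! ### The shapes of the interaction rules -/

/-- The first edge is the token edge. -/
def ruleEdges : Bool ≃ Option Unit where
  toFun b := if b then some () else none
  invFun o := o.isSome
  left_inv := by decide
  right_inv := by decide

theorem opNet_none_iso (t : Token) (φ : S.Op) :
    Iso (opNet t φ none) ((corolla (.op φ)).focus (.inl ⟨0, Nat.one_pos⟩) t) := by
  let fV : RuleV (ELabel.op φ : ELabel S).cod.length ≃
      Option (Fin 1 ⊕ Fin (ELabel.op φ : ELabel S).cod.length) :=
    { toFun := fun v => match v with
        | .root => some (.inl 0)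
        | .mid => none
        | .out i => some (.inr i)
      invFun := fun v => match v with
        | none => .mid
        | some (.inl _) => .root
        | some (.inr i) => .out i
      left_inv := by rintro (_ | _ | i) <;> rfl
      right_inv := by
        rintro (_ | i | i)
        · rfl
        · rw [Subsingleton.elim i 0]
        · rfl }
  have h1 : ∀ L : List (Fin (ELabel.op φ : ELabel S).cod.length),
      (L.map (Sum.inr : _ → Fin 1 ⊕ _)).map (splitAt (.inl 0)) = (L.map RuleV.out).map fV := by
    intro L
    rw [List.map_map, List.map_map]
    exact List.map_congr_left fun i _ => splitAt_ne (by simp)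
  refine IsoBy.iso (fV := fV) (fE := ruleEdges) (fB := Equiv.refl Empty)
    ⟨?_, ?_, ?_, ?_, fun b => b.elim, rfl, (h1 _)⟩
  · rintro (_ | _ | i) <;> rfl
  · rintro ((_ | _) | b)
    · rfl
    · exact congrArg (fun x => [x]) (splitAt_self _)
    · exact b.elim
  · rintro ((_ | _) | b)
    · rfl
    · change List.map some (List.map Sum.inr _) = List.map fV (List.map RuleV.out _)
      rw [List.map_map, List.map_map]
      rfl
    · exact b.elim
  · rintro (_ | _) <;> rfl

theorem opNet_some_iso (t : Token) (φ : S.Op) (k : Fin (ELabel.op φ : ELabel S).cod.length)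
    (hk : (ELabel.op φ : ELabel S).cod.get k = .star) :
    Iso (opNet t φ (some k)) ((corolla (.op φ)).focus (.inr k) t) := by
  classical
  -- Here `mid` lies between the operation and the token, so it is the half `some (.inr k)`; the
  -- output `out k`, behind the token, is the half `none`.
  let fV : RuleV (ELabel.op φ : ELabel S).cod.length ≃
      Option (Fin 1 ⊕ Fin (ELabel.op φ : ELabel S).cod.length) :=
    { toFun := fun v => match v with
        | .root => some (.inl 0)
        | .mid => some (.inr k)
        | .out i => splitAt (.inr k) (.inr i)
      invFun := fun v => match v with
        | none => .out k
        | some (.inl _) => .root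
        | some (.inr i) => if i = k then .mid else .out i
      left_inv := by
        rintro (_ | _ | i)
        · rfl
        · exact if_pos rfl
        · by_cases h : i = k
          · subst h
            simp [splitAt_self]
          · simp [h, splitAt_ne fun h' => h (Sum.inr.inj h')]
      right_inv := by
        rintro (_ | i | i)
        · exact splitAt_self _
        · rw [Subsingleton.elim i 0]
        · by_cases h : i = k
          · simp [h]
          · simp [h, splitAt_ne fun h' => h (Sum.inr.inj h')] }
  have hout : ∀ i, fV (.out i) = splitAt (.inr k) (.inr i) := fun i => rfl
  have h1 : ∀ L : List (Fin (ELabel.op φ : ELabel S).cod.length),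
      (L.map (Sum.inr : _ → Fin 1 ⊕ _)).map (splitAt (.inr k)) = (L.map RuleV.out).map fV := by
    intro L
    rw [List.map_map, List.map_map]
    rfl
  refine IsoBy.iso (fV := fV) (fE := ruleEdges) (fB := Equiv.refl Empty)
    ⟨?_, ?_, ?_, ?_, fun b => b.elim, rfl, h1 _⟩
  · rintro (_ | _ | i)
    · rfl
    · exact hk
    · exact focus_vlab_splitAt (corolla (.op φ)) (.inr k) t (.inr i)
  · rintro ((_ | _) | b)
    · rfl
    · exact congrArg (fun x => [x]) (splitAt_ne (by simp))
    · exact b.elim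
  · rintro ((_ | _) | b)
    · exact congrArg (fun x => [x]) (splitAt_self _).symm
    · change List.map some (List.map Sum.inr _) =
        List.map fV (List.map (fun i => if i = k then RuleV.mid else .out i) _)
      rw [List.map_map, List.map_map]
      refine List.map_congr_left fun i _ => ?_
      by_cases h : i = k
      · simp only [Function.comp, h, if_true]
        rfl
      · simp only [Function.comp, h, if_false]
        rw [hout, splitAt_ne fun h' => h (Sum.inr.inj h')]
    · exact b.elim
  · rintro (_ | _) <;> rfl

theorem instNet_iso (t : Token) :
    Iso (instNet S t) ((corolla .inst).focus (.inl ⟨0, Nat.one_pos⟩) t) := by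
  let fV : RuleV 1 ≃ Option (Fin 1 ⊕ Fin 1) :=
    { toFun := fun v => match v with
        | .root => some (.inl 0)
        | .mid => none
        | .out i => some (.inr i)
      invFun := fun v => match v with
        | none => .mid
        | some (.inl _) => .root
        | some (.inr i) => .out i
      left_inv := by rintro (_ | _ | i) <;> rfl
      right_inv := by
        rintro (_ | i | i)
        · rfl
        · rw [Subsingleton.elim i 0]
        · rfl }
  refine IsoBy.iso (fV := fV) (fE := ruleEdges) (fB := Equiv.refl Empty)
    ⟨?_, ?_, ?_, ?_, fun b => b.elim, rfl, ?_⟩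
  · rintro (_ | _ | i)
    · rfl
    · rfl
    · rw [Subsingleton.elim i 0]
      rfl
  · rintro ((_ | _) | b)
    · rfl
    · exact congrArg (fun x => [x]) (splitAt_self _)
    · exact b.elim
  · rintro ((_ | _) | b)
    · rfl
    · rfl
    · exact b.elim
  · rintro (_ | _) <;> rfl
  · exact congrArg (fun x => [x]) (splitAt_ne (by simp))

theorem contrNet_iso (t : Token) (left : Bool) :
    Iso (contrNet S t left)
      ((corolla (.contr .star)).focus (.inl (if left then (0 : Fin 2) else (1 : Fin 2))) t) := by
  let fV : RuleV 2 ≃ Option (Fin 2 ⊕ Fin 1) :=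
    { toFun := fun v => match v with
        | .root => some (.inl (if left then 0 else 1))
        | .mid => none
        | .out 0 => some (.inl (if left then 1 else 0))
        | .out 1 => some (.inr 0)
      invFun := fun v => match v with
        | none => .mid
        | some (.inl i) => if i = if left then 0 else 1 then .root else .out 0
        | some (.inr _) => .out 1
      left_inv := by
        rintro (_ | _ | i)
        · simp
        · rfl
        · fin_cases i
          · cases left <;> simp
          · rfl
      right_inv := by
        rintro (_ | i | i)
        · rfl
        · fin_cases i <;> cases left <;> simp
        · rw [Subsingleton.elim i 0] }
  have h01 : splitAt (.inl 0 : Fin 2 ⊕ Fin 1) (.inl 1) = some (.inl 1) := splitAt_ne (by simp)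
  have h10 : splitAt (.inl 1 : Fin 2 ⊕ Fin 1) (.inl 0) = some (.inl 0) := splitAt_ne (by simp)
  refine IsoBy.iso (fV := fV) (fE := ruleEdges) (fB := Equiv.refl Empty)
    ⟨?_, ?_, ?_, ?_, fun b => b.elim, ?_, ?_⟩
  · rintro (_ | _ | i)
    · cases left <;> rfl
    · cases left <;> rfl
    · fin_cases i
      · cases left <;> rfl
      · cases left <;> rfl
  · rintro ((_ | _) | b)
    · cases left <;> rfl
    · cases left
      · change [splitAt (.inl 1 : Fin 2 ⊕ Fin 1) (.inl 0), splitAt (.inl 1) (.inl 1)] = _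
        rw [h10, splitAt_self]
        rfl
      · change [splitAt (.inl 0 : Fin 2 ⊕ Fin 1) (.inl 0), splitAt (.inl 0) (.inl 1)] = _
        rw [h01, splitAt_self]
        rfl
    · exact b.elim
  · rintro ((_ | _) | b)
    · cases left <;> rfl
    · cases left <;> rfl
    · exact b.elim
  · rintro (_ | _) <;> rfl
  · cases left <;> rfl
  · exact congrArg (fun x => [x]) (splitAt_ne (by simp))

/-! ### Search steps as moves of the token -/

/-- The moves of a token in search steps. -/
inductive SearchMove (U : PreNet S) : U.V → Token → U.V → Token → Prop
  | contr (e : U.E) (p : U.V) (he : U.lab e = .contr .star) (hp : p ∈ U.src (.inl e)) :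
      SearchMove U p .search p .rewrite
  | inst (e : U.E) (p : U.V) (he : U.lab e = .inst) (hp : p ∈ U.src (.inl e)) :
      SearchMove U p .search p .value
  | first (e : U.E) (p q : U.V) (φ : S.Op) (he : U.lab e = .op φ) (hp : p ∈ U.src (.inl e))
      (hφ : 0 < S.eager φ) (hq : (U.tgt (.inl e))[0]? = some q) :
      SearchMove U p .search q .search
  | next (e : U.E) (p q : U.V) (φ : S.Op) (he : U.lab e = .op φ) (k : ℕ)
      (hp : (U.tgt (.inl e))[k]? = some p) (hφ : k + 1 < S.eager φ)
      (hq : (U.tgt (.inl e))[k + 1]? = some q) :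
      SearchMove U p .value q .search
  | last (e : U.E) (p q : U.V) (φ : S.Op) (he : U.lab e = .op φ) (k : ℕ)
      (hp : (U.tgt (.inl e))[k]? = some p) (hφ : k + 1 = S.eager φ)
      (hq : q ∈ U.src (.inl e)) (t : Token) (ht : IsResultToken φ t) :
      SearchMove U p .value q t
  | nullary (e : U.E) (p : U.V) (φ : S.Op) (he : U.lab e = .op φ) (hp : p ∈ U.src (.inl e))
      (hφ : S.eager φ = 0) (t : Token) (ht : IsResultToken φ t) :
      SearchMove U p .search p t

theorem IsoBy.searchMove {U W : PreNet S} {fV fE fB} (h : IsoBy U W fV fE fB) {p q s t}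
    (hm : SearchMove U p s q t) : SearchMove W (fV p) s (fV q) t := by
  have hs : ∀ {e v}, v ∈ U.src (.inl e) → fV v ∈ W.src (.inl (fE e)) := fun {e v} hv =>
    (h.mem_src (e := .inl e)).2 hv
  have ht : ∀ {e v} {k : ℕ}, (U.tgt (.inl e))[k]? = some v →
      (W.tgt (.inl (fE e)))[k]? = some (fV v) := fun {e v k} hv => by
    rw [h.tgtE, List.getElem?_map, hv]
    rfl
  cases hm with
  | contr e p he hp => exact .contr (fE e) _ ((h.lab e).trans he) (hs hp)
  | inst e p he hp => exact .inst (fE e) _ ((h.lab e).trans he) (hs hp)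
  | first e p q φ he hp hφ hq => exact .first (fE e) _ _ φ ((h.lab e).trans he) (hs hp) hφ (ht hq)
  | next e p q φ he k hp hφ hq => exact .next (fE e) _ _ φ ((h.lab e).trans he) k (ht hp) hφ (ht hq)
  | last e p q φ he k hp hφ hq t hr =>
    exact .last (fE e) _ _ φ ((h.lab e).trans he) k (ht hp) hφ (hs hq) t hr
  | nullary e p φ he hp hφ t hr => exact .nullary (fE e) _ φ ((h.lab e).trans he) (hs hp) hφ t hr

/-- Eager targets precede the thunks in the target type of an operation. -/
theorem op_cod_get_star {φ : S.Op} {k : Fin (ELabel.op φ : ELabel S).cod.length}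
    (h : k.val < S.eager φ) : (ELabel.op φ : ELabel S).cod.get k = .star := by
  have h' : k.val < (List.replicate (S.eager φ) VLabel.star).length := by simpa using h
  exact (List.getElem_append_left h').trans (List.getElem_replicate _)

theorem eager_le_cod_length (φ : S.Op) : S.eager φ ≤ (ELabel.op φ : ELabel S).cod.length := by
  simp [ELabel.cod]

/-- Both sides of an interaction rule are a single edge with a token. -/
theorem InteractionRule.exists_corolla {N N' : PreNet S} (h : InteractionRule N N') :
    ∃ (l : ELabel S) (pos pos' : (corolla l).V) (t t' : Token), (∀ s, l ≠ .token s) ∧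
      Iso N ((corolla l).focus pos t) ∧ Iso N' ((corolla l).focus pos' t') ∧
      ∀ (U : PreNet S) e p q, U.lab e = l → U.IsAt e pos p → U.IsAt e pos' q →
        SearchMove U p t q t' := by
  cases h with
  | rule1 left =>
    refine ⟨_, _, _, _, _, by simp, contrNet_iso _ left, contrNet_iso _ left, ?_⟩
    intro U e p q he hp hq
    obtain rfl := Option.some_injective _ (hp.symm.trans hq)
    exact .contr e p he (List.mem_of_getElem? hp)
  | rule2 =>
    refine ⟨_, _, _, _, _, by simp, instNet_iso _, instNet_iso _, ?_⟩
    intro U e p q he hp hq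
    obtain rfl := Option.some_injective _ (hp.symm.trans hq)
    exact .inst e p he (List.mem_of_getElem? hp)
  | rule3 φ k h hk =>
    refine ⟨_, _, _, _, _, by simp, opNet_none_iso _ φ,
      opNet_some_iso _ φ k (op_cod_get_star (hk ▸ h)), ?_⟩
    intro U e p q he hp hq
    exact .first e p q φ he (List.mem_of_getElem? hp) h (hk ▸ hq)
  | rule4 φ k k' h hk =>
    refine ⟨_, _, _, _, _, by simp, opNet_some_iso _ φ k (op_cod_get_star (by omega)),
      opNet_some_iso _ φ k' (op_cod_get_star (by omega)), ?_⟩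
    intro U e p q he hp hq
    exact .next e p q φ he k hp h (hk ▸ hq)
  | rule5a φ k h t ht =>
    refine ⟨_, _, _, _, _, by simp, opNet_some_iso _ φ k (op_cod_get_star (by omega)),
      opNet_none_iso _ φ, ?_⟩
    intro U e p q he hp hq
    exact .last e p q φ he k hp h (List.mem_of_getElem? hq) t ht
  | rule5b φ h t ht =>
    refine ⟨_, _, _, _, _, by simp, opNet_none_iso _ φ, opNet_none_iso _ φ, ?_⟩
    intro U e p q he hp hq
    obtain rfl := Option.some_injective _ (hp.symm.trans hq)
    exact .nullary e p φ he (List.mem_of_getElem? hp) h t ht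

/-- Every move is an instance of an interaction rule. -/
theorem SearchMove.exists_rule {U : PreNet S} (w : U.ShallowWF) {p q s t}
    (h : SearchMove U p s q t) :
    ∃ (l : ELabel S) (e : U.E) (pos pos' : (corolla l).V) (N N' : PreNet S), U.lab e = l ∧
      InteractionRule N N' ∧ Iso N ((corolla l).focus pos s) ∧ Iso N' ((corolla l).focus pos' t) ∧
      U.IsAt e pos p ∧ U.IsAt e pos' q := by
  -- An operation has one source, so membership in the source list fixes the position `0`.
  have hop : ∀ {e φ v}, U.lab e = .op φ → v ∈ U.src (.inl e) →
      (U.src (.inl e))[0]? = some v := by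
    intro e φ v he hv
    have h1 := w.lab_dom e
    rw [he] at h1
    obtain ⟨a, ha, -⟩ := List.map_eq_singleton_iff.1 h1
    rw [ha] at hv ⊢
    rw [List.mem_singleton.1 hv]
    rfl
  cases h with
  | contr e p he hp =>
    have h1 := w.lab_dom e
    rw [he] at h1
    have h2 := congrArg List.length h1
    rw [List.length_map] at h2
    obtain ⟨i, hi, rfl⟩ := List.getElem_of_mem hp
    have hi' : i < 2 := lt_of_lt_of_eq hi h2
    have hat : (U.src (.inl e))[i]? = some (U.src (.inl e))[i] := List.getElem?_eq_getElem hi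
    -- The index of `p` among the two sources selects the left or right version of the rule.
    interval_cases i
    · exact ⟨_, e, _, _, _, _, he, .rule1 true, contrNet_iso _ true, contrNet_iso _ true, hat, hat⟩
    · exact ⟨_, e, _, _, _, _, he, .rule1 false, contrNet_iso _ false,
        contrNet_iso _ false, hat, hat⟩
  | inst e p he hp =>
    have h1 := w.lab_dom e
    rw [he] at h1
    obtain ⟨a, ha, -⟩ := List.map_eq_singleton_iff.1 h1
    have hat : (U.src (.inl e))[0]? = some p := by
      rw [ha] at hp ⊢
      rw [List.mem_singleton.1 hp]
      rfl
    exact ⟨_, e, _, _, _, _, he, .rule2, instNet_iso _, instNet_iso _, hat, hat⟩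
  | first e p q φ he hp hφ hq =>
    exact ⟨_, e, _, _, _, _, he,
      .rule3 φ ⟨0, hφ.trans_le (eager_le_cod_length φ)⟩ hφ rfl, opNet_none_iso _ φ,
      opNet_some_iso _ φ _ (op_cod_get_star hφ), hop he hp, hq⟩
  | next e p q φ he k hp hφ hq =>
    have hk := hφ.trans_le (eager_le_cod_length φ)
    exact ⟨_, e, _, _, _, _, he,
      .rule4 φ ⟨k, (Nat.lt_succ_self k).trans hk⟩ ⟨k + 1, hk⟩ hφ rfl,
      opNet_some_iso _ φ _ (op_cod_get_star ((Nat.lt_succ_self k).trans hφ)),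
      opNet_some_iso _ φ _ (op_cod_get_star hφ), hp, hq⟩
  | last e p q φ he k hp hφ hq t ht =>
    have hk : k < S.eager φ := hφ ▸ Nat.lt_succ_self k
    exact ⟨_, e, _, _, _, _, he,
      .rule5a φ ⟨k, hk.trans_le (eager_le_cod_length φ)⟩ hφ t ht,
      opNet_some_iso _ φ _ (op_cod_get_star hk), opNet_none_iso _ φ, hp, hop he hq⟩
  | nullary e p φ he hp hφ t ht =>
    exact ⟨_, e, _, _, _, _, he, .rule5b φ hφ t ht,
      opNet_none_iso _ φ, opNet_none_iso _ φ, hop he hp, hop he hp⟩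

end PreNet

end Spartan

namespace Spartan

namespace PreNet

variable {S : OpSet.{u}}

/-! ### Simple contexts -/

theorem relabel_lab_self (D : PreNet S) (h : D.E) (l : ELabel S) : (D.relabel h l).lab h = l := by
  simp

theorem relabel_lab_ne (D : PreNet S) {h e : D.E} (he : e ≠ h) (l : ELabel S) :
    (D.relabel h l).lab e = D.lab e := by
  simp [he]

/-- With a hole label for `l`, this exhibits `U` as a context with a hole in place of `e`, filled
with the edge `e` again. -/
theorem relabel_relabel_iso (U : PreNet S) (e : U.E) (l : ELabel S) :
    IsoBy U ((U.relabel e l).relabel e (U.lab e)) (Equiv.refl U.V) (Equiv.refl U.E)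
      (Equiv.refl U.B) := by
  refine ⟨fun _ => rfl, ?_, ?_, fun f => ?_, fun _ => Iso.refl _, (List.map_id _).symm,
    (List.map_id _).symm⟩
  · rintro (f | b) <;> exact (List.map_id _).symm
  · rintro (f | b) <;> exact (List.map_id _).symm
  · by_cases h : f = e
    · rw [h]
      exact relabel_lab_self ..
    · exact (relabel_lab_ne (U.relabel e l) h _).trans (relabel_lab_ne U h _)

theorem corolla_hasType (l : ELabel S) {dom cod : List VLabel} (h : (corolla l).HasType dom cod) :
    l.dom = dom ∧ l.cod = cod := by
  obtain ⟨h1, h2⟩ := h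
  simp only [corolla, List.map_map] at h1 h2
  exact ⟨(List.map_get_finRange l.dom).symm.trans h1, (List.map_get_finRange l.cod).symm.trans h2⟩

theorem IsSimpleContext.eq_hole {D : PreNet S} {χ : Hole} (hD : D.IsSimpleContext χ) {h e : D.E}
    (hh : D.lab h = .hole χ) (he : D.lab e = .hole χ) : e = h :=
  Sum.inl.inj (D.deepEquiv.symm.injective
    (hD.1.1.2 χ _ _ ((deepLab_inl D e).trans he) ((deepLab_inl D h).trans hh)))

theorem IsSimpleContext.not_occurs {D : PreNet S} {χ : Hole} (hD : D.IsSimpleContext χ) (b : D.B) :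
    ¬ (D.content b).Occurs (.hole χ) := by
  rintro ⟨x, hx⟩
  obtain ⟨h, hh⟩ := hD.2
  have := D.deepEquiv.symm.injective
    (hD.1.1.2 χ _ _ ((deepLab_inr D b x).trans hx) ((deepLab_inl D h).trans hh))
  cases this

theorem plugOne_congr (D : PreNet S) (χ : Hole) {N N' : PreNet S} (h : Iso N N') :
    Iso (D.plugOne χ N) (D.plugOne χ N') :=
  (Iso.refl D).plug (fun _ => h) fun _ _ => Iff.rfl

theorem ShallowWF.exists_isAt {D : PreNet S} (w : D.ShallowWF) {h : D.E} {χ : Hole}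
    (hlab : D.lab h = .hole χ) {l : ELabel S} (hdom : l.dom = χ.dom) (hcod : l.cod = χ.cod)
    (pos : (corolla l).V) : ∃ x, D.IsAt h pos x := by
  cases pos with
  | inl i =>
    obtain ⟨x, hx, -⟩ := w.exists_hole_src hlab hdom i
    exact ⟨x, hx⟩
  | inr k =>
    obtain ⟨x, hx, -⟩ := w.exists_hole_tgt hlab hcod k
    exact ⟨x, hx⟩

/-- Both sides of an interaction rule are the same edge with a token at different positions. Plugged
into the context, they give one and the same hypernet with two placements of the token, and by
`Iso.of_focus` this hypernet is `U`. -/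
theorem search_focus {U : PreNet S} {p : U.V} {t : Token}
    {Y : Hypernet S} (h : Hypernet.Search (U.focus p t).toNet Y) :
    ∃ q s, SearchMove U p t q s ∧ Y = (U.focus q s).toNet := by
  classical
  obtain ⟨N, N', D, χ, hr, hD, hff, -, hN, -, hX, rfl, -, -⟩ := h
  obtain ⟨l, pos, pos', t₁, t₁', hl, hi, hi', hm⟩ := hr.exists_corolla
  obtain ⟨hdom, hcod⟩ := corolla_hasType l ((focus_hasType _ _ _).1 (hi.hasType hN))
  obtain ⟨h, hh⟩ := hD.2
  have w := hD.1.1.1.shallow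
  obtain ⟨x, hx⟩ := w.exists_isAt hh hdom hcod pos
  obtain ⟨x', hx'⟩ := w.exists_isAt hh hdom hcod pos'
  have hu := fun e (he : D.lab e = .hole χ) => hD.eq_hole hh he
  have k := plugOne_corolla pos t₁ w hh hu hD.not_occurs hdom hcod hx
  have k' := plugOne_corolla pos' t₁' w hh hu hD.not_occurs hdom hcod hx'
  have j : Iso (U.focus p t) ((D.relabel h l).focus x t₁) :=
    ((toNet_eq_iff.1 hX).trans (plugOne_congr D χ hi)).trans k.symm
  -- The context is focus-free and the label that replaces its hole is no token, as `Iso.of_focus`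
  -- requires.
  have hW : ∀ e s, (D.relabel h l).lab e ≠ .token s := by
    intro e s
    by_cases he : e = h
    · rw [he, relabel_lab_self]
      exact hl s
    · rw [relabel_lab_ne D he]
      exact hff.lab_ne e s
  obtain ⟨rfl, fV, fE, fB, f, rfl⟩ := j.of_focus hW
  have hm' := hm (D.relabel h l) h _ x' (by simp) hx hx'
  have hs := f.symm.searchMove hm'
  rw [fV.symm_apply_apply] at hs
  refine ⟨_, _, hs, toNet_eq_iff.2 ?_⟩
  exact ((plugOne_congr D χ hi').trans k'.symm).trans (f.symm.focus x' t₁')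

/-- The token only visits sources and eager targets of operations, or stays where it is; it never
reaches a thunk. -/
theorem SearchMove.vlab {U : PreNet S} (w : U.ShallowWF) {p q s t} (h : SearchMove U p s q t)
    (hp : U.vlab p = .star) : U.vlab q = .star := by
  have hsrc : ∀ {e φ v}, U.lab e = .op φ → v ∈ U.src (.inl e) → U.vlab v = .star := by
    intro e φ v he hv
    have h1 := w.lab_dom e
    rw [he] at h1
    have h2 := List.mem_map_of_mem (f := U.vlab) hv
    rw [h1] at h2
    exact List.mem_singleton.1 h2
  have htgt : ∀ {e φ v} {k : ℕ}, U.lab e = .op φ → (U.tgt (.inl e))[k]? = some v →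
      k < S.eager φ → U.vlab v = .star := by
    intro e φ v k he hv hk
    have h1 := w.lab_cod e
    rw [he] at h1
    have h2 := congrArg (fun L => L[k]?) h1
    simp only [List.getElem?_map, hv] at h2
    have h3 := List.getElem?_eq_getElem (hk.trans_le (eager_le_cod_length φ))
    exact Option.some_injective _ ((h2.trans h3).trans
      (congrArg some (op_cod_get_star (k := ⟨k, _⟩) hk)))
  cases h with
  | contr e p he _ => exact hp
  | inst e p he _ => exact hp
  | first e p q φ he _ hφ hq => exact htgt he hq hφ
  | next e p q φ he k _ hφ hq => exact htgt he hq hφ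
  | last e p q φ he k _ hφ hq t _ => exact hsrc he hq
  | nullary e p φ he _ hφ t _ => exact hp

/-! ### Turning an edge into a hole -/

section Relabel

variable {U : PreNet S} {e : U.E} {χ : Hole}

theorem occurs_relabel {l l' : ELabel S} (h : (U.relabel e l).Occurs l') :
    l' = l ∨ U.Occurs l' := by
  obtain ⟨f, hf⟩ | ⟨b, hb⟩ := occurs_iff.1 h
  · by_cases he : f = e
    · rw [he, relabel_lab_self] at hf
      exact .inl hf.symm
    · rw [relabel_lab_ne U he] at hf
      exact .inr (occurs_iff.2 (.inl ⟨f, hf⟩))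
  · exact .inr (occurs_iff.2 (.inr ⟨b, hb⟩))

theorem WF.relabel (w : U.WF) {l : ELabel S} (hdom : l.dom = (U.lab e).dom)
    (hcod : l.cod = (U.lab e).cod) : (U.relabel e l).WF := by
  have sw := w.shallow
  refine .intro _ ⟨sw.finite_V, sw.finite_E, sw.finite_B, sw.src_nodup, sw.tgt_nodup,
    sw.src_unique, sw.tgt_unique, fun f => ?_, fun f => ?_, sw.box_type, sw.ins_nodup,
    sw.outs_nodup, sw.mem_ins, sw.mem_outs, sw.ins_outs⟩ w.deep
  · refine (sw.lab_dom f).trans ?_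
    by_cases he : f = e
    · rw [he, relabel_lab_self, hdom]
    · rw [relabel_lab_ne U he]
  · refine (sw.lab_cod f).trans ?_
    by_cases he : f = e
    · rw [he, relabel_lab_self, hcod]
    · rw [relabel_lab_ne U he]

theorem HoleFree.isSimpleContext_relabel (w : U.WF) (hU : U.HoleFree)
    (hdom : χ.dom = (U.lab e).dom) (hcod : χ.cod = (U.lab e).cod) :
    (U.relabel e (.hole χ)).IsSimpleContext χ := by
  have hd : ∀ χ' x, (U.relabel e (.hole χ)).deepLab x = .hole χ' →
      x = (U.relabel e (.hole χ)).deepEquiv.symm (.inl e) := by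
    intro χ' x hx
    obtain ⟨x, rfl⟩ := (U.relabel e (.hole χ)).deepEquiv.symm.surjective x
    obtain f | ⟨b, x⟩ := x
    · rw [deepLab_inl] at hx
      by_cases he : f = e
      · rw [he]
      · rw [relabel_lab_ne U he] at hx
        exact absurd (occurs_iff (G := U).2 (.inl ⟨f, hx⟩)) (hU χ')
    · rw [deepLab_inr] at hx
      exact absurd (occurs_iff (G := U).2 (.inr ⟨b, x, hx⟩)) (hU χ')
  refine ⟨⟨⟨w.relabel hdom hcod, fun χ' x y hx hy => (hd χ' x hx).trans (hd χ' y hy).symm⟩,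
    fun χ' => ⟨fun h => ?_, ?_⟩⟩, e, by simp⟩
  · obtain h | h := occurs_relabel h
    · exact ELabel.hole.inj h
    · exact absurd h (hU χ')
  · rintro rfl
    exact occurs_iff.2 (.inl ⟨e, by simp⟩)

end Relabel

/-- The simple context is `U` with the edge of the move turned into a hole; the two sides of the
rule refill it with that edge and the token at its old and new position. -/
theorem SearchMove.search {U : PreNet S} {p q s t} (h : SearchMove U p s q t)
    (hs : (U.focus p s).IsState) : (U.focus q t).IsState ∧
      Hypernet.Search (U.focus p s).toNet (U.focus q t).toNet := by
  classical
  obtain ⟨w, hff, hhf, ht, hp⟩ := isState_focus.1 hs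
  have hs' : (U.focus q t).IsState := isState_focus.2 ⟨w, hff, hhf, ht, h.vlab w.shallow hp⟩
  refine ⟨hs', ?_⟩
  obtain ⟨l, e, pos, pos', N, N', rfl, hr, hi, hi', ha, ha'⟩ := h.exists_rule w.shallow
  -- Any name will do, as `U` has no holes.
  let χ : Hole := ⟨0, (U.lab e).dom, (U.lab e).cod⟩
  have hD : (U.relabel e (.hole χ)).IsSimpleContext χ := hhf.isSimpleContext_relabel w rfl rfl
  have hlab : (U.relabel e (.hole χ)).lab e = .hole χ := by simp
  have hu := fun f (hf : (U.relabel e (.hole χ)).lab f = .hole χ) => hD.eq_hole hlab hf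
  have k := plugOne_corolla pos s hD.1.1.1.shallow hlab hu hD.not_occurs rfl rfl
    (x := p) ha
  have k' := plugOne_corolla pos' t hD.1.1.1.shallow hlab hu hD.not_occurs rfl rfl
    (x := q) ha'
  have hN : ∀ pos t, ((corolla (U.lab e)).focus pos t).HasType χ.dom χ.cod := fun pos t => by
    refine (focus_hasType _ _ _).2 ⟨?_, ?_⟩
    · simp only [corolla, List.map_map]
      exact List.map_get_finRange (U.lab e).dom
    · simp only [corolla, List.map_map]
      exact List.map_get_finRange (U.lab e).cod
  have j := (relabel_relabel_iso U e (.hole χ)).focus p s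
  have j' := (relabel_relabel_iso U e (.hole χ)).focus q t
  refine ⟨N, N', U.relabel e (.hole χ), χ, hr, hD, fun s' hs' => ?_, ht, hi.symm.hasType (hN _ _),
    hi'.symm.hasType (hN _ _), toNet_eq_iff.2 ?_, toNet_eq_iff.2 ?_, ⟨_, rfl, hs⟩, ⟨_, rfl, hs'⟩⟩
  · obtain h | h := occurs_relabel hs'
    · cases h
    · exact hff _ h
  · exact (j.trans k).trans (plugOne_congr _ χ hi.symm)
  · exact (j'.trans k').trans (plugOne_congr _ χ hi'.symm)

end PreNet

end Spartan

namespace Spartan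

namespace PreNet

variable {S : OpSet.{u}}

/-! ### Final and rooted states -/

theorem HasType.exists_ins {U : PreNet S} {cod} (h : U.HasType [.star] cod) :
    ∃ i, U.ins = [i] ∧ U.vlab i = .star := List.map_eq_singleton_iff.1 h.1

/-- Reads off `underlying`, a quotient with chosen representatives, from any presentation with a
token at a vertex. -/
theorem IsState.underlying_iso {G U : PreNet S} {p : U.V} {t : Token} (hG : G.IsState)
    (h : Iso G (U.focus p t)) : Iso G.underlying U := by
  obtain ⟨q, s, j⟩ := hG.2.2.1.exists_focus hG.1
  obtain ⟨-, _, _, _, f, -⟩ :=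
    (j.symm.trans h).of_focus (isState_focus.1 (h.isState hG)).2.1.lab_ne
  exact f.iso

theorem Iso.start_iso_focus {W U : PreNet S} (h : Iso W U) {i : U.V} (hi : U.ins = [i])
    (w : U.WF) (hl : U.vlab i = .star) (t : Token) : Iso (W.start t) (U.focus i t) := by
  obtain ⟨fV, fE, fB, f⟩ := iso_iff.1 h.symm
  have hi' : W.ins = [fV i] := by
    rw [f.ins, hi]
    rfl
  have w' := ((h.symm.wf w).shallow.mem_ins (fV i)).1 (hi' ▸ List.mem_singleton.2 rfl)
  exact (PreNet.start_iso_focus hi' w' ((f.vlab i).trans hl) t).trans (f.focus i t).symm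

theorem IsState.exists_ins_of_start {W : PreNet S} {t : Token} (h : (W.start t).IsState) :
    ∃ i, W.ins = [i] := by
  have hlen : ((W.ins.map some).set 0 none).length = 1 :=
    (List.length_map _).symm.trans (congrArg List.length h.2.2.2.1)
  rw [List.length_set, List.length_map] at hlen
  exact List.length_eq_one_iff.1 hlen

/-- Here `W` is not known to be well-formed. What is needed about its input follows from the token
edge of the state `W.start t`: the label is ⋆ by typing, and no other edge ends there by uniqueness
of targets. -/
theorem IsState.start_iso_focus {W U : PreNet S} {t : Token} (h : (W.start t).IsState)
    (j : Iso W U) {i : U.V} (hi : U.ins = [i]) : Iso (W.start t) (U.focus i t) := by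
  obtain ⟨fV, fE, fB, f⟩ := iso_iff.1 j.symm
  have hi' : W.ins = [fV i] := by
    rw [f.ins, hi]
    rfl
  have htgt : (W.start t).tgt (.inl (none : Option W.E)) = [some (fV i)] := by
    change (W.ins[0]?).toList.map some = _
    rw [hi']
    rfl
  have hmem : (some (fV i) : Option W.V) ∈ (W.start t).tgt (.inl (none : Option W.E)) := by
    rw [htgt]
    exact List.mem_singleton.2 rfl
  have w := h.1.shallow
  have hlab : [W.vlab (fV i)] = [.star] := by
    have := w.lab_cod (none : Option W.E)
    rw [htgt] at this
    exact this
  refine (PreNet.start_iso_focus hi' (fun e he => ?_) (List.singleton_inj.1 hlab) t).trans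
    (f.focus i t).symm
  obtain e | b := e
  · cases w.tgt_unique (some (fV i)) (.inl (none : Option W.E)) (.inl (some e)) hmem
      (List.mem_map_of_mem (f := some) he)
  · cases w.tgt_unique (some (fV i)) (.inl (none : Option W.E)) (.inr b) hmem
      (List.mem_map_of_mem (f := some) he)

/-- By `Iso.of_focus`, an isomorphism with the hypernet that has its value token at the input pins
down both the label and the position. -/
theorem isFinal_focus {U : PreNet S} {p : U.V} {t : Token} (hs : (U.focus p t).IsState) :
    (U.focus p t).toNet.IsFinal ↔ t = .value ∧ p ∈ U.ins := by
  obtain ⟨w, hff, -, ht, -⟩ := isState_focus.1 hs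
  obtain ⟨i, hi, hil⟩ := ht.exists_ins
  constructor
  · rintro ⟨G, hG, hGs, h⟩
    have h1 := hGs.underlying_iso (toNet_eq_iff.1 hG)
    have h2 := (toNet_eq_iff.1 h).trans (h1.start_iso_focus hi w hil .value)
    obtain ⟨rfl, fV, fE, fB, f, hf⟩ := h2.of_focus hff.lab_ne
    exact ⟨rfl, f.mem_ins.1 (by simp [hf, hi])⟩
  · rintro ⟨rfl, hp⟩
    rw [hi, List.mem_singleton] at hp
    subst hp
    exact ⟨_, rfl, hs, toNet_eq_iff.2
      ((underlying_focus hff.lab_ne p .value).start_iso_focus hi w hil .value).symm⟩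

theorem rooted_focus_ins {U : PreNet S} {i : U.V} (hs : (U.focus i .search).IsState)
    (hi : U.ins = [i]) : (U.focus i .search).toNet.Rooted := by
  obtain ⟨w, hff, -, -, hil⟩ := isState_focus.1 hs
  refine ⟨_, rfl, hs, ?_⟩
  rw [((underlying_focus hff.lab_ne i .search).start_iso_focus hi w hil .search).toNet_eq]

/-- A search token lengthens the path by an operation edge. A value token moves from a target of an
operation edge, which must be the last edge of the path since each vertex is a target of at most one
edge; that edge is redirected to the next target or dropped. -/
theorem SearchMove.exists_opPath {U : PreNet S} (w : U.ShallowWF) {p q s t}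
    (h : SearchMove U p s q t) {r : U.V} (hr : r ∈ U.ins)
    (hp : Relation.ReflTransGen U.OpStep r p) : Relation.ReflTransGen U.OpStep r q := by
  have hback : ∀ {e φ} {k : ℕ}, U.lab e = .op φ → (U.tgt (.inl e))[k]? = some p →
      ∃ v ∈ U.src (.inl e), Relation.ReflTransGen U.OpStep r v := by
    intro e φ k he hk
    have hk := List.mem_of_getElem? hk
    obtain rfl | ⟨v, hv, f, φ', hf, hvf, hpf⟩ := hp.cases_tail
    · exact absurd hk ((w.mem_ins p).1 hr _)
    · obtain rfl := Sum.inl.inj (w.tgt_unique p _ _ hk hpf)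
      exact ⟨v, hvf, hv⟩
  cases h with
  | contr e p he _ => exact hp
  | inst e p he _ => exact hp
  | first e p q φ he hpe hφ hq => exact hp.tail ⟨e, φ, he, hpe, List.mem_of_getElem? hq⟩
  | next e p q φ he k hk hφ hq =>
    obtain ⟨v, hv, hrv⟩ := hback he hk
    exact hrv.tail ⟨e, φ, he, hv, List.mem_of_getElem? hq⟩
  | last e p q φ he k hk hφ hq t _ =>
    obtain ⟨v, hv, hrv⟩ := hback he hk
    have h1 := w.lab_dom e
    rw [he] at h1
    obtain ⟨a, ha, -⟩ := List.map_eq_singleton_iff.1 h1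
    rw [ha, List.mem_singleton] at hv hq
    rwa [hq, ← hv]
  | nullary e p φ he _ hφ t _ => exact hp

/-- In a rooted state, the token is reached by a path of operation edges. -/
theorem exists_opPath_of_rooted {U : PreNet S} {p : U.V} {t : Token}
    (hs : (U.focus p t).IsState) (h : (U.focus p t).toNet.Rooted) :
    ∃ r ∈ U.ins, Relation.ReflTransGen U.OpStep r p := by
  obtain ⟨w, hff, -, ht, -⟩ := isState_focus.1 hs
  obtain ⟨i, hi, hil⟩ := ht.exists_ins
  obtain ⟨G, hG, hGs, h⟩ := h
  have h1 := hGs.underlying_iso (toNet_eq_iff.1 hG)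
  rw [(h1.start_iso_focus hi w hil .search).toNet_eq] at h
  have key : ∀ Y, Relation.ReflTransGen Hypernet.Search (U.focus i .search).toNet Y →
      ∃ q s, Y = (U.focus q s).toNet ∧ Relation.ReflTransGen U.OpStep i q := by
    intro Y hY
    induction hY with
    | refl => exact ⟨i, .search, rfl, .refl⟩
    | tail _ hst ih =>
      obtain ⟨q, s, rfl, hq⟩ := ih
      obtain ⟨q', s', hm, rfl⟩ := search_focus hst
      exact ⟨q', s', rfl, hm.exists_opPath w.shallow (by simp [hi]) hq⟩
  obtain ⟨q, s, hq, hpath⟩ := key _ h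
  obtain ⟨-, fV, fE, fB, f, rfl⟩ := (toNet_eq_iff.1 hq).symm.of_focus hff.lab_ne
  exact ⟨fV i, f.mem_ins.2 (by simp [hi]), hpath.lift fV fun _ _ => f.opStep⟩

/-! ### Paths of operation edges through a plugged hypernet -/

section Through

variable {C : PreNet S} {D : Set Hole} {σ : Hole → PreNet S}

theorem plugVertex_eq_inl {q : PlugEdge D C} {v : (σ q.1.2).V} {x : C.V}
    (h : plugVertex D σ C q v = .inl x) :
    (v ∈ (σ q.1.2).ins ∧ x ∈ C.src (.inl q.1.1)) ∨
    (v ∉ (σ q.1.2).ins ∧ ∃ j : ℕ, (σ q.1.2).outs[j]? = some v ∧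
      (C.tgt (.inl q.1.1))[j]? = some x) := by
  have hg := glueAt_eq_of_plugVertex h
  by_cases hi : v ∈ (σ q.1.2).ins
  · obtain ⟨j, -, hj⟩ := glue_of_mem_ins (srcs := C.src (.inl q.1.1))
      (tgts := C.tgt (.inl q.1.1)) hi
    exact .inl ⟨hi, List.mem_of_getElem? (hj.symm.trans hg)⟩
  · by_cases ho : v ∈ (σ q.1.2).outs
    · obtain ⟨j, hj', hj⟩ := glue_of_mem_outs (srcs := C.src (.inl q.1.1))
        (tgts := C.tgt (.inl q.1.1)) hi ho
      exact .inr ⟨hi, j, hj', hj.symm.trans hg⟩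
    · rw [glueAt, glue_none hi ho] at hg
      cases hg

/-- Only outputs among the non-inputs are glued, and they go to targets of holes; these are distinct
for one hole and disjoint for different holes. Inputs must be left out: a target of one hole may be
a source of another. -/
theorem plugVertex_inj (w : C.ShallowWF) {q q' : PlugEdge D C} {v : (σ q.1.2).V}
    {v' : (σ q'.1.2).V} (hv : v ∉ (σ q.1.2).ins) (hv' : v' ∉ (σ q'.1.2).ins)
    (h : plugVertex D σ C q v = plugVertex D σ C q' v') :
    (⟨q, v⟩ : Σ q : PlugEdge D C, (σ q.1.2).V) = ⟨q', v'⟩ := by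
  cases hx : plugVertex D σ C q v with
  | inl x =>
    obtain ⟨hi, -⟩ | ⟨-, j, hj, hjx⟩ := plugVertex_eq_inl hx
    · exact absurd hi hv
    obtain ⟨hi, -⟩ | ⟨-, j', hj', hjx'⟩ := plugVertex_eq_inl (h.symm.trans hx)
    · exact absurd hi hv'
    obtain ⟨⟨e, χ⟩, he, hχ⟩ := q
    obtain ⟨⟨e', χ'⟩, he', hχ'⟩ := q'
    obtain rfl : e = e' := Sum.inl.inj
      (w.tgt_unique x _ _ (List.mem_of_getElem? hjx) (List.mem_of_getElem? hjx'))
    obtain rfl : χ = χ' := ELabel.hole.inj (he.symm.trans he')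
    obtain rfl : j = j' := (List.getElem?_inj (List.getElem?_eq_some_iff.1 hjx).1
      (w.tgt_nodup _)).1 (hjx.trans hjx'.symm)
    obtain rfl := Option.some_injective _ (hj.symm.trans hj')
    rfl
  | inr y =>
    have hy' := h.symm.trans hx
    cases hg : glueAt D σ C q v with
    | some x => rw [plugVertex_of_some hg] at hx; cases hx
    | none =>
      cases hg' : glueAt D σ C q' v' with
      | some x => rw [plugVertex_of_some hg'] at hy'; cases hy'
      | none =>
        rw [plugVertex_of_none hg, plugVertex_of_none hg'] at h
        have := congrArg (fun y : (Σ q : PlugEdge D C, {v : (σ q.1.2).V //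
          glueAt D σ C q v = none}) => (⟨y.1, y.2.1⟩ : Σ q : PlugEdge D C, (σ q.1.2).V))
          (Sum.inr.inj h)
        exact this

/-- Follow the path backwards from the image of `v`. Its last edge is no edge of the context, as `v`
is either not glued or glued to a target of the hole. So it lies in the same plugged hypernet, and
one continues from its source until an input is met; the path cannot run out before, because `r` is
a target of no edge. -/
theorem exists_opPath_through (w : C.ShallowWF) (hσ : ∀ q : PlugEdge D C, (σ q.1.2).ShallowWF)
    {r : C.V} (hr : r ∈ C.ins) {x : PlugV D σ C}
    (hx : Relation.ReflTransGen (plugNet D σ C).OpStep (.inl r) x) (q : PlugEdge D C)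
    (v : (σ q.1.2).V) (hv : v ∉ (σ q.1.2).ins) (hvx : plugVertex D σ C q v = x) :
    ∃ i ∈ (σ q.1.2).ins, Relation.TransGen (σ q.1.2).OpStep i v := by
  induction hx generalizing v with
  | refl =>
    obtain ⟨hi, -⟩ | ⟨-, j, -, hj⟩ := plugVertex_eq_inl hvx
    · exact absurd hi hv
    · exact absurd (List.mem_of_getElem? hj) ((w.mem_ins r).1 hr _)
  | @tail y z _ hst ih =>
    obtain ⟨⟨e, he⟩ | ⟨q', e⟩, φ, hlab, hy, hz⟩ := hst
    · change z ∈ (C.tgt (.inl e)).map Sum.inl at hz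
      obtain ⟨a, ha, rfl⟩ := List.mem_map.1 hz
      obtain ⟨hi, -⟩ | ⟨-, j, -, hj⟩ := plugVertex_eq_inl hvx
      · exact absurd hi hv
      · have := Sum.inl.inj (w.tgt_unique a _ _ ha (List.mem_of_getElem? hj))
        exact absurd ⟨_, q.2.2, this ▸ q.2.1⟩ he
    · change z ∈ ((σ q'.1.2).tgt (.inl e)).map (plugVertex D σ C q') at hz
      change y ∈ ((σ q'.1.2).src (.inl e)).map (plugVertex D σ C q') at hy
      obtain ⟨v', hv', rfl⟩ := List.mem_map.1 hz
      obtain ⟨a, ha, rfl⟩ := List.mem_map.1 hy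
      have hv'' : v' ∉ (σ q'.1.2).ins := fun h => ((hσ q').mem_ins v').1 h _ hv'
      cases plugVertex_inj w hv hv'' hvx
      have hs : (σ q.1.2).OpStep a v := ⟨e, φ, hlab, ha, hv'⟩
      by_cases hai : a ∈ (σ q.1.2).ins
      · exact ⟨a, hai, .single hs⟩
      · obtain ⟨i, hi, hp⟩ := ih a hai rfl
        exact ⟨i, hi, hp.tail hs⟩

/-- No path of operation edges leads through a one-way hypernet to a target of its hole. -/
theorem not_oneWay_of_opPath (w : C.ShallowWF) (hσ : ∀ q : PlugEdge D C, (σ q.1.2).ShallowWF)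
    {r : C.V} (hr : r ∈ C.ins) {p : C.V} (hp : C.vlab p = .star)
    (hx : Relation.ReflTransGen (plugNet D σ C).OpStep (.inl r) (.inl p)) (q : PlugEdge D C)
    (hty : (σ q.1.2).HasType q.1.2.dom q.1.2.cod) (hpq : p ∈ C.tgt (.inl q.1.1)) :
    ¬ (σ q.1.2).OneWay := by
  intro how
  obtain ⟨j, hj, hjp⟩ := List.getElem_of_mem hpq
  have h1 := w.lab_cod q.1.1
  rw [q.2.1] at h1
  have h2 := hty.2.trans h1.symm
  have h3 := congrArg (fun L => L[j]?) h2
  simp only [List.getElem?_map, List.getElem?_eq_getElem hj, hjp, Option.map_some] at h3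
  obtain ⟨v, hv, hvl⟩ := Option.map_eq_some_iff.1 h3
  have hvo := List.mem_of_getElem? hv
  have hvi : v ∉ (σ q.1.2).ins := fun h => (hσ q).ins_outs v ⟨h, hvo⟩
  have hpv : plugVertex D σ C q v = .inl p := by
    refine plugVertex_of_some ((glue_outs (hσ q).outs_nodup hvi hv).trans ?_)
    rw [List.getElem?_eq_getElem hj, hjp]
  obtain ⟨i, hi, hpath⟩ := exists_opPath_through w hσ hr hx q v hvi hpv
  refine how i hi v hvo ?_ (hvl.trans hp) hpath
  -- The input `i` is a source of the first operation edge of the path, hence labelled ⋆.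
  obtain ⟨c, ⟨e, φ, he, hie, -⟩, -⟩ := Relation.TransGen.head'_iff.1 hpath
  have h4 := (hσ q).lab_dom e
  rw [he] at h4
  have h5 := List.mem_map_of_mem (f := (σ q.1.2).vlab) hie
  rw [h4] at h5
  exact List.mem_singleton.1 h5

end Through

end PreNet

end Spartan

namespace Spartan

namespace PreNet

variable {S : OpSet.{u}}

/-! ### Search moves in contexts -/

section PlugMove

variable {C : PreNet S} {D : Set Hole} {σ : Hole → PreNet S}

/-- A source of an inner edge is not an output, so it meets the context only as an input. -/
theorem mem_src_of_plug (hσ : ∀ q : PlugEdge D C, (σ q.1.2).ShallowWF) {p : C.V}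
    {q : PlugEdge D C} {e : (σ q.1.2).E}
    (h : (.inl p : PlugV D σ C) ∈ (plugNet D σ C).src (.inl (.inr ⟨q, e⟩))) :
    p ∈ C.src (.inl q.1.1) := by
  obtain ⟨v, hv, hvp⟩ := List.mem_map.1 h
  obtain ⟨-, hp⟩ | ⟨-, j, hj, -⟩ := plugVertex_eq_inl hvp
  · exact hp
  · exact absurd hv (((hσ q).mem_outs v).1 (List.mem_of_getElem? hj) _)

theorem mem_tgt_of_plug (hσ : ∀ q : PlugEdge D C, (σ q.1.2).ShallowWF) {p : C.V}
    {q : PlugEdge D C} {e : (σ q.1.2).E}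
    (h : (.inl p : PlugV D σ C) ∈ (plugNet D σ C).tgt (.inl (.inr ⟨q, e⟩))) :
    p ∈ C.tgt (.inl q.1.1) := by
  obtain ⟨v, hv, hvp⟩ := List.mem_map.1 h
  obtain ⟨hi, -⟩ | ⟨-, j, -, hp⟩ := plugVertex_eq_inl hvp
  · exact absurd hv (((hσ q).mem_ins v).1 hi _)
  · exact List.mem_of_getElem? hp

/-- A move of a token that is neither searching at a source nor returning from a target of a hole
is a move in the context. -/
theorem SearchMove.of_plug (hσ : ∀ q : PlugEdge D C, (σ q.1.2).ShallowWF) {p : C.V}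
    {y x : (plugNet D σ C).V} {s t : Token} (h : SearchMove (plugNet D σ C) y s x t)
    (hp : (.inl p : PlugV D σ C) = y)
    (hs : s = .search → ∀ q : PlugEdge D C, p ∉ C.src (.inl q.1.1))
    (hv : s = .value → ∀ q : PlugEdge D C, p ∉ C.tgt (.inl q.1.1)) :
    ∃ p', x = (.inl p' : PlugV D σ C) ∧ SearchMove C p s p' t := by
  have hinl : ∀ {L : List C.V} {v : C.V}, (.inl v : PlugV D σ C) ∈ L.map Sum.inl → v ∈ L :=
    fun h => (List.mem_map_of_injective Sum.inl_injective).1 h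
  have hget : ∀ {L : List C.V} {k : ℕ} {x : PlugV D σ C}, (L.map Sum.inl)[k]? = some x →
      ∃ v, L[k]? = some v ∧ .inl v = x := fun {L k x} h => by
    rw [List.getElem?_map] at h
    exact Option.map_eq_some_iff.1 h
  -- In each case the edge comes from the context, and the move is one of `C`, or from a plugged
  -- hypernet; then `p` is a source of the hole if the token is searching, and a target of the hole
  -- if it is a value token.
  cases h with
  | contr e _ he hpe =>
    obtain ⟨e, _⟩ | ⟨q, e⟩ := e
    · subst hp
      exact ⟨p, rfl, .contr e p he (hinl hpe)⟩
    · subst hp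
      exact absurd (mem_src_of_plug hσ hpe) (hs rfl q)
  | inst e _ he hpe =>
    obtain ⟨e, _⟩ | ⟨q, e⟩ := e
    · subst hp
      exact ⟨p, rfl, .inst e p he (hinl hpe)⟩
    · subst hp
      exact absurd (mem_src_of_plug hσ hpe) (hs rfl q)
  | first e _ _ φ he hpe hφ hq =>
    obtain ⟨e, _⟩ | ⟨q, e⟩ := e
    · subst hp
      obtain ⟨p', hp', rfl⟩ := hget hq
      exact ⟨p', rfl, .first e p p' φ he (hinl hpe) hφ hp'⟩
    · subst hp
      exact absurd (mem_src_of_plug hσ hpe) (hs rfl q)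
  | next e _ _ φ he k hk hφ hq =>
    obtain ⟨e, _⟩ | ⟨q, e⟩ := e
    · obtain ⟨p₁, hp₁, h₁⟩ := hget hk
      obtain rfl := Sum.inl.inj (hp.trans h₁.symm)
      obtain ⟨p', hp', rfl⟩ := hget hq
      exact ⟨p', rfl, .next e p p' φ he k hp₁ hφ hp'⟩
    · subst hp
      exact absurd (mem_tgt_of_plug hσ (List.mem_of_getElem? hk)) (hv rfl q)
  | last e _ _ φ he k hk hφ hq t ht =>
    obtain ⟨e, _⟩ | ⟨q, e⟩ := e
    · obtain ⟨p₁, hp₁, h₁⟩ := hget hk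
      obtain rfl := Sum.inl.inj (hp.trans h₁.symm)
      obtain ⟨p', hp', rfl⟩ := List.mem_map.1 hq
      exact ⟨p', rfl, .last e p p' φ he k hp₁ hφ hp' t ht⟩
    · subst hp
      exact absurd (mem_tgt_of_plug hσ (List.mem_of_getElem? hk)) (hv rfl q)
  | nullary e _ φ he hpe hφ t ht =>
    obtain ⟨e, _⟩ | ⟨q, e⟩ := e
    · subst hp
      exact ⟨p, rfl, .nullary e p φ he (hinl hpe) hφ t ht⟩
    · subst hp
      exact absurd (mem_src_of_plug hσ hpe) (hs rfl q)

/-- The edge of a move is not a hole, so it survives plugging, whatever is plugged in. This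
transports a move from one state of a specimen to the other. -/
theorem SearchMove.plug {p p' : C.V} {s t : Token} (h : SearchMove C p s p' t) :
    SearchMove (plugNet D σ C) (Sum.inl p) s (Sum.inl p') t := by
  have hmem : ∀ {L : List C.V} {v : C.V}, v ∈ L → (.inl v : PlugV D σ C) ∈ L.map Sum.inl :=
    fun h => List.mem_map_of_mem h
  have hget : ∀ {L : List C.V} {k : ℕ} {v : C.V}, L[k]? = some v →
      (L.map Sum.inl)[k]? = some (.inl v : PlugV D σ C) := fun {L k v} h => by
    rw [List.getElem?_map, h]
    rfl
  have hne : ∀ {e : C.E} {l : ELabel S}, C.lab e = l → (∀ χ, l ≠ .hole χ) →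
      ¬ ∃ χ ∈ D, C.lab e = .hole χ := fun he hl ⟨χ, _, h'⟩ => hl χ (he.symm.trans h')
  cases h with
  | contr e p he hp => exact .contr (U := plugNet D σ C) (Sum.inl ⟨e, hne he (by simp)⟩) _ he (hmem hp)
  | inst e p he hp => exact .inst (U := plugNet D σ C) (Sum.inl ⟨e, hne he (by simp)⟩) _ he (hmem hp)
  | first e p q φ he hp hφ hq =>
    exact .first (U := plugNet D σ C) (Sum.inl ⟨e, hne he (by simp)⟩) _ _ φ he (hmem hp) hφ (hget hq)
  | next e p q φ he k hp hφ hq =>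
    exact .next (U := plugNet D σ C) (Sum.inl ⟨e, hne he (by simp)⟩) _ _ φ he k (hget hp) hφ (hget hq)
  | last e p q φ he k hp hφ hq t ht =>
    exact .last (U := plugNet D σ C) (Sum.inl ⟨e, hne he (by simp)⟩) _ _ φ he k (hget hp) hφ (hmem hq) t ht
  | nullary e p φ he hp hφ t ht =>
    exact .nullary (U := plugNet D σ C) (Sum.inl ⟨e, hne he (by simp)⟩) _ φ he (hmem hp) hφ t ht

end PlugMove

theorem SearchMove.ne_rewrite {U : PreNet S} {p q s t} (h : SearchMove U p s q t) :
    s ≠ .rewrite := by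
  cases h <;> simp

/-- A rewrite token that results from a search step is not at a hole. -/
theorem SearchMove.not_at_hole {U : PreNet S} (w : U.ShallowWF) {p q s}
    (h : SearchMove U p s q .rewrite) {f : U.E} {χ : Hole} (hf : U.lab f = .hole χ) :
    q ∉ U.src (.inl f) := by
  have key : ∀ {e : U.E} {l : ELabel S}, U.lab e = l → (∀ χ, l ≠ .hole χ) → q ∈ U.src (.inl e) →
      q ∉ U.src (.inl f) := fun {e l} he hl hq hq' => by
    obtain rfl := Sum.inl.inj (w.src_unique q _ _ hq hq')
    exact hl χ (he.symm.trans hf)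
  cases h with
  | contr e p he hp => exact key he (by simp) hp
  | last e p q φ he k hp hφ hq t ht => exact key he (by simp) hq
  | nullary e p φ he hp hφ t ht => exact key he (by simp) hp

theorem plugOne_hasToken {D N : PreNet S} {χ : Hole} {h : D.E} (hh : D.lab h = .hole χ) {t : Token}
    (hN : N.HasToken t) : (D.plugOne χ N).HasToken t := by
  obtain ⟨e, he⟩ := hN
  rw [plugOne, plug_eq]
  exact ⟨.inr ⟨⟨(h, χ), hh, rfl⟩, e⟩, he⟩

theorem ContractionRule.hasToken {N N' : PreNet S} (h : ContractionRule N N') :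
    N.HasToken .rewrite := by
  cases h with
  | copy n k h T H hT hH =>
    rw [plugAll, plug_eq]
    exact ⟨.inl ⟨(0 : Fin 3), by rintro ⟨χ, -, h⟩; cases h⟩, rfl⟩

theorem IsState.exists_focus {G : PreNet S} (h : G.IsState) :
    ∃ (U : PreNet S) (p : U.V) (t : Token), Iso G (U.focus p t) ∧ (U.focus p t).IsState := by
  obtain ⟨p, t, j⟩ := h.2.2.1.exists_focus h.1
  exact ⟨_, p, t, j, j.isState h⟩

end PreNet

open PreNet

/-! ### Token labels and available transitions -/

namespace Behaviour

variable {S : OpSet.{u}} (B : Behaviour S)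

theorem Rewrite.hasToken {X Y : Hypernet S} (h : B.Rewrite X Y) : X.Sat (HasToken .rewrite) := by
  obtain ⟨N, N', D, χ, hr, hD, -, -, -, -, rfl, -⟩ | h := h
  · obtain ⟨h, hh⟩ := hD.2
    exact ⟨_, rfl, plugOne_hasToken hh hr.hasToken⟩
  · obtain ⟨G, hG, e, -, -, -, he, -⟩ := B.active_left X Y h
    exact ⟨G, hG, e, he⟩

variable {B}

theorem Rewrite.eq_rewrite {U : PreNet S} {p : U.V} {t : Token} {Y : Hypernet S}
    (hU : U.FocusFree) (h : B.Rewrite (U.focus p t).toNet Y) : t = .rewrite := by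
  obtain ⟨G, hG, ht⟩ := Rewrite.hasToken B h
  exact (hU.eq_of_hasToken_focus ((toNet_eq_iff.1 hG).hasToken ht)).symm

/-- A value token can only move away from a target of an operation edge, and the input is a target
of no edge; rewrite transitions need a rewrite token. -/
theorem not_step_of_isFinal {X Y : Hypernet S} (h : X.IsFinal) : ¬ B.Step X Y := by
  intro hst
  obtain ⟨G, hG, hGs, -⟩ := id h
  obtain ⟨U, p, t, j, hs⟩ := hGs.exists_focus
  obtain rfl : X = (U.focus p t).toNet := hG.symm.trans j.toNet_eq
  obtain ⟨rfl, hp⟩ := (isFinal_focus hs).1 h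
  obtain ⟨w, hff, -⟩ := isState_focus.1 hs
  obtain hst | hst := hst
  · obtain ⟨q, s, hm, -⟩ := search_focus hst
    cases hm with
    | next e _ _ φ he k hk =>
      exact (w.shallow.mem_ins p).1 hp _ (List.mem_of_getElem? hk)
    | last e _ _ φ he k hk =>
      exact (w.shallow.mem_ins p).1 hp _ (List.mem_of_getElem? hk)
  · cases Rewrite.eq_rewrite hff hst

/-! ### Specimens -/

/-- Specimens whose context is `C` with a token at `p`. -/
structure SpecimenAt (𝒞 : Set (Hypernet S)) (T : Hypernet S → Hypernet S → Prop)
    (C : PreNet S) (p : C.V) (t : Token) (H₁ H₂ : Hole → PreNet S) : Prop where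
  isContext : C.IsContext
  focusFree : C.FocusFree
  star : C.vlab p = .star
  mem : C.toNet ∈ 𝒞
  related : ∀ χ, C.Occurs (.hole χ) → T (H₁ χ).toNet (H₂ χ).toNet
  type₁ : ∀ χ, C.Occurs (.hole χ) → (H₁ χ).HasType χ.dom χ.cod
  type₂ : ∀ χ, C.Occurs (.hole χ) → (H₂ χ).HasType χ.dom χ.cod
  isState₁ : ((plugNet Set.univ H₁ C).focus (.inl p) t).IsState
  isState₂ : ((plugNet Set.univ H₂ C).focus (.inl p) t).IsState

theorem wf_of_related {T : Hypernet S → Hypernet S → Prop} (hT : IsPreTemplate T)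
    {H₁ H₂ : PreNet S} (h : T H₁.toNet H₂.toNet) : H₁.WF ∧ H₂.WF := by
  obtain ⟨dom, cod, ⟨G₁, e₁, h₁, -⟩, ⟨G₂, e₂, h₂, -⟩⟩ := hT _ _ h
  exact ⟨(toNet_eq_iff.1 e₁).wf h₁.1, (toNet_eq_iff.1 e₂).wf h₂.1⟩

theorem plugAll_focus_iso {C : PreNet S} {H : Hole → PreNet S}
    (hH : ∀ χ, C.Occurs (.hole χ) → (H χ).WF) (p : C.V) (t : Token) :
    Iso ((plugNet Set.univ H C).focus (.inl p) t) ((C.focus p t).plugAll H) :=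
  plug_focus (fun q => (hH _ (occurs_iff.2 (.inl ⟨_, q.2.1⟩))).shallow) p t

section

variable {𝒞 : Set (Hypernet S)} {T : Hypernet S → Hypernet S → Prop} {C : PreNet S}
  {H₁ H₂ : Hole → PreNet S}

/-- The token edge of the context becomes a position in its underlying context, shared by both
states. The pre-template property makes the plugged hypernets well-formed, as `plug_focus` requires.
-/
theorem Specimen.exists_specimenAt (hT : IsPreTemplate T) (h : Specimen 𝒞 T C H₁ H₂) :
    ∃ (p : C.underlying.V) (t : Token), Iso C (C.underlying.focus p t) ∧
      SpecimenAt 𝒞 T C.underlying p t H₁ H₂ ∧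
      (C.plugAll H₁).toNet = ((plugNet Set.univ H₁ C.underlying).focus (.inl p) t).toNet ∧
      (C.plugAll H₂).toNet = ((plugNet Set.univ H₂ C.underlying).focus (.inl p) t).toNet := by
  obtain ⟨p, t, j⟩ := h.focussed.exists_focus h.isContext.1
  have hf := j.focussed h.focussed
  have hc := j.isContext h.isContext
  have hocc : ∀ {χ}, C.underlying.Occurs (.hole χ) → C.Occurs (.hole χ) :=
    fun hχ => j.symm.occurs (occurs_focus hχ)
  have j₁ : Iso (C.plugAll H₁) ((plugNet Set.univ H₁ C.underlying).focus (.inl p) t) :=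
    (j.plug (fun χ => Iso.refl (H₁ χ)) fun _ _ => Iff.rfl).trans (plugAll_focus_iso
      (fun χ hχ => (wf_of_related hT (h.related χ (hocc hχ))).1) p t).symm
  have j₂ : Iso (C.plugAll H₂) ((plugNet Set.univ H₂ C.underlying).focus (.inl p) t) :=
    (j.plug (fun χ => Iso.refl (H₂ χ)) fun _ _ => Iff.rfl).trans (plugAll_focus_iso
      (fun χ hχ => (wf_of_related hT (h.related χ (hocc hχ))).2) p t).symm
  exact ⟨p, t, j, ⟨hc.of_focus (hc.1.of_focus hf), focusFree_of_focussed_focus hf,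
    hc.1.vlab_of_focus, h.mem, fun χ hχ => h.related χ (hocc hχ),
    fun χ hχ => h.type₁ χ (hocc hχ), fun χ hχ => h.type₂ χ (hocc hχ),
    j₁.isState h.isState₁, j₂.isState h.isState₂⟩, j₁.toNet_eq, j₂.toNet_eq⟩

theorem SpecimenAt.specimen (hT : IsPreTemplate T) {p : C.V} {t : Token}
    (h : SpecimenAt 𝒞 T C p t H₁ H₂) : Specimen 𝒞 T (C.focus p t) H₁ H₂ ∧
      ((C.focus p t).plugAll H₁).toNet = ((plugNet Set.univ H₁ C).focus (.inl p) t).toNet ∧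
      ((C.focus p t).plugAll H₂).toNet = ((plugNet Set.univ H₂ C).focus (.inl p) t).toNet := by
  have j₁ := plugAll_focus_iso (fun χ hχ => (wf_of_related hT (h.related χ hχ)).1) p t
  have j₂ := plugAll_focus_iso (fun χ hχ => (wf_of_related hT (h.related χ hχ)).2) p t
  refine ⟨⟨h.isContext.focus h.star, h.focusFree.focussed_focus
    (h.isContext.1.shallow.ins_outs p), ?_, fun χ hχ => h.related χ (hole_occurs_focus.1 hχ),
    fun χ hχ => h.type₁ χ (hole_occurs_focus.1 hχ),
    fun χ hχ => h.type₂ χ (hole_occurs_focus.1 hχ),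
    j₁.isState h.isState₁, j₂.isState h.isState₂⟩, j₁.toNet_eq.symm, j₂.toNet_eq.symm⟩
  rw [(underlying_focus h.focusFree.lab_ne p t).toNet_eq]
  exact h.mem

/-- Output-closure does not say which of the two hypernets is one-way, so both states have to be
rooted; the path of operation edges in the corresponding state then gives the contradiction. -/
theorem SpecimenAt.isOneWay (hT : IsPreTemplate T) {p : C.V} {t : Token}
    (h : SpecimenAt 𝒞 T C p t H₁ H₂) (hT' : OutputClosed T)
    (hr₁ : ((plugNet Set.univ H₁ C).focus (.inl p) t).toNet.Rooted)
    (hr₂ : ((plugNet Set.univ H₂ C).focus (.inl p) t).toNet.Rooted)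
    (q : PlugEdge Set.univ C) : p ∉ C.tgt (.inl q.1.1) := by
  intro hp
  have hocc : ∀ q : PlugEdge Set.univ C, C.Occurs (.hole q.1.2) :=
    fun q => occurs_iff.2 (.inl ⟨_, q.2.1⟩)
  have w := h.isContext.1.shallow
  obtain ⟨G, hG, how⟩ | ⟨G, hG, how⟩ := hT' _ _ (h.related _ (hocc q))
  · obtain ⟨r, hr, hpath⟩ := exists_opPath_of_rooted h.isState₁ hr₁
    obtain ⟨r, hr', rfl⟩ := List.mem_map.1 hr
    exact not_oneWay_of_opPath w
      (fun q => (wf_of_related hT (h.related _ (hocc q))).1.shallow) hr' h.star hpath q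
      (h.type₁ _ (hocc q)) hp ((toNet_eq_iff.1 hG).oneWay how)
  · obtain ⟨r, hr, hpath⟩ := exists_opPath_of_rooted h.isState₂ hr₂
    obtain ⟨r, hr', rfl⟩ := List.mem_map.1 hr
    exact not_oneWay_of_opPath w
      (fun q => (wf_of_related hT (h.related _ (hocc q))).2.shallow) hr' h.star hpath q
      (h.type₂ _ (hocc q)) hp ((toNet_eq_iff.1 hG).oneWay how)

/-- If the token of the context of a specimen is neither a rewrite token nor searching at a hole,
then both states are final, or they make the same step, or the first one is stuck. -/
theorem Specimen.step (hT : IsPreTemplate T) (hT' : OutputClosed T) (h : Specimen 𝒞 T C H₁ H₂)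
    (hr₁ : (C.plugAll H₁).toNet.Rooted) (hr₂ : (C.plugAll H₂).toNet.Rooted)
    (hrw : ¬ C.HasToken .rewrite) (hse : C.HasToken .search → ¬ C.Entering) :
    ((C.plugAll H₁).toNet.IsFinal ∧ (C.plugAll H₂).toNet.IsFinal) ∨
    (¬ (C.plugAll H₁).toNet.IsFinal ∧ ¬ ∃ Y, B.Step (C.plugAll H₁).toNet Y) ∨
    ∃ C', Specimen 𝒞 T C' H₁ H₂ ∧ ¬ (C'.HasToken .rewrite ∧ C'.Entering) ∧
      B.Step (C.plugAll H₁).toNet (C'.plugAll H₁).toNet ∧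
      B.Step (C.plugAll H₂).toNet (C'.plugAll H₂).toNet := by
  obtain ⟨p, t, j, hat, e₁, e₂⟩ := h.exists_specimenAt hT
  rw [e₁] at hr₁ ⊢
  rw [e₂] at hr₂ ⊢
  have htok : C.HasToken t := j.symm.hasToken hasToken_focus
  by_cases hf : ((plugNet Set.univ H₁ C.underlying).focus (.inl p) t).toNet.IsFinal
  -- Finality depends only on the label of the token and on `p` being an input of the context, which
  -- the two states share.
  · obtain ⟨ht, hp⟩ := (isFinal_focus hat.isState₁).1 hf
    obtain ⟨p₀, hp₀, hpe⟩ := List.mem_map.1 hp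
    exact .inl ⟨hf, (isFinal_focus hat.isState₂).2
      ⟨ht, List.mem_map.2 ⟨p₀, hp₀, congrArg Sum.inl (Sum.inl.inj hpe)⟩⟩⟩
  by_cases hst : ∃ Y, B.Step ((plugNet Set.univ H₁ C.underlying).focus (.inl p) t).toNet Y
  swap
  · exact .inr (.inl ⟨hf, hst⟩)
  refine .inr (.inr ?_)
  obtain ⟨Y, hst⟩ := hst
  have htr : t ≠ .rewrite := by
    rintro rfl
    exact hrw htok
  obtain hst | hst := hst
  swap
  · exact absurd (Rewrite.eq_rewrite (isState_focus.1 hat.isState₁).2.1 hst) htr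
  obtain ⟨x, s, hm, rfl⟩ := search_focus hst
  obtain ⟨p', rfl, hm'⟩ := hm.of_plug
    (fun q => (wf_of_related hT (hat.related _ (occurs_iff.2 (.inl ⟨_, q.2.1⟩)))).1.shallow)
    rfl (fun hs q hp => hse (hs ▸ htok) (j.symm.entering (entering_focus q.2.1 hp)))
    (fun _ => hat.isOneWay hT hT' hr₁ hr₂)
  have w := hat.isContext.1.shallow
  obtain ⟨s₁, m₁⟩ := hm'.plug.search hat.isState₁
  obtain ⟨s₂, m₂⟩ := hm'.plug.search hat.isState₂
  have hat' : SpecimenAt 𝒞 T C.underlying p' s H₁ H₂ :=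
    ⟨hat.isContext, hat.focusFree, hm'.vlab w hat.star, hat.mem, hat.related, hat.type₁, hat.type₂,
      s₁, s₂⟩
  obtain ⟨hsp, e₁', e₂'⟩ := hat'.specimen hT
  refine ⟨_, hsp, ?_, ?_, ?_⟩
  -- A rewrite token just created sits at a source of a contraction or an operation, hence not at a
  -- source of a hole.
  · rintro ⟨h1, h2⟩
    obtain rfl := hat.focusFree.eq_of_hasToken_focus h1
    obtain ⟨f, χ, hf, hp'⟩ := hat.focusFree.exists_of_entering_focus h2
    exact hm'.not_at_hole w hf hp'
  · rw [e₁']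
    exact .inl m₁
  · rw [e₂']
    exact .inl m₂

end

end Behaviour

end Spartan

namespace Spartan

/-! ### Reductions to final states -/

theorem StepsN.append {α : Type*} {r : α → α → Prop} {k l : ℕ} {x y z : α}
    (h : StepsN r k x y) (h' : StepsN r l y z) : StepsN r (k + l) x z := by
  induction k generalizing x with
  | zero =>
    obtain rfl : x = y := h
    rwa [Nat.zero_add]
  | succ k ih =>
    obtain ⟨v, hv, h⟩ := h
    rw [Nat.succ_add]
    exact ⟨v, hv, ih h⟩

theorem StepsN.single {α : Type*} {r : α → α → Prop} {x y : α} (h : r x y) : StepsN r 1 x y :=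
  ⟨y, h, rfl⟩

namespace Behaviour

open Hypernet PreNet

variable {S : OpSet.{u}} {B : Behaviour S}

theorem Refocusing.steps (h : B.Refocusing) {k : ℕ} {X Y : Hypernet S}
    (hs : StepsN B.Step k X Y) (hX : X.Rooted) : Y.Rooted := by
  induction k generalizing X with
  | zero =>
    obtain rfl : X = Y := hs
    exact hX
  | succ k ih =>
    obtain ⟨Z, hZ, hs⟩ := hs
    exact ih hs (h _ _ hZ hX)

/-- The run to `N` follows the given steps by determinism, and cannot be the shorter one because a
final state has no step. -/
theorem Deterministic.steps_final (hdet : B.Deterministic) {n k : ℕ} {X Y N : Hypernet S}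
    (hN : N.IsFinal) (hn : StepsN B.Step n X N) (hk : StepsN B.Step k X Y) :
    ∃ m, n = k + m ∧ StepsN B.Step m Y N := by
  induction k generalizing X n with
  | zero =>
    obtain rfl : X = Y := hk
    exact ⟨n, (Nat.zero_add n).symm, hn⟩
  | succ k ih =>
    obtain ⟨Z, hZ, hk⟩ := hk
    cases n with
    | zero =>
      obtain rfl : X = N := hn
      exact absurd hZ (not_step_of_isFinal hN)
    | succ n =>
      obtain ⟨Z', hZ', hn⟩ := hn
      obtain rfl := hdet _ _ _ hZ hZ'
      obtain ⟨m, rfl, hm⟩ := ih hn hk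
      exact ⟨m, Nat.add_right_comm k m 1, hm⟩

theorem eq_zero_of_isFinal {n : ℕ} {X N : Hypernet S} (hX : X.IsFinal)
    (hn : StepsN B.Step n X N) : n = 0 := by
  cases n with
  | zero => rfl
  | succ n =>
    obtain ⟨Z, hZ, -⟩ := hn
    exact absurd hZ (not_step_of_isFinal hX)

/-- Every state reachable from `X` lies on the unique run to `N`, so it is final or has a step. This
discards the stuck alternatives of input-safety and robustness. -/
theorem Deterministic.not_stuck (hdet : B.Deterministic) {n : ℕ} {X Y N : Hypernet S}
    (hN : N.IsFinal) (hn : StepsN B.Step n X N) (h : Relation.ReflTransGen B.Step X Y) :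
    ¬ B.Stuck Y := by
  induction h using Relation.ReflTransGen.head_induction_on generalizing n with
  | refl =>
    rintro ⟨-, hf, hst⟩
    cases n with
    | zero =>
      obtain rfl : Y = N := hn
      exact hf hN
    | succ n =>
      obtain ⟨Z, hZ, -⟩ := hn
      exact hst ⟨Z, hZ⟩
  | head hXZ _ ih =>
    obtain ⟨m, -, hm⟩ := hdet.steps_final hN hn (.single hXZ)
    exact ih hm

/-- A counting simulation, up to refinements, implies refinement. -/
theorem StateRefines.of_simulation {Q Q' Q'' : ℕ → ℕ → Prop} (hdet : B.Deterministic)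
    (hQ : Reasonable Q Q' Q'') {R : Hypernet S → Hypernet S → Prop}
    (hR : ∀ X Y, R X Y → ∀ n N, N.IsFinal → StepsN B.Step n X N →
      (∃ k N', N'.IsFinal ∧ Q n k ∧ StepsN B.Step k Y N') ∨
      ∃ k l X₁ Y₁ X₂ Y₂, 0 < k ∧ Q k l ∧ StepsN B.Step k X X₁ ∧ StepsN B.Step l Y Y₁ ∧
        B.StateRefines Q' X₁ X₂ ∧ R X₂ Y₂ ∧ B.StateRefines Q'' Y₂ Y₁)
    {X Y : Hypernet S} (h : R X Y) : B.StateRefines Q X Y := by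
  intro n
  induction n using Nat.strong_induction_on generalizing X Y with
  | _ n ih =>
    intro N hN hn
    obtain ⟨k, N', h⟩ | ⟨k, l, X₁, Y₁, X₂, Y₂, hk, hkl, hX, hY, hX', hR', hY'⟩ :=
      hR X Y h n N hN hn
    · exact ⟨k, N', h⟩
    · obtain ⟨m, rfl, hm⟩ := hdet.steps_final hN hn hX
      obtain ⟨m', N', hN', hmm, hm'⟩ := hX' m N hN hm
      -- The remaining run from `X₂` has length `m' ≤ m`, and `m < k + m` as `k` is positive; so the
      -- induction hypothesis applies.
      have := hQ.ge _ _ hmm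
      obtain ⟨a, A, hA, hma, ha⟩ := ih m' (by omega) hR' N' hN' hm'
      obtain ⟨b, A', hA', hab, hb⟩ := hY' a A hA ha
      -- The chain `Q' m m'`, `Q m' a`, `Q'' a b` collapses to `Q m b`, which is added to `Q k l`.
      exact ⟨l + b, A', hA', hQ.add _ _ _ _ hkl (hQ.comp _ _ _ _ hmm hma hab), hY.append hb⟩

/-! ### Related states -/

variable {𝒞 : Set (Hypernet S)} {Q Q' Q'' : ℕ → ℕ → Prop} {T : Hypernet S → Hypernet S → Prop}

/-- The rooted states of a specimen without an entering rewrite token. -/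
def Related (𝒞 : Set (Hypernet S)) (T : Hypernet S → Hypernet S → Prop) (X Y : Hypernet S) :
    Prop :=
  ∃ C H₁ H₂, Specimen 𝒞 T C H₁ H₂ ∧ (C.plugAll H₁).toNet = X ∧ (C.plugAll H₂).toNet = Y ∧
    X.Rooted ∧ Y.Rooted ∧ ¬ (C.HasToken .rewrite ∧ C.Entering)

/-- A consequence of input-safety that holds for a template and for the converse of a template: only
the first state is required to get stuck, and there may be no step to the new specimen. -/
def WeaklyInputSafe (B : Behaviour S) (𝒞 : Set (Hypernet S)) (Q Q' Q'' : ℕ → ℕ → Prop)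
    (T : Hypernet S → Hypernet S → Prop) : Prop :=
  ∀ C H₁ H₂, Specimen 𝒞 T C H₁ H₂ → C.HasToken .search → C.Entering →
    (∃ N, B.Stuck N ∧ Relation.ReflTransGen B.Step (C.plugAll H₁).toNet N) ∨
    (∃ C' H₁' H₂' k₁ k₂, Specimen 𝒞 T C' H₁' H₂' ∧
      ¬ C'.HasToken .rewrite ∧ ¬ C'.Entering ∧ Q k₁ k₂ ∧
      StepsN B.Step k₁ (C.plugAll H₁).toNet (C'.plugAll H₁').toNet ∧
      StepsN B.Step k₂ (C.plugAll H₂).toNet (C'.plugAll H₂').toNet) ∨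
    (∃ N₁ N₂ t k₁ k₂, QuasiSpecimen 𝒞 T (B.StateRefines Q') (B.StateRefines Q'') t N₁ N₂ ∧
      t ≠ .rewrite ∧ 0 < k₁ ∧ Q k₁ k₂ ∧
      StepsN B.Step k₁ (C.plugAll H₁).toNet N₁ ∧ StepsN B.Step k₂ (C.plugAll H₂).toNet N₂)

theorem StateRefines.mono {Q₁ Q₂ : ℕ → ℕ → Prop} (h : ∀ k l, Q₁ k l → Q₂ k l) {X Y : Hypernet S}
    (hXY : B.StateRefines Q₁ X Y) : B.StateRefines Q₂ X Y := fun k N hN hk => by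
  obtain ⟨l, N', hN', hkl, hl⟩ := hXY k N hN hk
  exact ⟨l, N', hN', h _ _ hkl, hl⟩

theorem Specimen.converse {C : PreNet S} {H₁ H₂ : Hole → PreNet S}
    (h : Specimen 𝒞 T C H₁ H₂) : Specimen 𝒞 (fun X Y => T Y X) C H₂ H₁ :=
  ⟨h.isContext, h.focussed, h.mem, h.related, h.type₂, h.type₁, h.isState₂, h.isState₁⟩

/-- Of each state equivalence only the direction from the first to the second state is kept, and the
second one is loosened from `Q'` to `Q''`. -/
theorem InputSafe.weakly (hQ' : ∀ k l, Q' k l → Q'' k l) (h : B.InputSafe 𝒞 Q Q' T) :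
    B.WeaklyInputSafe 𝒞 Q Q' Q'' T := by
  intro C H₁ H₂ hsp ht he
  obtain ⟨N₁, _, hN₁, -, h₁, -⟩ | ⟨C', H₁', H₂', k₁, k₂, h⟩ |
    ⟨N₁, N₂, t, k₁, k₂, ⟨s₁, s₂, C', H₁', H₂', hsp', t₀, t₁, t₂, hR⟩, htr, hk, h₁, h₂⟩ :=
    h C H₁ H₂ hsp ht he
  · exact .inl ⟨N₁, hN₁, h₁⟩
  · exact .inr (.inl ⟨C', H₁', H₂', 1 + k₁, k₂, h⟩)
  · refine .inr (.inr ⟨N₁, N₂, t, 1 + k₁, 1 + k₂, ⟨s₁, s₂, C', H₁', H₂', hsp', t₀, t₁, t₂,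
      fun r₁ r₂ => ?_⟩, htr, by omega, hk, h₁, h₂⟩)
    obtain ⟨r₁', r₂', e₁, e₂⟩ := hR r₁ r₂
    exact ⟨r₁', r₂', e₁.1, e₂.1.mono hQ'⟩

/-- The two runs exchange roles, so in alternative (II) the guaranteed step falls to the second
state and the first may not move at all; alternative (III) has a step on both sides. The refinements
needed are the backward halves of the equivalences. -/
theorem InputSafe.weakly_converse (hQ' : ∀ k l, Q' k l → Q'' k l)
    (h : B.InputSafe 𝒞 (fun k l => Q l k) Q' T) :
    B.WeaklyInputSafe 𝒞 Q Q' Q'' (fun X Y => T Y X) := by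
  intro C H₁ H₂ hsp ht he
  obtain ⟨_, N₂, -, hN₂, -, h₂⟩ | ⟨C', H₁', H₂', k₁, k₂, hsp', hr, he', hk, h₁, h₂⟩ |
    ⟨N₁, N₂, t, k₁, k₂, ⟨s₁, s₂, C', H₁', H₂', hsp', t₀, t₁, t₂, hR⟩, htr, hk, h₁, h₂⟩ :=
    h C H₂ H₁ hsp.converse ht he
  · exact .inl ⟨N₂, hN₂, h₂⟩
  · exact .inr (.inl ⟨C', H₂', H₁', k₂, 1 + k₁, hsp'.converse, hr, he', hk, h₂, h₁⟩)
  · refine .inr (.inr ⟨N₂, N₁, t, 1 + k₂, 1 + k₁, ⟨s₂, s₁, C', H₂', H₁', hsp'.converse, t₀, t₂, t₁,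
      fun r₂ r₁ => ?_⟩, htr, by omega, hk, h₂, h₁⟩)
    obtain ⟨r₁', r₂', e₁, e₂⟩ := hR r₁ r₂
    exact ⟨r₂', r₁', e₂.2, e₁.2.mono hQ'⟩

theorem _root_.Spartan.PreNet.Focussed.eq_of_hasToken {G : PreNet S} (h : G.Focussed) {s t : Token}
    (hs : G.HasToken s) (ht : G.HasToken t) : s = t := by
  obtain ⟨e, he⟩ := hs
  obtain ⟨e', he'⟩ := ht
  obtain rfl := h.1.unique ⟨s, he⟩ ⟨t, he'⟩
  exact ELabel.token.inj (he.symm.trans he')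

/-- A token that is not a rewrite token meets the invariant of `Related` on entering rewrite tokens
trivially. -/
theorem QuasiSpecimen.exists_related {R R' : Hypernet S → Hypernet S → Prop} {t : Token}
    {N₁ N₂ : Hypernet S} (h : QuasiSpecimen 𝒞 T R R' t N₁ N₂) (ht : t ≠ .rewrite)
    (h₁ : N₁.Rooted) (h₂ : N₂.Rooted) : ∃ X Y, R N₁ X ∧ Related 𝒞 T X Y ∧ R' Y N₂ := by
  obtain ⟨-, -, C, H₁, H₂, hsp, htok, -, -, h⟩ := h
  obtain ⟨r₁, r₂, e₁, e₂⟩ := h h₁ h₂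
  exact ⟨_, _, e₁, ⟨C, H₁, H₂, hsp, rfl, rfl, r₁, r₂,
    fun h' => ht (hsp.focussed.eq_of_hasToken htok h'.1)⟩, e₂⟩

/-- Of the outcomes of `Specimen.step`, a first state that is neither final nor able to step is
ruled out by its run to a final state. -/
theorem Specimen.related_step (hT : IsPreTemplate T) (hout : OutputClosed T)
    (hrefocus : B.Refocusing) {C : PreNet S} {H₁ H₂ : Hole → PreNet S}
    (h : Specimen 𝒞 T C H₁ H₂) (hr₁ : (C.plugAll H₁).toNet.Rooted)
    (hr₂ : (C.plugAll H₂).toNet.Rooted) (hrw : ¬ C.HasToken .rewrite)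
    (hse : C.HasToken .search → ¬ C.Entering) {n : ℕ} {N : Hypernet S} (hN : N.IsFinal)
    (hn : StepsN B.Step n (C.plugAll H₁).toNet N) :
    (n = 0 ∧ (C.plugAll H₂).toNet.IsFinal) ∨
    ∃ X Y, B.Step (C.plugAll H₁).toNet X ∧ B.Step (C.plugAll H₂).toNet Y ∧ Related 𝒞 T X Y := by
  obtain ⟨hf₁, hf₂⟩ | ⟨hf, hst⟩ | ⟨C', hsp, hne, h₁, h₂⟩ := h.step (B := B) hT hout hr₁ hr₂ hrw hse
  · exact .inl ⟨eq_zero_of_isFinal hf₁ hn, hf₂⟩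
  · cases n with
    | zero => exact absurd ((show _ = N from hn) ▸ hN) hf
    | succ n =>
      obtain ⟨Z, hZ, -⟩ := hn
      exact absurd ⟨Z, hZ⟩ hst
  · exact .inr ⟨_, _, h₁, h₂, C', H₁, H₂, hsp, rfl, rfl, hrefocus _ _ h₁ hr₁, hrefocus _ _ h₂ hr₂,
      hne⟩

/-- Safe and robust relations give rise to counting simulations. -/
theorem Related.stateRefines (hdet : B.Deterministic) (hrefocus : B.Refocusing)
    (hQ : Reasonable Q Q' Q'') (hT : IsPreTemplate T) (hout : OutputClosed T)
    (hin : B.WeaklyInputSafe 𝒞 Q Q' Q'' T) (hrob : B.Robust 𝒞 Q Q' Q'' T) {X Y : Hypernet S}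
    (h : Related 𝒞 T X Y) : B.StateRefines Q X Y := by
  have refl : ∀ k, Q k k := hQ.preorder.refl
  have refl' : ∀ X, B.StateRefines Q' X X := fun X k N hN hk =>
    ⟨k, N, hN, hQ.preorder'.refl k, hk⟩
  have refl'' : ∀ X, B.StateRefines Q'' X X := fun X k N hN hk =>
    ⟨k, N, hN, hQ.preorder''.refl k, hk⟩
  refine StateRefines.of_simulation hdet hQ (R := Related 𝒞 T) ?_ h
  clear h X Y
  rintro _ _ ⟨C, H₁, H₂, hsp, rfl, rfl, hr₁, hr₂, hne⟩ n N hN hn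
  by_cases hrw : C.HasToken .rewrite
  · have hent : ¬ C.Entering := fun he => hne ⟨hrw, he⟩
    obtain ⟨p, t, j, hat, e₁, -⟩ := hsp.exists_specimenAt hT
    obtain rfl := hsp.focussed.eq_of_hasToken (j.symm.hasToken hasToken_focus) hrw
    cases n with
    | zero =>
      obtain rfl : _ = N := hn
      rw [e₁] at hN
      cases ((isFinal_focus hat.isState₁).1 hN).1
    | succ n =>
      obtain ⟨Z, hZ, hn⟩ := hn
      obtain hZ' | hZ' := id hZ
      · rw [e₁] at hZ'
        obtain ⟨q, s, hm, -⟩ := search_focus hZ'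
        exact absurd rfl hm.ne_rewrite
      -- Alternative (I) contradicts that both states are rooted, and (II) that the first one
      -- reaches a final state. In (III), the rewrite transition is the extra step in `1 + k₁`.
      obtain hnr | ⟨N'', hN'', hZN⟩ | ⟨N₁, N₂, t, k₁, k₂, hq, ht, hk, h₁, h₂⟩ :=
        hrob _ _ hZ' C H₁ H₂ hsp rfl hrw hent
      · exact absurd hnr (by simp [hr₁, hr₂])
      · exact absurd hN'' (hdet.not_stuck hN hn hZN)
      · have h₁' : StepsN B.Step (1 + k₁) (C.plugAll H₁).toNet N₁ := (StepsN.single hZ).append h₁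
        obtain ⟨X, Y, hX, hXY, hY⟩ :=
          hq.exists_related ht (hrefocus.steps h₁' hr₁) (hrefocus.steps h₂ hr₂)
        exact .inr ⟨1 + k₁, k₂, N₁, N₂, X, Y, by omega, hk, h₁', h₂, hX, hXY, hY⟩
  · by_cases hse : C.HasToken .search ∧ C.Entering
    · obtain ⟨N', hN', hst⟩ | ⟨C', H₁', H₂', k₁, k₂, hsp', hrw', hent', hk, h₁, h₂⟩ |
        ⟨N₁, N₂, t, k₁, k₂, hq, ht, hpos, hk, h₁, h₂⟩ := hin C H₁ H₂ hsp hse.1 hse.2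
      · exact absurd hN' (hdet.not_stuck hN hn hst)
      -- Since `k₁` may be `0`, a step common to both states of the new specimen is appended to make
      -- progress; if instead these states are final, the simulation ends there.
      · obtain ⟨m, rfl, hm⟩ := hdet.steps_final hN hn h₁
        obtain ⟨rfl, hf⟩ | ⟨X, Y, hX, hY, hXY⟩ := hsp'.related_step hT hout hrefocus
          (hrefocus.steps h₁ hr₁) (hrefocus.steps h₂ hr₂) hrw' (fun _ => hent') hN hm
        · exact .inl ⟨k₂, _, hf, hk, h₂⟩
        · exact .inr ⟨k₁ + 1, k₂ + 1, X, Y, X, Y, by omega, hQ.add _ _ _ _ hk (refl 1),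
            h₁.append (.single hX), h₂.append (.single hY), refl' X, hXY, refl'' Y⟩
      · obtain ⟨X, Y, hX, hXY, hY⟩ :=
          hq.exists_related ht (hrefocus.steps h₁ hr₁) (hrefocus.steps h₂ hr₂)
        exact .inr ⟨k₁, k₂, N₁, N₂, X, Y, hpos, hk, h₁, h₂, hX, hXY, hY⟩
    · obtain ⟨rfl, hf⟩ | ⟨X, Y, hX, hY, hXY⟩ :=
        hsp.related_step hT hout hrefocus hr₁ hr₂ hrw (fun h he => hse ⟨h, he⟩) hN hn
      · exact .inl ⟨0, _, hf, refl 0, rfl⟩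
      · exact .inr ⟨1, 1, X, Y, X, Y, one_pos, refl 1, .single hX, .single hY, refl' X, hXY,
          refl'' Y⟩

/-- The two initial states form a specimen with the token at the input of the context. They are
rooted by the empty sequence of search transitions, and their token is a search token, so they are
`Related`. -/
theorem ctxtRefines_of_robust (hdet : B.Deterministic) (hrefocus : B.Refocusing)
    (hQ : Reasonable Q Q' Q'') (hT : IsPreTemplate T) (hout : OutputClosed T)
    (hin : B.WeaklyInputSafe 𝒞 Q Q' Q'' T) (hrob : B.Robust 𝒞 Q Q' Q'' T) {X₁ X₂ : Hypernet S}
    (h : T X₁ X₂) : B.CtxtRefines 𝒞 Q X₁ X₂ := by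
  rintro C H₁ H₂ χ rfl rfl hC hχ hff ht₁ ht₂ hs₁ hs₂
  -- As `χ` is the only hole of `C`, plugging into `χ` and plugging a constant family into all holes
  -- agree.
  have hj : ∀ H : PreNet S, Iso (C.plugOne χ H) (plugNet Set.univ (fun _ => H) C) := fun H => by
    rw [← plug_eq]
    exact (Iso.refl C).plug (fun _ => Iso.refl H) fun χ' hχ' =>
      ⟨fun _ => Set.mem_univ _, fun _ => (hχ.2 χ').1 hχ'⟩
  obtain ⟨i, hi⟩ : ∃ i, C.ins = [i] := by
    have hs := hs₁
    rw [plugOne, plug_eq] at hs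
    obtain ⟨v, hv⟩ := hs.exists_ins_of_start
    obtain ⟨i, hi, -⟩ := List.map_eq_singleton_iff.1 hv
    exact ⟨i, hi⟩
  have hi' : ∀ H : PreNet S, (plugNet Set.univ (fun _ => H) C).ins = [Sum.inl i] := fun H => by
    change C.ins.map Sum.inl = _
    rw [hi]
    rfl
  have j₁ := hs₁.start_iso_focus (hj H₁) (hi' H₁)
  have j₂ := hs₂.start_iso_focus (hj H₂) (hi' H₂)
  have s₁ := j₁.isState hs₁
  have s₂ := j₂.isState hs₂
  have hat : SpecimenAt 𝒞 T C i .search (fun _ => H₁) (fun _ => H₂) :=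
    ⟨hχ.1, hff, (isState_focus.1 s₁).2.2.2.2, hC, fun _ _ => h,
      fun χ' hχ' => (hχ.2 χ').1 hχ' ▸ ht₁, fun χ' hχ' => (hχ.2 χ').1 hχ' ▸ ht₂, s₁, s₂⟩
  obtain ⟨hsp, e₁, e₂⟩ := hat.specimen hT
  rw [j₁.toNet_eq, j₂.toNet_eq]
  refine Related.stateRefines hdet hrefocus hQ hT hout hin hrob
    ⟨_, _, _, hsp, e₁, e₂, rooted_focus_ins s₁ (hi' H₁), rooted_focus_ins s₂ (hi' H₂), fun h' => ?_⟩
  cases hsp.focussed.eq_of_hasToken hasToken_focus h'.1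

end Behaviour

end Spartan

/-! ### The theorem -/

theorem mainTheorem1 {S : Spartan.OpSet.{u}} (B : Spartan.Behaviour S)
    (hdet : B.Deterministic) (hrefocus : B.Refocusing)
    (𝒞 : Set (Spartan.Hypernet S)) (h𝒞 : Spartan.IsContextSet 𝒞)
    (hplug : Spartan.ClosedUnderPlugging 𝒞)
    (Q Q' Q'' : ℕ → ℕ → Prop) (hQ : Spartan.Reasonable Q Q' Q'')
    (T : Spartan.Hypernet S → Spartan.Hypernet S → Prop) (hT : Spartan.IsPreTemplate T) :
    (B.IsTemplate 𝒞 Q Q' T → B.Robust 𝒞 Q Q' Q'' T →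
      ∀ G₁ G₂, T G₁ G₂ → B.CtxtRefines 𝒞 Q G₁ G₂) ∧
    (B.IsTemplate 𝒞 (fun k l => Q l k) Q' T → B.Robust 𝒞 Q Q' Q'' (fun G H => T H G) →
      ∀ G₁ G₂, T G₁ G₂ → B.CtxtRefines 𝒞 Q G₂ G₁) := by
  refine ⟨fun ht hr G₁ G₂ h => ?_, fun ht hr G₁ G₂ h => ?_⟩
  · exact Spartan.Behaviour.ctxtRefines_of_robust hdet hrefocus hQ hT ht.2 (ht.1.weakly hQ.sub) hr h
  -- The same argument for the converse relation: being a pre-template and output-closure are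
  -- symmetric in the two hypernets, and reversing both `Q` and the relation turns input-safety into
  -- the weak form for `Q`.
  · refine Spartan.Behaviour.ctxtRefines_of_robust hdet hrefocus hQ (fun X₁ X₂ hX => ?_)
      (fun X₁ X₂ hX => (ht.2 X₂ X₁ hX).symm) (ht.1.weakly_converse hQ.sub) hr h
    obtain ⟨dom, cod, h₂, h₁⟩ := hT X₂ X₁ hX
    exact ⟨dom, cod, h₁, h₂⟩
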